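/- **Setting.** Let $d=d_S+d_A\ge 1$, $\mathcal S=[-1,1]^{d_S}$, $\mathcal A=[-1,1]^{d_A}$, $\mathcal Z=\mathcal S\times\mathcal A=[-1,1]^d$, $H\ge 1$. An MDP consists of transition kernels $p_h(\cdot\mid z)$ on $\mathcal S$ and rewards $R_h(z)\in[0,1]$, for $z\in\mathcal Z$ and $1\le h\le H$; $\mathcal T_hf(z)=R_h(z)+\mathbb E_{s'\sim p_h(\cdot|z)}[\sup_{a'}f(s',a')]$ is its Bellman optimality operator, $Q^*_{H+1}=0$ and $Q^*_h=\mathcal T_hQ^*_{h+1}$. The space $\mathcal C^{\nu,1}_p(\mathcal Z)$ consists of the functions whose $2$-periodic extension is $C^\nu$ with $\|f\|_{\mathcal C^{\nu,1}}=\max_{|\alpha|\le\nu+1}\|D^\alpha f\|_{L^\infty}<\infty$ (the derivatives of order $\nu+1$ are weak ones). The MDP is $\nu$-smooth with constant $C_{\mathcal T}$ if $\mathcal T_h$ maps $\mathcal C^{\nu,1}_p(\mathcal Z)$ into itself and $\|\mathcal T_hf\|_{\mathcal C^{\nu,1}}\le C_{\mathcal T}(\|f\|_{\mathcal C^{\nu,1}}+1)$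 for all $h$ and all $f\in\mathcal C^{\nu,1}_p(\mathcal Z)$. For $n\in\mathbb Z$ let $\mathrm{soc}(n,x)$ be $1$, $\sin(n\pi x)$, $\cos(n\pi x)$ for $n=0$, $n>0$, $n<0$. Let $\varphi_N(z)$ be the vector of the $\widetilde N$ functions $\prod_i\mathrm{soc}(n_i,z_i)$, $n\in\mathbb Z^d$, $\|n\|_1\le N$. Let $D_n^0(z)=2^{-d}\sum_{\|k\|_1\le n}e^{i\pi k\cdot z}$ and, for even $N\ge2$, let $D_N=\frac1{N/2+1}\sum_{n=N/2}^{N}D_n^0$ be the de la Vallée Poussin kernel. Write $D_N=\beta_+D_N^+-\beta_-D_N^-$, where $D_N^\pm$ are the positive and the negative part of $D_N$, normalized to probability densities on $[-1,1]^d$. Let $*$ be circular convolution on $[-1,1]^d$, and let $\widetilde Q_{H+1}=0$, $\widetilde Q_h=D_N*\mathcal T_h\widetilde Q_{h+1}$. A quasi-optimal design is a finitely supported probability distribution $\rho$ on $\mathcal Z$ with $|\mathrm{supp}(\rho)|\le4\widetilde N\log\log\widetilde N$ for which $\Sigma=\mathbb E_{z\sim\rho}[\varphi_N(z)\varphi_N(z)^\top]$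 is invertible and $\varphi_N(z)^\top\Sigma^{-1}\varphi_N(z)\le2\widetilde N$ for all $z\in\mathcal Z$. **Algorithm** (inputs $N$, $n_{\rm tot}$, $\rho$). For each stage $h$ let $\mathcal D_h$ contain $\lceil n_{\rm tot}\rho(z)\rceil$ copies of each $z\in\mathrm{supp}(\rho)$. Put $\widehat Q_{H+1}=0$. For $h=H,\dots,1$ and each element $z$ of $\mathcal D_h$ draw, all independently, $\eta_\pm\sim D_N^\pm$ and query the generative model at $z+\eta_\pm$ (modulo $2$), which gives $r^\pm=R_h(z+\eta_\pm)$ and $s^\pm\sim p_h(\cdot\mid z+\eta_\pm)$; the target is $\beta_+r^+-\beta_-r^-+\beta_+\widehat V_{h+1}(s^+)-\beta_-\widehat V_{h+1}(s^-)$ with $\widehat V_{h+1}(s)=\max_a\widehat Q_{h+1}(s,a)$. Then $\widehat Q_h=\varphi_N^\top\widehat\theta_h$, where $\widehat\theta_h$ is the least-squares fit of the targets by $\varphi_N$ on $\mathcal D_h$. The number of samples per stage is $n=2\sum_{z\in\mathrm{supp}(\rho)}\lceil n_{\rm tot}\rho(z)\rceil$. **Theorem.** In every dimension $d$ there is a constant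 $\Lambda_d$ with $\|D_N\|_{L^1([-1,1]^d)}\le\Lambda_d$ for all even $N\ge 2$. For every $\nu\in\mathbb N$ and every $C_{\mathcal T}$ there is $c\in\mathbb N$, depending only on $\nu$ and $C_{\mathcal T}$, such that for all $d_S,d_A,H$ as above and every such $\Lambda_d$ there is a constant $C_N$ (which does not depend on $\varepsilon,\delta$) with the following property. For every $0<\varepsilon<1$ there is an even $N\ge2$ with $N\le C_N\varepsilon^{-1/(\nu+1)}$ for which quasi-optimal designs exist, and for every $\delta>0$ there is $n_{\rm tot}\in\mathbb N$, such that for every quasi-optimal design $\rho$ the number of samples per stage satisfies $$n\le K(H,d)\,\varepsilon^{-\frac{d+2(\nu+1)}{\nu+1}}\Bigl(1+\log\tfrac1\varepsilon+\log\bigl(1+\tfrac1\delta\bigr)\Bigr)^{c},\qquad K(H,d)=(c\,\Lambda_d)^{cHd},$$ and, on every MDP that is $\nu$-smooth with constant $C_{\mathcal T}$, the algorithm run with $N$, $n_{\rm tot}$ and $\rho$ satisfies, with probability at least $1-\delta$, simultaneously for all $h=1,\dots,H$, $$\|Q^*_h-\widehat Q_h\|_\infty<\frac{\varepsilon}{(3\Lambda_d)^h}\qquad\text{and}\qquad\|\widetilde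 Q_h-\widehat Q_h\|_\infty<\frac{\varepsilon}{(3\Lambda_d)^h}.$$ -/

import Mathlib

open MeasureTheory ProbabilityTheory
open scoped ENNReal

noncomputable section

namespace SmoothMDP

/-! ### The cube, trigonometric features and circular convolution -/

/-- The cube `[-1,1]^d`. -/
abbrev Cube (d : ℕ) : Type := Set.Icc (-1 : Fin d → ℝ) 1

/-- Lebesgue measure on the cube. -/
instance cubeMeasureSpace (d : ℕ) : MeasureSpace (Cube d) := Measure.Subtype.measureSpace

/-- Reduction of a point of `ℝ^d` to the cube, coordinate by coordinate and modulo the period `2`. -/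
def wrap {d : ℕ} (x : Fin d → ℝ) : Cube d :=
  ⟨fun i => toIcoMod (zero_lt_two' ℝ) (-1) (x i),
    fun i => (toIcoMod_mem_Ico (zero_lt_two' ℝ) (-1) (x i)).1, fun i => by
      have h := (toIcoMod_mem_Ico (zero_lt_two' ℝ) (-1) (x i)).2
      simp only [Pi.one_apply]
      linarith⟩

/-- The extension by periodicity of a function on the cube. -/
def periodicExt {d : ℕ} (f : Cube d → ℝ) : (Fin d → ℝ) → ℝ := fun x => f (wrap x)

/-- The multi-frequencies `n ∈ ℤ^d` with `‖n‖₁ ≤ N`. -/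
def freqs (d N : ℕ) : Finset (Fin d → ℤ) :=
  (Fintype.piFinset fun _ => Finset.Icc (-(N : ℤ)) N).filter fun n => ∑ i, |n i| ≤ (N : ℤ)

/-- The index type of the trigonometric feature map of degree `N`. -/
abbrev FeatIdx (d N : ℕ) : Type := {n : Fin d → ℤ // n ∈ freqs d N}

/-- The number `Ñ` of trigonometric features of degree at most `N`. -/
def numFeatures (d N : ℕ) : ℕ := (freqs d N).card

/-- The univariate trigonometric monomial. -/
def soc (n : ℤ) (z : ℝ) : ℝ :=
  if n = 0 then 1 else if 0 < n then Real.sin (n * Real.pi * z) else Real.cos (n * Real.pi * z)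

/-- The feature map `φ_N`, which stacks all the monomials of degree at most `N`. -/
def feature {d : ℕ} (N : ℕ) (z : Cube d) : FeatIdx d N → ℝ :=
  fun n => ∏ i, soc (n.1 i) (z.1 i)

/-- The Dirichlet kernel of order `n` on `[-1,1]^d`: the sum of `exp (iπ k·z)` over `‖k‖₁ ≤ n`
(a real number, since the frequencies come in pairs `±k`). The factor `2^{-d}` makes the circular
convolution with it, taken with respect to Lebesgue measure on the cube, equal to the truncation
of the Fourier series to degree `n`. -/
def dirichletKernel {d : ℕ} (n : ℕ) (z : Fin d → ℝ) : ℝ :=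
  (∑ k ∈ freqs d n, Real.cos (Real.pi * ∑ i, (k i : ℝ) * z i)) / 2 ^ d

/-- The de la Vallée Poussin kernel `D_N` (for even `N`). -/
def vpKernel {d : ℕ} (N : ℕ) (z : Fin d → ℝ) : ℝ :=
  (∑ n ∈ Finset.Icc (N / 2) N, dirichletKernel n z) / (((N / 2 : ℕ) : ℝ) + 1)

/-- `Λ` bounds the `L¹` norms of all the de la Vallée Poussin kernels in dimension `d`:
it is an admissible value of the constant `Λ_d`. -/
def IsVPBound (d : ℕ) (L : ℝ) : Prop :=
  ∀ N : ℕ, 0 < N → Even N → ∫ z : Cube d, |vpKernel N z.1| ≤ L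

/-- Circular convolution of a periodic kernel with a function on the cube. -/
def circConv {d : ℕ} (D : (Fin d → ℝ) → ℝ) (f : Cube d → ℝ) : Cube d → ℝ :=
  fun x => ∫ y : Cube d, f y * D (x.1 - y.1)

/-! ### The periodic spaces `C_p^{ν,1}` -/

/-- The partial derivative `∂_{i_1} ⋯ ∂_{i_k} g`. -/
def partialDeriv {d k : ℕ} (g : (Fin d → ℝ) → ℝ) (i : Fin k → Fin d) (x : Fin d → ℝ) : ℝ :=
  iteratedFDeriv ℝ k g x fun j => Pi.single (i j) 1

/-- The `C^{ν,1}` norm of a function on the cube, with values in `[0,∞]` and computed on the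
periodic extension. The first term is the largest sup norm of a partial derivative of order at
most `ν`. In the second term, the `L^∞` norm of a (weak) partial derivative of order `ν + 1`, say
`∂_j` of a derivative `G` of order `ν`, is the supremum of the difference quotients of `G` in
direction `j`. -/
def cNorm {d : ℕ} (ν : ℕ) (f : Cube d → ℝ) : ℝ≥0∞ :=
  (⨆ (k : ℕ) (_ : k ≤ ν) (i : Fin k → Fin d) (x : Fin d → ℝ),
      ‖partialDeriv (periodicExt f) i x‖ₑ) ⊔
  (⨆ (i : Fin ν → Fin d) (j : Fin d) (x : Fin d → ℝ) (t : ℝ) (_ : t ≠ 0),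
      ‖(partialDeriv (periodicExt f) i (x + Pi.single j t) -
        partialDeriv (periodicExt f) i x) / t‖ₑ)

/-- Membership in `C_p^{ν,1}([-1,1]^d)`. -/
structure MemCp {d : ℕ} (ν : ℕ) (f : Cube d → ℝ) : Prop where
  /-- the values on opposite faces of the cube agree -/
  boundary : ∀ z : Cube d, periodicExt f z.1 = f z
  contDiff : ContDiff ℝ ν (periodicExt f)
  norm_lt_top : cNorm ν f < ∞

/-! ### Markov decision processes -/

/-- A finite-horizon MDP with state space `[-1,1]^dS`, action space `[-1,1]^dA` and horizon `H`.
State-action pairs are points of `[-1,1]^(dS+dA)`. The index `h : Fin H` is the stage `h + 1`. -/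
structure MDP (dS dA H : ℕ) where
  /-- transition kernels -/
  p : Fin H → Kernel (Cube (dS + dA)) (Cube dS)
  markov : ∀ h, IsMarkovKernel (p h)
  /-- reward functions -/
  R : Fin H → Cube (dS + dA) → ℝ
  R_mem : ∀ h z, R h z ∈ Set.Icc (0 : ℝ) 1

/-- The pair `(s,a)` as a point of `[-1,1]^(dS+dA)`. -/
def pair {dS dA : ℕ} (s : Cube dS) (a : Cube dA) : Cube (dS + dA) :=
  ⟨Fin.append s.1 a.1,
    fun i => Fin.addCases (motive := fun i => (-1 : ℝ) ≤ Fin.append s.1 a.1 i)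
      (fun j => by rw [Fin.append_left]; exact s.2.1 j)
      (fun j => by rw [Fin.append_right]; exact a.2.1 j) i,
    fun i => Fin.addCases (motive := fun i => Fin.append s.1 a.1 i ≤ (1 : ℝ))
      (fun j => by rw [Fin.append_left]; exact s.2.2 j)
      (fun j => by rw [Fin.append_right]; exact a.2.2 j) i⟩

/-- `V(s) = sup_a Q(s,a)`. -/
def valueOf {dS dA : ℕ} (Q : Cube (dS + dA) → ℝ) (s : Cube dS) : ℝ := ⨆ a : Cube dA, Q (pair s a)

variable {dS dA H : ℕ}

/-- The Bellman optimality operator `T_h`. -/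
def MDP.bellman (M : MDP dS dA H) (h : Fin H) (f : Cube (dS + dA) → ℝ) : Cube (dS + dA) → ℝ :=
  fun z => M.R h z + ∫ s, valueOf f s ∂(M.p h z)

/-- The MDP is `ν`-smooth with constant `CT`: each Bellman operator maps `C_p^{ν,1}` to itself,
with `‖T_h f‖ ≤ CT (‖f‖ + 1)`. -/
def MDP.IsSmooth (M : MDP dS dA H) (ν : ℕ) (CT : ℝ) : Prop :=
  ∀ (h : Fin H) (f : Cube (dS + dA) → ℝ), MemCp ν f →
    MemCp ν (M.bellman h f) ∧ cNorm ν (M.bellman h f) ≤ ENNReal.ofReal CT * (cNorm ν f + 1)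

/-- The optimal action-value functions: zero after the last stage, and `Q*_h = T_h Q*_{h+1}`.
The index `h.castSucc` is the stage of `h : Fin H`, the index `h.succ` the next one. -/
def MDP.Qstar (M : MDP dS dA H) : Fin (H + 1) → Cube (dS + dA) → ℝ :=
  Fin.reverseInduction (motive := fun _ => Cube (dS + dA) → ℝ) (fun _ => 0)
    fun h Qnext => M.bellman h Qnext

/-- The perturbed action-value functions: zero after the last stage, and
`Q̃_h = D_N * T_h Q̃_{h+1}`. -/
def MDP.Qtilde (M : MDP dS dA H) (N : ℕ) : Fin (H + 1) → Cube (dS + dA) → ℝ :=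
  Fin.reverseInduction (motive := fun _ => Cube (dS + dA) → ℝ) (fun _ => 0)
    fun h Qnext => circConv (vpKernel N) (M.bellman h Qnext)

/-! ### Quasi-optimal designs -/

/-- A finitely supported probability distribution on `[-1,1]^d`. -/
structure Design (d : ℕ) where
  weight : Cube d →₀ ℝ
  nonneg : ∀ z, 0 ≤ weight z
  sum_eq_one : (weight.sum fun _ w => w) = 1

/-- The matrix `Σ = E_{z ∼ ρ} [φ_N(z) φ_N(z)ᵀ]`. -/
def Design.covariance {d : ℕ} (ρ : Design d) (N : ℕ) : Matrix (FeatIdx d N) (FeatIdx d N) ℝ :=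
  ρ.weight.sum fun z w => w • Matrix.vecMulVec (feature N z) (feature N z)

/-- Quasi-optimal design for the set of features `φ_N(z)`, `z ∈ [-1,1]^d`. -/
structure Design.IsQuasiOptimal {d : ℕ} (ρ : Design d) (N : ℕ) : Prop where
  card_le : (ρ.weight.support.card : ℝ) ≤
    4 * numFeatures d N * Real.log (Real.log (numFeatures d N))
  invertible : IsUnit (ρ.covariance N).det
  norm_le : ∀ z : Cube d,
    dotProduct (feature N z) ((ρ.covariance N)⁻¹.mulVec (feature N z)) ≤ 2 * numFeatures d N

/-- The dataset of a stage: each support point `z` of the design is repeated `⌈ntot ρ(z)⌉` times. -/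
abbrev Design.SampleIdx {d : ℕ} (ρ : Design d) (ntot : ℕ) : Type :=
  Σ z : {z : Cube d // z ∈ ρ.weight.support}, Fin ⌈(ntot : ℝ) * ρ.weight z.1⌉₊

/-- The number of calls to the generative model at each stage: two for each element of the
dataset. -/
def Design.samplesPerStage {d : ℕ} (ρ : Design d) (ntot : ℕ) : ℕ :=
  2 * ∑ z ∈ ρ.weight.support, ⌈(ntot : ℝ) * ρ.weight z⌉₊

/-! ### The algorithm: perturbed least-squares value iteration -/

/-- The mass `β₊` of the positive part of `D_N`. -/
def betaPos (d N : ℕ) : ℝ := ∫ z : Cube d, max (vpKernel N z.1) 0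

/-- The mass `β₋` of the negative part of `D_N`. -/
def betaNeg (d N : ℕ) : ℝ := ∫ z : Cube d, max (-vpKernel N z.1) 0

/-- The distribution with density `D_N⁺`, the normalized positive part of `D_N`. -/
def noisePos (d N : ℕ) : Measure (Cube d) :=
  volume.withDensity fun z => ENNReal.ofReal (max (vpKernel N z.1) 0 / betaPos d N)

/-- The distribution with density `D_N⁻`, the normalized negative part of `D_N`. -/
def noiseNeg (d N : ℕ) : Measure (Cube d) :=
  volume.withDensity fun z => ENNReal.ofReal (max (-vpKernel N z.1) 0 / betaNeg d N)

/-- The law of one call to the generative model at stage `h`: draw `η` from the noise, query at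
`w = z + η` (reduced to the cube) and obtain `s' ∼ p_h(· | w)`. The outcome is `(w, s')`. -/
def MDP.queryLaw (M : MDP dS dA H) (noise : Measure (Cube (dS + dA))) (h : Fin H)
    (z : Cube (dS + dA)) : Measure (Cube (dS + dA) × Cube dS) :=
  (noise.map fun η => wrap (z.1 + η.1)) ⊗ₘ M.p h

/-- The outcome of the two queries, with positive and with negative noise, made for one element of
a dataset. -/
abbrev QueryPair (dS dA : ℕ) : Type :=
  (Cube (dS + dA) × Cube dS) × (Cube (dS + dA) × Cube dS)

/-- The law of all the outcomes, over all stages and all the elements of the datasets. They are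
independent. -/
def MDP.dataLaw (M : MDP dS dA H) (N ntot : ℕ) (ρ : Design (dS + dA)) :
    Measure (Fin H → ρ.SampleIdx ntot → QueryPair dS dA) :=
  Measure.pi fun h => Measure.pi fun j =>
    (M.queryLaw (noisePos (dS + dA) N) h j.1.1).prod (M.queryLaw (noiseNeg (dS + dA) N) h j.1.1)

/-- The regression target
`(β₊ r⁺ - β₋ r⁻) + (β₊ V(s⁺) - β₋ V(s⁻))` built from one pair of queries. -/
def MDP.target (M : MDP dS dA H) (N : ℕ) (h : Fin H) (V : Cube dS → ℝ) (q : QueryPair dS dA) : ℝ :=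
  (betaPos (dS + dA) N * M.R h q.1.1 - betaNeg (dS + dA) N * M.R h q.2.1) +
    (betaPos (dS + dA) N * V q.1.2 - betaNeg (dS + dA) N * V q.2.2)

/-- A minimizer `θ` of `∑_j (x_jᵀ θ - y_j)²`. -/
def leastSquares {I J : Type} [Fintype I] [Fintype J] (x : J → I → ℝ) (y : J → ℝ) : I → ℝ :=
  Classical.epsilon fun θ : I → ℝ => ∀ θ' : I → ℝ,
    ∑ j, (dotProduct (x j) θ - y j) ^ 2 ≤ ∑ j, (dotProduct (x j) θ' - y j) ^ 2

/-- The estimates `Q̂_h = φ_Nᵀ θ̂_h` that the algorithm computes from the outcomes `ω` of the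
queries, backwards from `Q̂_{H+1} = 0`. -/
def MDP.Qhat (M : MDP dS dA H) (N ntot : ℕ) (ρ : Design (dS + dA))
    (ω : Fin H → ρ.SampleIdx ntot → QueryPair dS dA) : Fin (H + 1) → Cube (dS + dA) → ℝ :=
  Fin.reverseInduction (motive := fun _ => Cube (dS + dA) → ℝ) (fun _ => 0)
    fun h Qnext z => dotProduct (feature N z)
      (leastSquares (fun j : ρ.SampleIdx ntot => feature N j.1.1)
        fun j => M.target N h (valueOf Qnext) (ω h j))

/-- The sup distance of two functions on the cube, with values in `[0,∞]`. -/
def supDist {d : ℕ} (f g : Cube d → ℝ) : ℝ≥0∞ := ⨆ z, ‖f z - g z‖ₑ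

end SmoothMDP

end

/-!
The error of least-squares value iteration with kernel `D_N` splits into a bias `Q*_h - Q̃_h`, which
depends on how well `D_N * f` approximates smooth functions, and a regression error `Q̃_h - Q̂_h`,
which is small with high probability because the targets are unbiased for a function in the span of
the features.

*Kernels.* The `L¹` norms of `D_N` are bounded (`exists_isVPBound`). Indeed `D_N` is a combination
of two sums of the form `∑_{j ≤ n} D_j^0`, and `2^d` times such a sum is the `n`-th coefficient of
the power series in `r` of `∏_j p_r(x_j) / (1 - r)²`, where `p_r(x) = ∑_k r^{|k|} e^{iπkx}` is the
Poisson kernel with a complex parameter. The coefficients are estimated on the circle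
`|r| = 1 - 1/(n+2)`, on which `‖p_r‖₁` grows more slowly than any power of `|1 - r| / (1 - |r|)`.
Conversely, any bound `L` satisfies `L ≥ 1` and `d ≤ 13 L` (`IsVPBound.dim_le`, by duality with a
Riesz product), and therefore absorbs polynomial factors in `d`.

*Approximation.* `D_N * f` is a trigonometric polynomial of degree `N`, convolution with `D_N` fixes
polynomials of degree `N/2`, and it increases the `C^{ν,1}` norm by at most the factor `L`. Together
with a Jackson inequality, which is obtained from iterated differences and positive kernels, this
gives `‖f - D_N * f‖ = O(N^{-(ν+1)})` (`MemCp.abs_circConv_sub_le`). Hence `Q̃_h` has a `C^{ν,1}` norm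
that is at most exponential in `H`, and `Q*_h - Q̃_h` is a sum of at most `H` approximation errors
(`MDP.IsSmooth.abs_Qstar_sub_Qtilde_le`).

*Designs.* The orthonormal version of the features has norm `√Ñ` at every point and is isotropic on
average. A one-sided barrier argument of Batson–Spielman–Srivastava type selects `12 Ñ` points whose
frame operator is at least half of the expected one; the uniform distribution on them is
quasi-optimal as soon as `12 ≤ 4 log log Ñ` (`exists_isQuasiOptimal`).

*Statistics.* The regression targets are unbiased for `D_N * T_h Q̂_{h+1}`, which lies exactly in the
span of the features. The error of the fit at a point is thus a weighted sum of independent bounded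
variables, and the weights have square sum at most `2Ñ / ntot`. Hoeffding's inequality and a union
bound over a finite grid, on which trigonometric polynomials of degree `N` are controlled up to a
factor `2`, give uniform accuracy (`MDP.IsSmooth.dataLaw_le`); the errors propagate through the
stages with a factor `L` each (`MDP.IsSmooth.abs_sub_Qhat_le`). It remains to choose `N` of order
`ε^{-1/(ν+1)}` and `ntot` of order `Ñ ε^{-2}` up to logarithms; all the constants are powers of one
number `(c L)^H` (`growth_bounds`, `exists_degree`, `exists_sampleSize`).
-/


noncomputable section

namespace SmoothMDP

/-! ### Lebesgue measure on the cube -/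

/-- Lebesgue measure on `[-1,1]`, as a measure on the line. -/
def lineMeasure : Measure ℝ := volume.restrict (Set.Icc (-1 : ℝ) 1)

/-- Lebesgue measure on the cube `[-1,1]^d`, as a measure on `ℝ^d`. -/
def boxMeasure (d : ℕ) : Measure (Fin d → ℝ) := Measure.pi fun _ => lineMeasure

instance : IsFiniteMeasure lineMeasure := by unfold lineMeasure; infer_instance

instance (d : ℕ) : IsFiniteMeasure (boxMeasure d) := by unfold boxMeasure; infer_instance

lemma boxMeasure_eq (d : ℕ) :
    boxMeasure d = (volume : Measure (Fin d → ℝ)).restrict (Set.Icc (-1) 1) := by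
  unfold boxMeasure lineMeasure
  rw [← Set.pi_univ_Icc, volume_pi, Measure.restrict_pi_pi]
  rfl

lemma measurableEmbedding_cubeVal (d : ℕ) :
    MeasurableEmbedding (Subtype.val : Cube d → (Fin d → ℝ)) :=
  MeasurableEmbedding.subtype_coe measurableSet_Icc

lemma measurePreserving_cubeVal (d : ℕ) :
    MeasurePreserving (Subtype.val : Cube d → (Fin d → ℝ)) volume (boxMeasure d) := by
  refine ⟨measurable_subtype_coe, ?_⟩
  rw [boxMeasure_eq]
  exact map_comap_subtype_coe measurableSet_Icc _

instance (d : ℕ) : IsFiniteMeasure (volume : Measure (Cube d)) := by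
  constructor
  have h := (measurePreserving_cubeVal d).measure_preimage_emb (measurableEmbedding_cubeVal d)
    Set.univ
  rw [Set.preimage_univ] at h
  rw [h]
  exact measure_lt_top _ _

lemma integral_cube {E : Type*} [NormedAddCommGroup E] [NormedSpace ℝ E] {d : ℕ}
    (f : (Fin d → ℝ) → E) : ∫ z : Cube d, f z.1 = ∫ x, f x ∂(boxMeasure d) :=
  (measurePreserving_cubeVal d).integral_comp (measurableEmbedding_cubeVal d) f

lemma integral_lineMeasure {E : Type*} [NormedAddCommGroup E] [NormedSpace ℝ E] (f : ℝ → E) :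
    ∫ x, f x ∂lineMeasure = ∫ x in (-1 : ℝ)..1, f x := by
  unfold lineMeasure
  rw [integral_Icc_eq_integral_Ioc, intervalIntegral.integral_of_le (by norm_num)]

lemma integral_cube_prod {𝕜 : Type*} [RCLike 𝕜] {d : ℕ} (g : Fin d → ℝ → 𝕜) :
    ∫ z : Cube d, ∏ i, g i (z.1 i) = ∏ i, ∫ x in (-1 : ℝ)..1, g i x := by
  rw [integral_cube (fun x => ∏ i, g i (x i))]
  unfold boxMeasure
  rw [integral_fintype_prod_eq_prod]
  simp_rw [integral_lineMeasure]

lemma volume_real_cube (d : ℕ) : (volume : Measure (Cube d)).real Set.univ = 2 ^ d := by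
  have h := integral_cube_prod (𝕜 := ℝ) (d := d) (fun _ _ => 1)
  simp only [Finset.prod_const_one, integral_const, smul_eq_mul, mul_one,
    intervalIntegral.integral_const, Finset.prod_const, Finset.card_univ, Fintype.card_fin] at h
  rw [h]; norm_num

/-! ### Reduction modulo the period -/

lemma wrap_apply {d : ℕ} (x : Fin d → ℝ) (i : Fin d) :
    (wrap x).1 i = x i - toIcoDiv (zero_lt_two' ℝ) (-1) (x i) * 2 := by
  change toIcoMod (zero_lt_two' ℝ) (-1) (x i) = _
  rw [toIcoMod, zsmul_eq_mul]

/-- A function on `ℝ^d` that has period `2` in each coordinate. -/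
def IsPeriodic {d : ℕ} {E : Type*} (F : (Fin d → ℝ) → E) : Prop :=
  ∀ (x : Fin d → ℝ) (n : Fin d → ℤ), F (fun i => x i + n i * 2) = F x

lemma IsPeriodic.wrap {d : ℕ} {E : Type*} {F : (Fin d → ℝ) → E} (hF : IsPeriodic F)
    (x : Fin d → ℝ) : F (wrap x).1 = F x := by
  rw [← hF x (fun i => -toIcoDiv (zero_lt_two' ℝ) (-1) (x i))]
  congr 1
  ext i
  rw [wrap_apply]
  push_cast
  ring

lemma isPeriodic_periodicExt {d : ℕ} (f : Cube d → ℝ) : IsPeriodic (periodicExt f) := by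
  intro x n
  unfold periodicExt
  congr 1
  apply Subtype.ext
  ext i
  have := toIcoMod_add_zsmul (zero_lt_two' ℝ) (-1) (x i) (n i)
  simpa only [SmoothMDP.wrap, zsmul_eq_mul] using this

lemma IsPeriodic.comp_add {d : ℕ} {E : Type*} {F : (Fin d → ℝ) → E} (hF : IsPeriodic F)
    (a : Fin d → ℝ) : IsPeriodic fun x => F (a + x) := by
  intro x n
  beta_reduce
  rw [← hF (a + x) n]
  congr 1
  ext i
  simp only [Pi.add_apply]
  ring

lemma IsPeriodic.comp_neg {d : ℕ} {E : Type*} {F : (Fin d → ℝ) → E} (hF : IsPeriodic F) :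
    IsPeriodic fun x => F (-x) := by
  intro x n
  beta_reduce
  rw [← hF (-x) (-n)]
  congr 1
  ext i
  simp only [Pi.neg_apply, Int.cast_neg]
  ring

lemma measurePreserving_toIcoMod_add (x : ℝ) :
    MeasurePreserving (fun t : ℝ => toIcoMod (zero_lt_two' ℝ) (-1) (x + t))
      lineMeasure lineMeasure := by
  have : Fact ((0 : ℝ) < 2) := ⟨zero_lt_two⟩
  have hl : lineMeasure = volume.restrict (Set.Ioc (-1 : ℝ) (-1 + 2)) := by
    unfold lineMeasure
    rw [show (-1 : ℝ) + 2 = 1 by norm_num]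
    exact Measure.restrict_congr_set Ioc_ae_eq_Icc.symm
  have hmk : MeasurePreserving (fun t : ℝ => (t : AddCircle (2 : ℝ))) lineMeasure volume := by
    rw [hl]; exact AddCircle.measurePreserving_mk 2 (-1)
  let e : AddCircle (2 : ℝ) → ℝ := fun b => (AddCircle.equivIco 2 (-1) b : ℝ)
  have he : Measurable e :=
    measurable_subtype_coe.comp (AddCircle.measurableEquivIco 2 (-1)).measurable
  have hemk : ∀ t : ℝ, e (t : AddCircle (2 : ℝ)) = toIcoMod (zero_lt_two' ℝ) (-1) t :=
    fun t => rfl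
  have hep : MeasurePreserving e volume lineMeasure := by
    refine ⟨he, ?_⟩
    rw [← hmk.map_eq, Measure.map_map he hmk.measurable]
    have : (e ∘ fun t : ℝ => (t : AddCircle (2 : ℝ))) =ᵐ[lineMeasure] id := by
      have h1 : lineMeasure = volume.restrict (Set.Ico (-1 : ℝ) (-1 + 2)) := by
        unfold lineMeasure
        rw [show (-1 : ℝ) + 2 = 1 by norm_num]
        exact Measure.restrict_congr_set Ico_ae_eq_Icc.symm
      rw [h1]
      filter_upwards [ae_restrict_mem measurableSet_Ico] with t ht
      rw [Function.comp_apply, hemk, id]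
      exact (toIcoMod_eq_self _).2 ht
    rw [Measure.map_congr this, Measure.map_id]
  have hc := hep.comp ((measurePreserving_add_left volume (x : AddCircle (2 : ℝ))).comp hmk)
  convert hc using 1
  ext t
  simp only [Function.comp_apply]
  rw [← hemk, AddCircle.coe_add]

/-- Translation modulo the period preserves Lebesgue measure on the cube. -/
lemma measurePreserving_wrap_add {d : ℕ} (x : Fin d → ℝ) :
    MeasurePreserving (fun η : Cube d => wrap (x + η.1)) volume volume := by
  have hT : MeasurePreserving
      (fun (y : Fin d → ℝ) i => toIcoMod (zero_lt_two' ℝ) (-1) (x i + y i))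
      (boxMeasure d) (boxMeasure d) :=
    measurePreserving_pi (fun _ => lineMeasure) (fun _ => lineMeasure)
      (fun i => measurePreserving_toIcoMod_add (x i))
  have hm : Measurable fun η : Cube d => wrap (x + η.1) :=
    (hT.measurable.comp measurable_subtype_coe).subtype_mk
  refine ⟨hm, (measurableEmbedding_cubeVal d).map_injective ?_⟩
  rw [Measure.map_map measurable_subtype_coe hm, (measurePreserving_cubeVal d).map_eq,
    ← (hT.comp (measurePreserving_cubeVal d)).map_eq]
  rfl

lemma measurable_wrap {d : ℕ} : Measurable (wrap : (Fin d → ℝ) → Cube d) := by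
  have h1 : Measurable fun t : ℝ => toIcoMod (zero_lt_two' ℝ) (-1) t := by
    simpa only [zero_add] using (measurePreserving_toIcoMod_add 0).measurable
  exact (measurable_pi_lambda _ fun i => h1.comp (measurable_pi_apply i)).subtype_mk

/-- Reflection of the cube. -/
def reflect {d : ℕ} (z : Cube d) : Cube d :=
  ⟨-z.1, by
    have h := z.2
    constructor
    · intro i; have := h.2 i; simp only [Pi.neg_apply, Pi.one_apply] at *; linarith
    · intro i; have := h.1 i; simp only [Pi.neg_apply, Pi.one_apply] at *; linarith⟩

lemma measurePreserving_reflect (d : ℕ) :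
    MeasurePreserving (reflect : Cube d → Cube d) volume volume := by
  have h1 : MeasurePreserving (fun t : ℝ => -t) lineMeasure lineMeasure := by
    have := (Measure.measurePreserving_neg (volume : Measure ℝ)).restrict_preimage
      (s := Set.Icc (-1 : ℝ) 1) measurableSet_Icc
    unfold lineMeasure
    simpa using this
  have hT : MeasurePreserving (fun (y : Fin d → ℝ) i => -(y i)) (boxMeasure d) (boxMeasure d) :=
    measurePreserving_pi (fun _ => lineMeasure) (fun _ => lineMeasure) (fun i => h1)
  have hm : Measurable (reflect : Cube d → Cube d) :=
    (hT.measurable.comp measurable_subtype_coe).subtype_mk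
  refine ⟨hm, (measurableEmbedding_cubeVal d).map_injective ?_⟩
  rw [Measure.map_map measurable_subtype_coe hm, (measurePreserving_cubeVal d).map_eq,
    ← (hT.comp (measurePreserving_cubeVal d)).map_eq]
  rfl

lemma integral_wrap_add {d : ℕ} (x : Fin d → ℝ) {f : Cube d → ℝ} (hf : Measurable f) :
    ∫ η : Cube d, f (wrap (x + η.1)) = ∫ z : Cube d, f z := by
  have h := measurePreserving_wrap_add x
  conv_rhs => rw [← h.map_eq]
  rw [integral_map h.measurable.aemeasurable hf.aestronglyMeasurable]

lemma integral_wrap_sub {d : ℕ} (x : Fin d → ℝ) {f : Cube d → ℝ} (hf : Measurable f) :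
    ∫ η : Cube d, f (wrap (x - η.1)) = ∫ z : Cube d, f z := by
  rw [← integral_wrap_add x hf]
  have h := measurePreserving_reflect d
  have hm : Measurable fun η : Cube d => f (wrap (x + η.1)) :=
    hf.comp (measurePreserving_wrap_add x).measurable
  conv_rhs => rw [← h.map_eq]
  rw [integral_map h.measurable.aemeasurable hm.aestronglyMeasurable]
  simp only [reflect, sub_eq_add_neg]

/-- Circular convolution as an average of translates of the periodic extension. -/
lemma circConv_eq {d : ℕ} {D : (Fin d → ℝ) → ℝ} (hD : IsPeriodic D) (hDm : Measurable D)
    {f : Cube d → ℝ} (hf : Measurable f) (x : Cube d) :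
    circConv D f x = ∫ t : Cube d, periodicExt f (x.1 - t.1) * D t.1 := by
  have hm : Measurable fun y : Cube d => f y * D (x.1 - y.1) :=
    hf.mul (hDm.comp (measurable_const.sub measurable_subtype_coe))
  unfold circConv
  rw [← integral_wrap_sub x.1 hm]
  congr 1
  ext t
  have := (hD.comp_add x.1).comp_neg.wrap (x.1 - t.1)
  simp only [periodicExt] at *
  rw [sub_eq_add_neg x.1 (wrap (x.1 - t.1)).1, this]
  congr 2
  abel

/-- Circular convolution with an even kernel, as an average over noise. -/
lemma circConv_eq_add {d : ℕ} {D : (Fin d → ℝ) → ℝ} (hD : IsPeriodic D) (hDm : Measurable D)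
    (heven : ∀ x, D (-x) = D x) {f : Cube d → ℝ} (hf : Measurable f) (x : Cube d) :
    circConv D f x = ∫ t : Cube d, f (wrap (x.1 + t.1)) * D t.1 := by
  have hm : Measurable fun y : Cube d => f y * D (x.1 - y.1) :=
    hf.mul (hDm.comp (measurable_const.sub measurable_subtype_coe))
  unfold circConv
  rw [← integral_wrap_add x.1 hm]
  congr 1
  ext t
  have := (hD.comp_add x.1).comp_neg.wrap (x.1 + t.1)
  beta_reduce at this
  rw [sub_eq_add_neg x.1 (wrap (x.1 + t.1)).1, this, ← heven t.1]
  congr 2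
  abel

/-! ### The trigonometric system -/

lemma mem_freqs {d N : ℕ} {n : Fin d → ℤ} : n ∈ freqs d N ↔ ∑ i, |n i| ≤ (N : ℤ) := by
  unfold freqs
  rw [Finset.mem_filter, and_iff_right_iff_imp]
  intro h
  rw [Fintype.mem_piFinset]
  intro i
  rw [Finset.mem_Icc, ← abs_le]
  exact (Finset.single_le_sum (f := fun i => |n i|) (fun i _ => abs_nonneg _)
    (Finset.mem_univ i)).trans h

lemma freqs_mono {d : ℕ} {m n : ℕ} (h : m ≤ n) : freqs d m ⊆ freqs d n := by
  intro k hk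
  rw [mem_freqs] at *
  exact hk.trans (by exact_mod_cast h)

/-- The univariate monomials, normalized in `L²` of the uniform distribution on `[-1,1]`. -/
def nsoc (n : ℤ) (t : ℝ) : ℝ := (if n = 0 then 1 else √2) * soc n t

lemma nsoc_zero (t : ℝ) : nsoc 0 t = 1 := by simp [nsoc, soc]

lemma nsoc_pos {n : ℤ} (hn : 0 < n) (t : ℝ) : nsoc n t = √2 * Real.sin (n * Real.pi * t) := by
  simp [nsoc, soc, hn.ne', hn]

lemma nsoc_neg {n : ℤ} (hn : n < 0) (t : ℝ) : nsoc n t = √2 * Real.cos (n * Real.pi * t) := by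
  simp [nsoc, soc, hn.ne, hn.not_gt]

lemma integral_cos_int (k : ℤ) :
    ∫ t in (-1 : ℝ)..1, Real.cos (k * Real.pi * t) = if k = 0 then 2 else 0 := by
  split_ifs with h
  · subst h; norm_num
  · have hk : (k : ℝ) * Real.pi ≠ 0 := mul_ne_zero (by exact_mod_cast h) Real.pi_ne_zero
    rw [intervalIntegral.integral_comp_mul_left (fun x => Real.cos x) hk, integral_cos]
    simp [Real.sin_int_mul_pi]

lemma integral_sin_int (k : ℤ) : ∫ t in (-1 : ℝ)..1, Real.sin (k * Real.pi * t) = 0 := by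
  by_cases h : k = 0
  · subst h; simp
  · have hk : (k : ℝ) * Real.pi ≠ 0 := mul_ne_zero (by exact_mod_cast h) Real.pi_ne_zero
    rw [intervalIntegral.integral_comp_mul_left (fun x => Real.sin x) hk, integral_sin]
    simp

lemma intervalIntegrable_cos_int (k : ℤ) :
    IntervalIntegrable (fun t => Real.cos (k * Real.pi * t)) volume (-1) 1 :=
  (by fun_prop : Continuous fun t : ℝ => Real.cos (k * Real.pi * t)).intervalIntegrable _ _

lemma intervalIntegrable_sin_int (k : ℤ) :
    IntervalIntegrable (fun t => Real.sin (k * Real.pi * t)) volume (-1) 1 :=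
  (by fun_prop : Continuous fun t : ℝ => Real.sin (k * Real.pi * t)).intervalIntegrable _ _

lemma integral_nsoc_mul_nsoc (n m : ℤ) :
    ∫ t in (-1 : ℝ)..1, nsoc n t * nsoc m t = if n = m then 2 else 0 := by
  have h2 : √2 * √2 = (2 : ℝ) := Real.mul_self_sqrt zero_le_two
  rcases lt_trichotomy n 0 with hn | hn | hn <;> rcases lt_trichotomy m 0 with hm | hm | hm
  · have : ∀ t : ℝ, nsoc n t * nsoc m t = Real.cos ((n - m : ℤ) * Real.pi * t) +
        Real.cos ((n + m : ℤ) * Real.pi * t) := by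
      intro t
      rw [nsoc_neg hn, nsoc_neg hm]
      push_cast
      rw [sub_mul, sub_mul, add_mul, add_mul, Real.cos_sub, Real.cos_add]
      linear_combination (Real.cos (n * Real.pi * t) * Real.cos (m * Real.pi * t)) * h2
    simp_rw [this]
    rw [intervalIntegral.integral_add (intervalIntegrable_cos_int _) (intervalIntegrable_cos_int _),
      integral_cos_int, integral_cos_int, if_neg (show n + m ≠ 0 by omega), add_zero]
    simp only [sub_eq_zero]
  · subst hm
    have : ∀ t : ℝ, nsoc n t * nsoc 0 t = √2 * Real.cos (n * Real.pi * t) := by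
      intro t; rw [nsoc_neg hn, nsoc_zero, mul_one]
    simp_rw [this]
    rw [intervalIntegral.integral_const_mul, integral_cos_int, if_neg hn.ne, mul_zero]
  · have : ∀ t : ℝ, nsoc n t * nsoc m t = Real.sin ((m + n : ℤ) * Real.pi * t) +
        Real.sin ((m - n : ℤ) * Real.pi * t) := by
      intro t
      rw [nsoc_neg hn, nsoc_pos hm]
      push_cast
      rw [sub_mul, sub_mul, add_mul, add_mul, Real.sin_sub, Real.sin_add]
      linear_combination (Real.cos (n * Real.pi * t) * Real.sin (m * Real.pi * t)) * h2
    simp_rw [this]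
    rw [intervalIntegral.integral_add (intervalIntegrable_sin_int _) (intervalIntegrable_sin_int _),
      integral_sin_int, integral_sin_int, if_neg (by omega), add_zero]
  · subst hn
    have : ∀ t : ℝ, nsoc 0 t * nsoc m t = √2 * Real.cos (m * Real.pi * t) := by
      intro t; rw [nsoc_neg hm, nsoc_zero, one_mul]
    simp_rw [this]
    rw [intervalIntegral.integral_const_mul, integral_cos_int, if_neg hm.ne, mul_zero,
      if_neg hm.ne']
  · subst hn; subst hm
    simp only [nsoc_zero]; norm_num
  · subst hn
    have : ∀ t : ℝ, nsoc 0 t * nsoc m t = √2 * Real.sin (m * Real.pi * t) := by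
      intro t; rw [nsoc_pos hm, nsoc_zero, one_mul]
    simp_rw [this]
    rw [intervalIntegral.integral_const_mul, integral_sin_int, mul_zero, if_neg hm.ne]
  · have : ∀ t : ℝ, nsoc n t * nsoc m t = Real.sin ((n + m : ℤ) * Real.pi * t) +
        Real.sin ((n - m : ℤ) * Real.pi * t) := by
      intro t
      rw [nsoc_pos hn, nsoc_neg hm]
      push_cast
      rw [sub_mul, sub_mul, add_mul, add_mul, Real.sin_sub, Real.sin_add]
      linear_combination (Real.sin (n * Real.pi * t) * Real.cos (m * Real.pi * t)) * h2
    simp_rw [this]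
    rw [intervalIntegral.integral_add (intervalIntegrable_sin_int _) (intervalIntegrable_sin_int _),
      integral_sin_int, integral_sin_int, if_neg (by omega), add_zero]
  · subst hm
    have : ∀ t : ℝ, nsoc n t * nsoc 0 t = √2 * Real.sin (n * Real.pi * t) := by
      intro t; rw [nsoc_pos hn, nsoc_zero, mul_one]
    simp_rw [this]
    rw [intervalIntegral.integral_const_mul, integral_sin_int, mul_zero, if_neg hn.ne']
  · have : ∀ t : ℝ, nsoc n t * nsoc m t = Real.cos ((n - m : ℤ) * Real.pi * t) -
        Real.cos ((n + m : ℤ) * Real.pi * t) := by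
      intro t
      rw [nsoc_pos hn, nsoc_pos hm]
      push_cast
      rw [sub_mul, sub_mul, add_mul, add_mul, Real.cos_sub, Real.cos_add]
      linear_combination (Real.sin (n * Real.pi * t) * Real.sin (m * Real.pi * t)) * h2
    simp_rw [this]
    rw [intervalIntegral.integral_sub (intervalIntegrable_cos_int _) (intervalIntegrable_cos_int _),
      integral_cos_int, integral_cos_int, if_neg (show n + m ≠ 0 by omega), sub_zero]
    simp only [sub_eq_zero]

lemma nsoc_mul_add_nsoc_neg_mul (n : ℤ) (s t : ℝ) :
    nsoc n s * nsoc n t + nsoc (-n) s * nsoc (-n) t = 2 * Real.cos (n * Real.pi * (s - t)) := by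
  have h2 : √2 * √2 = (2 : ℝ) := Real.mul_self_sqrt zero_le_two
  rcases lt_trichotomy n 0 with hn | hn | hn
  · rw [nsoc_neg hn, nsoc_neg hn, nsoc_pos (neg_pos.2 hn), nsoc_pos (neg_pos.2 hn), mul_sub,
      Real.cos_sub]
    push_cast
    simp only [neg_mul, Real.sin_neg]
    linear_combination (Real.cos (n * Real.pi * s) * Real.cos (n * Real.pi * t) +
      Real.sin (n * Real.pi * s) * Real.sin (n * Real.pi * t)) * h2
  · subst hn; simp [nsoc_zero]; norm_num
  · rw [nsoc_pos hn, nsoc_pos hn, nsoc_neg (neg_lt_zero.2 hn), nsoc_neg (neg_lt_zero.2 hn), mul_sub,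
      Real.cos_sub]
    push_cast
    simp only [neg_mul, Real.cos_neg]
    linear_combination (Real.cos (n * Real.pi * s) * Real.cos (n * Real.pi * t) +
      Real.sin (n * Real.pi * s) * Real.sin (n * Real.pi * t)) * h2

lemma contDiff_nsoc (n : ℤ) : ContDiff ℝ ⊤ (nsoc n) := by
  rcases lt_trichotomy n 0 with hn | hn | hn
  · rw [show nsoc n = fun t => √2 * Real.cos (n * Real.pi * t) from funext (nsoc_neg hn)]
    fun_prop
  · subst hn
    rw [show nsoc 0 = fun _ => 1 from funext nsoc_zero]
    fun_prop
  · rw [show nsoc n = fun t => √2 * Real.sin (n * Real.pi * t) from funext (nsoc_pos hn)]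
    fun_prop

lemma nsoc_add_period (n k : ℤ) (t : ℝ) : nsoc n (t + k * 2) = nsoc n t := by
  have e : (n : ℝ) * Real.pi * (t + k * 2) = n * Real.pi * t + (n * k : ℤ) * (2 * Real.pi) := by
    push_cast; ring
  rcases lt_trichotomy n 0 with hn | hn | hn
  · rw [nsoc_neg hn, nsoc_neg hn, e, Real.cos_add_int_mul_two_pi]
  · subst hn; simp [nsoc_zero]
  · rw [nsoc_pos hn, nsoc_pos hn, e, Real.sin_add_int_mul_two_pi]

/-- A sum over the multi-frequencies of products over the coordinates depends only on the
even parts of the factors, because the set of multi-frequencies is invariant under sign changes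
of single coordinates. -/
lemma sum_freqs_prod_congr {R : Type*} [Field R] [CharZero R] {d : ℕ} (N : ℕ)
    (a b : Fin d → ℤ → R) (h : ∀ i n, a i n + a i (-n) = b i n + b i (-n)) :
    ∑ n ∈ freqs d N, ∏ i, a i (n i) = ∑ n ∈ freqs d N, ∏ i, b i (n i) := by
  classical
  have flip : ∀ (A : Fin d → ℤ → R) (j : Fin d), 2 * ∑ n ∈ freqs d N, ∏ i, A i (n i) =
      ∑ n ∈ freqs d N, (A j (n j) + A j (-(n j))) * ∏ i ∈ Finset.univ.erase j, A i (n i) := by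
    intro A j
    have hinv : ∑ n ∈ freqs d N, ∏ i, A i (n i) =
        ∑ n ∈ freqs d N, A j (-(n j)) * ∏ i ∈ Finset.univ.erase j, A i (n i) := by
      refine Finset.sum_bij' (fun n _ => Function.update n j (-(n j)))
        (fun n _ => Function.update n j (-(n j))) ?_ ?_ ?_ ?_ ?_
      · intro n hn
        rw [mem_freqs] at *
        convert hn using 2 with i
        by_cases hij : i = j
        · subst hij; simp
        · simp [hij]
      · intro n hn
        rw [mem_freqs] at *
        convert hn using 2 with i
        by_cases hij : i = j
        · subst hij; simp
        · simp [hij]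
      · intro n _; simp
      · intro n _; simp
      · intro n _
        rw [← Finset.mul_prod_erase Finset.univ (fun i => A i (n i)) (Finset.mem_univ j)]
        simp only [Function.update_self, neg_neg]
        congr 1
        refine Finset.prod_congr rfl fun i hi => ?_
        rw [Function.update_of_ne (Finset.ne_of_mem_erase hi)]
    rw [two_mul]
    nth_rewrite 2 [hinv]
    rw [← Finset.sum_add_distrib]
    refine Finset.sum_congr rfl fun n _ => ?_
    rw [← Finset.mul_prod_erase Finset.univ (fun i => A i (n i)) (Finset.mem_univ j), add_mul]
  have key : ∀ s : Finset (Fin d), ∑ n ∈ freqs d N, ∏ i, a i (n i) =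
      ∑ n ∈ freqs d N, ∏ i, (if i ∈ s then b i else a i) (n i) := by
    intro s
    induction s using Finset.induction_on with
    | empty => simp
    | insert j s hj ih =>
      rw [ih]
      refine mul_left_cancel₀ (two_ne_zero (α := R)) ?_
      rw [flip _ j, flip _ j]
      refine Finset.sum_congr rfl fun n _ => ?_
      simp only [hj, if_false, Finset.mem_insert_self, if_true, h]
      congr 1
      refine Finset.prod_congr rfl fun i hi => ?_
      simp [Finset.mem_insert, Finset.ne_of_mem_erase hi]
  rw [key Finset.univ]
  simp

lemma dirichletKernel_eq_prod {d : ℕ} (n : ℕ) (z : Fin d → ℝ) :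
    dirichletKernel n z =
      (∑ k ∈ freqs d n, ∏ i, Real.cos ((k i : ℝ) * Real.pi * z i)) / 2 ^ d := by
  unfold dirichletKernel
  congr 1
  have h := sum_freqs_prod_congr (R := ℂ) n
    (fun (i : Fin d) (k : ℤ) => Complex.exp ((k * Real.pi * z i : ℝ) * Complex.I))
    (fun (i : Fin d) (k : ℤ) => (Real.cos (k * Real.pi * z i) : ℂ)) ?_
  · have h' := congrArg Complex.re h
    simp only [← Complex.exp_sum, ← Finset.sum_mul, ← Complex.ofReal_sum, Complex.re_sum,
      Complex.exp_ofReal_mul_I_re, ← Complex.ofReal_prod, Complex.ofReal_re] at h'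
    rw [← h']
    refine Finset.sum_congr rfl fun k _ => ?_
    rw [Finset.mul_sum]
    congr 1
    exact Finset.sum_congr rfl fun i _ => by ring
  · intro i k
    push_cast
    rw [Complex.exp_mul_I, Complex.exp_mul_I]
    simp only [neg_mul, Complex.cos_neg, Complex.sin_neg]
    ring

/-- The multivariate trigonometric monomials, orthonormal for the uniform distribution. -/
def basisFn {d : ℕ} (n : Fin d → ℤ) (x : Fin d → ℝ) : ℝ := ∏ i, nsoc (n i) (x i)

lemma isPeriodic_basisFn {d : ℕ} (n : Fin d → ℤ) : IsPeriodic (basisFn n) := by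
  intro x k
  unfold basisFn
  exact Finset.prod_congr rfl fun i _ => nsoc_add_period _ _ _

lemma contDiff_basisFn {d : ℕ} (n : Fin d → ℤ) : ContDiff ℝ ⊤ (basisFn n) := by
  unfold basisFn
  refine contDiff_prod fun i _ => ?_
  exact (contDiff_nsoc (n i)).comp (contDiff_apply ℝ ℝ i)

lemma integral_basisFn_mul {d : ℕ} (n m : Fin d → ℤ) :
    ∫ z : Cube d, basisFn n z.1 * basisFn m z.1 = if n = m then 2 ^ d else 0 := by
  unfold basisFn
  simp_rw [← Finset.prod_mul_distrib]
  rw [integral_cube_prod (fun i t => nsoc (n i) t * nsoc (m i) t)]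
  simp_rw [integral_nsoc_mul_nsoc]
  split_ifs with h
  · subst h; simp
  · obtain ⟨i, hi⟩ := Function.ne_iff.1 h
    exact Finset.prod_eq_zero (Finset.mem_univ i) (if_neg hi)

/-- Addition theorem for the trigonometric monomials. -/
lemma sum_basisFn_mul {d : ℕ} (N : ℕ) (x y : Fin d → ℝ) :
    ∑ n ∈ freqs d N, basisFn n x * basisFn n y = 2 ^ d * dirichletKernel N (x - y) := by
  rw [dirichletKernel_eq_prod, mul_div_cancel₀ _ (by positivity)]
  unfold basisFn
  simp_rw [← Finset.prod_mul_distrib]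
  refine sum_freqs_prod_congr N (fun i n => nsoc n (x i) * nsoc n (y i))
    (fun i n => Real.cos ((n : ℝ) * Real.pi * (x - y) i)) fun i n => ?_
  simp only [nsoc_mul_add_nsoc_neg_mul, Pi.sub_apply, Int.cast_neg, neg_mul, Real.cos_neg]
  ring

lemma sum_basisFn_sq {d : ℕ} (N : ℕ) (x : Fin d → ℝ) :
    ∑ n ∈ freqs d N, basisFn n x ^ 2 = numFeatures d N := by
  simp_rw [sq]
  rw [sum_basisFn_mul, sub_self, dirichletKernel, mul_div_cancel₀ _ (by positivity)]
  simp [numFeatures]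

lemma dirichletKernel_neg {d : ℕ} (n : ℕ) (z : Fin d → ℝ) :
    dirichletKernel n (-z) = dirichletKernel n z := by
  simp [dirichletKernel]

lemma isPeriodic_dirichletKernel {d : ℕ} (n : ℕ) :
    IsPeriodic (dirichletKernel n : (Fin d → ℝ) → ℝ) := by
  intro x k
  simp only [dirichletKernel_eq_prod]
  congr 1
  refine Finset.sum_congr rfl fun m _ => Finset.prod_congr rfl fun i _ => ?_
  rw [show (m i : ℝ) * Real.pi * (x i + k i * 2) =
    m i * Real.pi * x i + (m i * k i : ℤ) * (2 * Real.pi) by push_cast; ring,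
    Real.cos_add_int_mul_two_pi]

lemma continuous_dirichletKernel {d : ℕ} (n : ℕ) :
    Continuous (dirichletKernel n : (Fin d → ℝ) → ℝ) := by
  unfold dirichletKernel
  fun_prop

lemma vpKernel_neg {d : ℕ} (N : ℕ) (z : Fin d → ℝ) : vpKernel N (-z) = vpKernel N z := by
  simp [vpKernel, dirichletKernel_neg]

lemma isPeriodic_vpKernel {d : ℕ} (N : ℕ) : IsPeriodic (vpKernel N : (Fin d → ℝ) → ℝ) := by
  intro x k
  simp only [vpKernel]
  congr 1
  exact Finset.sum_congr rfl fun n _ => isPeriodic_dirichletKernel n x k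

lemma continuous_vpKernel {d : ℕ} (N : ℕ) : Continuous (vpKernel N : (Fin d → ℝ) → ℝ) := by
  unfold vpKernel
  exact (continuous_finsetSum _ fun n _ => continuous_dirichletKernel n).div_const _

/-! ### Trigonometric polynomials -/

/-- The trigonometric polynomials of `ℓ¹` degree at most `N`. -/
def trigSpan (d N : ℕ) : Submodule ℝ ((Fin d → ℝ) → ℝ) :=
  Submodule.span ℝ (basisFn '' (freqs d N : Set (Fin d → ℤ)))

lemma basisFn_mem_trigSpan {d N : ℕ} {n : Fin d → ℤ} (h : n ∈ freqs d N) :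
    basisFn n ∈ trigSpan d N :=
  Submodule.subset_span ⟨n, h, rfl⟩

lemma trigSpan_mono {d m n : ℕ} (h : m ≤ n) : trigSpan d m ≤ trigSpan d n :=
  Submodule.span_mono (Set.image_mono (by exact_mod_cast freqs_mono h))

lemma contDiff_of_mem_trigSpan {d N : ℕ} {P : (Fin d → ℝ) → ℝ} (hP : P ∈ trigSpan d N) :
    ContDiff ℝ ⊤ P := by
  induction hP using Submodule.span_induction with
  | mem x hx => obtain ⟨n, _, rfl⟩ := hx; exact contDiff_basisFn n
  | zero => exact contDiff_const
  | add x y _ _ hx hy => exact hx.add hy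
  | smul a x _ hx => exact hx.const_smul a

lemma isPeriodic_of_mem_trigSpan {d N : ℕ} {P : (Fin d → ℝ) → ℝ} (hP : P ∈ trigSpan d N) :
    IsPeriodic P := by
  induction hP using Submodule.span_induction with
  | mem x hx => obtain ⟨n, _, rfl⟩ := hx; exact isPeriodic_basisFn n
  | zero => intro x n; rfl
  | add x y _ _ hx hy => intro z n; simp only [Pi.add_apply]; rw [hx z n, hy z n]
  | smul a x _ hx => intro z n; simp only [Pi.smul_apply]; rw [hx z n]

lemma continuous_of_mem_trigSpan {d N : ℕ} {P : (Fin d → ℝ) → ℝ} (hP : P ∈ trigSpan d N) :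
    Continuous P :=
  (contDiff_of_mem_trigSpan hP).continuous

lemma integrable_cube {d : ℕ} {f : Cube d → ℝ} (hf : Measurable f) {B : ℝ} (hB : ∀ z, |f z| ≤ B) :
    Integrable f :=
  Integrable.of_bound hf.aestronglyMeasurable B (Filter.Eventually.of_forall hB)

lemma integrable_cube_of_continuous {d : ℕ} {f : Cube d → ℝ} (hf : Continuous f) :
    Integrable f := by
  obtain ⟨B, hB⟩ := isCompact_univ.exists_bound_of_continuousOn hf.continuousOn
  exact integrable_cube hf.measurable fun z => hB z (Set.mem_univ z)

/-- A function in the span of the features. -/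
lemma exists_feature_of_mem_trigSpan {d N : ℕ} {P : (Fin d → ℝ) → ℝ} (hP : P ∈ trigSpan d N) :
    ∃ θ : FeatIdx d N → ℝ, ∀ z : Cube d, P z.1 = dotProduct (feature N z) θ := by
  induction hP using Submodule.span_induction with
  | mem x hx =>
    obtain ⟨n, hn, rfl⟩ := hx
    refine ⟨Pi.single ⟨n, hn⟩ (∏ i, if n i = 0 then 1 else √2), fun z => ?_⟩
    rw [dotProduct_single, feature, ← Finset.prod_mul_distrib]
    unfold basisFn nsoc
    exact Finset.prod_congr rfl fun i _ => mul_comm _ _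
  | zero => exact ⟨0, fun z => by simp⟩
  | add x y _ _ hx hy =>
    obtain ⟨a, ha⟩ := hx
    obtain ⟨b, hb⟩ := hy
    exact ⟨a + b, fun z => by rw [dotProduct_add, Pi.add_apply, ha, hb]⟩
  | smul c x _ hx =>
    obtain ⟨a, ha⟩ := hx
    exact ⟨c • a, fun z => by rw [dotProduct_smul, Pi.smul_apply, ha]⟩

/-- The factor between the features and the orthonormal monomials. -/
def normFactor {d : ℕ} (n : Fin d → ℤ) : ℝ := ∏ i, if n i = 0 then 1 else √2

lemma normFactor_pos {d : ℕ} (n : Fin d → ℤ) : 0 < normFactor n := by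
  unfold normFactor
  refine Finset.prod_pos fun i _ => ?_
  split_ifs <;> positivity

lemma basisFn_eq_feature {d N : ℕ} (n : FeatIdx d N) (z : Cube d) :
    basisFn n.1 z.1 = normFactor n.1 * feature N z n := by
  unfold basisFn normFactor feature nsoc
  rw [← Finset.prod_mul_distrib]

lemma exists_trigSpan_feature {d N : ℕ} (θ : FeatIdx d N → ℝ) :
    ∃ P ∈ trigSpan d N, ∀ z : Cube d, P z.1 = dotProduct (feature N z) θ := by
  refine ⟨∑ n : FeatIdx d N, ((normFactor n.1)⁻¹ * θ n) • basisFn n.1,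
    Submodule.sum_mem _ fun n _ => Submodule.smul_mem _ _ (basisFn_mem_trigSpan n.2), fun z => ?_⟩
  rw [Finset.sum_apply, dotProduct]
  refine Finset.sum_congr rfl fun n _ => ?_
  rw [Pi.smul_apply, basisFn_eq_feature, smul_eq_mul]
  have := (normFactor_pos n.1).ne'
  field_simp

lemma circConv_dirichletKernel {d : ℕ} (N : ℕ) {f : Cube d → ℝ} (hf : Integrable f) (x : Cube d) :
    circConv (dirichletKernel N) f x =
      ∑ k ∈ freqs d N, ((∫ y : Cube d, f y * basisFn k y.1) / 2 ^ d) * basisFn k x.1 := by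
  unfold circConv
  have h : ∀ y : Cube d, f y * dirichletKernel N (x.1 - y.1) =
      ∑ k ∈ freqs d N, (f y * basisFn k y.1) * (basisFn k x.1 / 2 ^ d) := by
    intro y
    have h2 := sum_basisFn_mul N x.1 y.1
    rw [show dirichletKernel N (x.1 - y.1) =
      (∑ n ∈ freqs d N, basisFn n x.1 * basisFn n y.1) / 2 ^ d by rw [h2]; field_simp,
      Finset.sum_div, Finset.mul_sum]
    exact Finset.sum_congr rfl fun k _ => by ring
  simp_rw [h]
  rw [integral_finsetSum]
  · refine Finset.sum_congr rfl fun k _ => ?_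
    rw [integral_mul_const]
    ring
  · intro k _
    refine Integrable.mul_const ?_ _
    obtain ⟨B, hB⟩ := isCompact_univ.exists_bound_of_continuousOn
      ((contDiff_basisFn k).continuous.comp
        (continuous_subtype_val : Continuous (Subtype.val : Cube d → _))).continuousOn
    exact hf.mul_bdd ((contDiff_basisFn k).continuous.comp continuous_subtype_val).aestronglyMeasurable
      (Filter.Eventually.of_forall fun z => hB z (Set.mem_univ z))

lemma circConv_dirichletKernel_mem {d : ℕ} (N : ℕ) {f : Cube d → ℝ} (hf : Integrable f) :
    ∃ P ∈ trigSpan d N, ∀ x : Cube d, circConv (dirichletKernel N) f x = P x.1 := by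
  refine ⟨∑ k ∈ freqs d N, ((∫ y : Cube d, f y * basisFn k y.1) / 2 ^ d) • basisFn k,
    Submodule.sum_mem _ fun n hn => Submodule.smul_mem _ _ (basisFn_mem_trigSpan hn), fun x => ?_⟩
  rw [circConv_dirichletKernel N hf, Finset.sum_apply]
  rfl

lemma integrable_mul_continuous {d : ℕ} {f : Cube d → ℝ} (hf : Integrable f)
    {D : (Fin d → ℝ) → ℝ} (hD : Continuous D) (x : Cube d) :
    Integrable fun y : Cube d => f y * D (x.1 - y.1) := by
  have hc : Continuous fun y : Cube d => D (x.1 - y.1) := by fun_prop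
  obtain ⟨B, hB⟩ := isCompact_univ.exists_bound_of_continuousOn hc.continuousOn
  exact hf.mul_bdd hc.aestronglyMeasurable
      (Filter.Eventually.of_forall fun z => hB z (Set.mem_univ z))

lemma circConv_vpKernel {d : ℕ} (N : ℕ) {f : Cube d → ℝ} (hf : Integrable f) (x : Cube d) :
    circConv (vpKernel N) f x =
      (∑ n ∈ Finset.Icc (N / 2) N, circConv (dirichletKernel n) f x) /
        (((N / 2 : ℕ) : ℝ) + 1) := by
  unfold circConv vpKernel
  rw [← integral_finsetSum _
    fun n _ => integrable_mul_continuous hf (continuous_dirichletKernel n) x, ← integral_div]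
  simp_rw [← Finset.mul_sum, mul_div_assoc]

/-- Convolution with the de la Vallée Poussin kernel produces trigonometric polynomials. -/
lemma circConv_vpKernel_mem {d : ℕ} (N : ℕ) {f : Cube d → ℝ} (hf : Integrable f) :
    ∃ P ∈ trigSpan d N, ∀ x : Cube d, circConv (vpKernel N) f x = P x.1 := by
  choose P hP hPx using fun n : ℕ => circConv_dirichletKernel_mem n hf
  refine ⟨(((N / 2 : ℕ) : ℝ) + 1)⁻¹ • ∑ n ∈ Finset.Icc (N / 2) N, P n,
    Submodule.smul_mem _ _ (Submodule.sum_mem _ fun n hn =>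
      trigSpan_mono (Finset.mem_Icc.1 hn).2 (hP n)), fun x => ?_⟩
  rw [circConv_vpKernel N hf, Pi.smul_apply, Finset.sum_apply, smul_eq_mul, div_eq_inv_mul]
  simp_rw [hPx]

lemma integrable_of_mem_trigSpan {d N : ℕ} {P : (Fin d → ℝ) → ℝ} (hP : P ∈ trigSpan d N) :
    Integrable fun z : Cube d => P z.1 :=
  integrable_cube_of_continuous ((continuous_of_mem_trigSpan hP).comp continuous_subtype_val)

/-- The Dirichlet kernel reproduces trigonometric polynomials. -/
lemma circConv_dirichletKernel_self {d m N : ℕ} (hmN : m ≤ N) {P : (Fin d → ℝ) → ℝ}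
    (hP : P ∈ trigSpan d m) (x : Cube d) :
    circConv (dirichletKernel N) (fun z : Cube d => P z.1) x = P x.1 := by
  classical
  induction hP using Submodule.span_induction with
  | mem P hP =>
    obtain ⟨n, hn, rfl⟩ := hP
    rw [circConv_dirichletKernel N (integrable_of_mem_trigSpan (basisFn_mem_trigSpan hn))]
    simp_rw [integral_basisFn_mul]
    rw [Finset.sum_eq_single n]
    · simp
    · intro k _ hk; simp [hk.symm]
    · intro h; exact absurd (freqs_mono hmN hn) h
  | zero => simp [circConv]
  | add P Q hP hQ ihP ihQ =>
    rw [Pi.add_apply, ← ihP, ← ihQ]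
    unfold circConv
    rw [← integral_add (integrable_mul_continuous (integrable_of_mem_trigSpan hP)
        (continuous_dirichletKernel N) x)
      (integrable_mul_continuous (integrable_of_mem_trigSpan hQ) (continuous_dirichletKernel N) x)]
    simp only [Pi.add_apply, add_mul]
  | smul a P _ ih =>
    rw [Pi.smul_apply, ← ih]
    unfold circConv
    simp only [Pi.smul_apply, smul_eq_mul, mul_assoc]
    rw [integral_const_mul]

/-- The de la Vallée Poussin kernel reproduces trigonometric polynomials of half its degree. -/
lemma circConv_vpKernel_self {d N : ℕ} (hN : Even N) {P : (Fin d → ℝ) → ℝ}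
    (hP : P ∈ trigSpan d (N / 2)) (x : Cube d) :
    circConv (vpKernel N) (fun z : Cube d => P z.1) x = P x.1 := by
  rw [circConv_vpKernel N (integrable_of_mem_trigSpan hP), div_eq_iff (by positivity)]
  rw [Finset.sum_congr rfl fun n hn =>
    circConv_dirichletKernel_self (Finset.mem_Icc.1 hn).1 hP x, Finset.sum_const, Nat.card_Icc,
    nsmul_eq_mul, mul_comm]
  congr 1
  obtain ⟨k, rfl⟩ := hN
  rw [show (k + k) / 2 = k by omega, show k + k + 1 - k = k + 1 by omega]
  push_cast
  rfl

/-- Lipschitz bound for a trigonometric polynomial in terms of its sup norm. -/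
lemma abs_sub_le_of_mem_trigSpan {d N : ℕ} {P : (Fin d → ℝ) → ℝ} (hP : P ∈ trigSpan d N)
    {B : ℝ} (hB : ∀ z : Cube d, |P z.1| ≤ B) (x y : Cube d) {δ : ℝ} (hδ : 0 ≤ δ)
    (hxy : ∀ i, |x.1 i - y.1 i| ≤ δ) :
    |P x.1 - P y.1| ≤ B * (numFeatures d N * (Real.pi * N * δ)) := by
  have hB0 : 0 ≤ B := (abs_nonneg _).trans (hB x)
  rw [← circConv_dirichletKernel_self le_rfl hP x, ← circConv_dirichletKernel_self le_rfl hP y]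
  unfold circConv
  rw [← integral_sub
    (integrable_mul_continuous (integrable_of_mem_trigSpan hP) (continuous_dirichletKernel N) x)
    (integrable_mul_continuous (integrable_of_mem_trigSpan hP) (continuous_dirichletKernel N) y)]
  have hb : ∀ w : Cube d, ‖P w.1 * dirichletKernel N (x.1 - w.1) -
      P w.1 * dirichletKernel N (y.1 - w.1)‖ ≤
      B * (numFeatures d N * (Real.pi * N * δ)) / 2 ^ d := by
    intro w
    rw [← mul_sub, Real.norm_eq_abs, abs_mul, mul_div_assoc]
    refine mul_le_mul (hB w) ?_ (abs_nonneg _) hB0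
    unfold dirichletKernel
    rw [← sub_div, abs_div, abs_of_pos (by positivity : (0 : ℝ) < 2 ^ d), ← Finset.sum_sub_distrib]
    gcongr
    refine (Finset.abs_sum_le_sum_abs _ _).trans ?_
    rw [numFeatures, ← nsmul_eq_mul]
    refine Finset.sum_le_card_nsmul _ _ _ fun k hk => ?_
    have hcos : ∀ a b : ℝ, |Real.cos a - Real.cos b| ≤ |a - b| := fun a b => by
      simpa [Real.dist_eq] using Real.lipschitzWith_cos.dist_le_mul a b
    refine (hcos _ _).trans ?_
    rw [← mul_sub, abs_mul, abs_of_pos Real.pi_pos, mul_assoc]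
    refine mul_le_mul_of_nonneg_left ?_ Real.pi_pos.le
    rw [← Finset.sum_sub_distrib]
    have hk' : ∑ i, |(k i : ℝ)| ≤ N := by
      have := mem_freqs.1 hk
      exact_mod_cast this
    calc |∑ i, ((k i : ℝ) * (x.1 - w.1) i - (k i : ℝ) * (y.1 - w.1) i)|
        ≤ ∑ i, |(k i : ℝ)| * δ := by
          refine (Finset.abs_sum_le_sum_abs _ _).trans (Finset.sum_le_sum fun i _ => ?_)
          rw [← mul_sub, abs_mul]
          refine mul_le_mul_of_nonneg_left ?_ (abs_nonneg _)
          simpa using hxy i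
      _ ≤ N * δ := by rw [← Finset.sum_mul]; gcongr
  have := norm_integral_le_of_norm_le_const (μ := (volume : Measure (Cube d)))
    (Filter.Eventually.of_forall hb)
  rw [volume_real_cube, div_mul_cancel₀ _ (by positivity)] at this
  exact this

/-! ### Sums over `ℓ¹` balls as coefficients of power series -/

lemma sum_freqs_eq_sum_coeff {R : Type*} [CommRing R] {d : ℕ} (a : Fin d → ℤ → R) (N : ℕ) :
    ∑ k ∈ freqs d N, ∏ i, a i (k i) = ∑ j ∈ Finset.range (N + 1),
      PowerSeries.coeff j (∏ i, PowerSeries.mk fun l : ℕ =>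
        ∑ k ∈ ({(l : ℤ), -(l : ℤ)} : Finset ℤ), a i k) := by
  classical
  have hnat : ∀ k : Fin d → ℤ, ((∑ i, (k i).natAbs : ℕ) : ℤ) = ∑ i, |k i| := by
    intro k; push_cast; rfl
  rw [← Finset.sum_fiberwise_of_maps_to (s := freqs d N) (t := Finset.range (N + 1))
    (g := fun k => ∑ i, (k i).natAbs)]
  · refine Finset.sum_congr rfl fun j hj => ?_
    rw [PowerSeries.coeff_prod]
    rw [← Finset.sum_fiberwise_of_maps_to (t := Finset.finsuppAntidiag Finset.univ j)
      (g := fun k : Fin d → ℤ => Finsupp.equivFunOnFinite.symm fun i => (k i).natAbs)]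
    · refine Finset.sum_congr rfl fun l hl => ?_
      simp only [PowerSeries.coeff_mk]
      rw [Finset.prod_univ_sum]
      refine Finset.sum_congr ?_ fun _ _ => rfl
      ext k
      rw [Finset.mem_finsuppAntidiag] at hl
      simp only [Finset.mem_filter, Fintype.mem_piFinset, Finset.mem_insert, Finset.mem_singleton,
        mem_freqs, ← Int.natAbs_eq_iff]
      constructor
      · rintro ⟨_, h⟩ i
        have := DFunLike.congr_fun h i
        simpa using this
      · intro h
        have hk : (fun i => (k i).natAbs) = l := funext h
        have hs : ∑ i, (k i).natAbs = j := by rw [← hl.1]; simp_rw [h]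
        refine ⟨⟨?_, hs⟩, ?_⟩
        · rw [← hnat, hs]
          have := Finset.mem_range.1 hj
          omega
        · ext i; simpa using h i
    · intro k hk
      rw [Finset.mem_filter] at hk
      rw [Finset.mem_finsuppAntidiag]
      exact ⟨by simpa using hk.2, Finset.subset_univ _⟩
  · intro k hk
    rw [mem_freqs, ← hnat] at hk
    rw [Finset.mem_range]
    omega

/-- The power series `P` converges absolutely at `r`, with sum `w`. -/
def EvalsTo (P : PowerSeries ℂ) (r w : ℂ) : Prop :=
  Summable (fun k => ‖PowerSeries.coeff k P * r ^ k‖) ∧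
    ∑' k, PowerSeries.coeff k P * r ^ k = w

lemma EvalsTo.mul {P Q : PowerSeries ℂ} {r v w : ℂ} (hP : EvalsTo P r v) (hQ : EvalsTo Q r w) :
    EvalsTo (P * Q) r (v * w) := by
  have e : ∀ n, PowerSeries.coeff n (P * Q) * r ^ n = ∑ kl ∈ Finset.HasAntidiagonal.antidiagonal n,
      (PowerSeries.coeff kl.1 P * r ^ kl.1) * (PowerSeries.coeff kl.2 Q * r ^ kl.2) := by
    intro n
    rw [PowerSeries.coeff_mul, Finset.sum_mul]
    refine Finset.sum_congr rfl fun kl hkl => ?_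
    rw [← Finset.HasAntidiagonal.mem_antidiagonal.1 hkl, pow_add]
    ring
  refine ⟨?_, (tsum_congr e).trans ?_⟩
  · refine (summable_norm_sum_mul_antidiagonal_of_summable_norm hP.1 hQ.1).congr fun n => ?_
    rw [e]
  · rw [← hP.2, ← hQ.2]
    exact (tsum_mul_tsum_eq_tsum_sum_antidiagonal_of_summable_norm hP.1 hQ.1).symm

lemma evalsTo_prod {ι : Type*} (s : Finset ι) {P : ι → PowerSeries ℂ} {r : ℂ} {w : ι → ℂ}
    (h : ∀ i ∈ s, EvalsTo (P i) r (w i)) : EvalsTo (∏ i ∈ s, P i) r (∏ i ∈ s, w i) := by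
  classical
  induction s using Finset.induction_on with
  | empty =>
    have hz : ∀ k ∉ ({0} : Finset ℕ), PowerSeries.coeff k (1 : PowerSeries ℂ) * r ^ k = 0 := by
      intro k hk
      rw [PowerSeries.coeff_one, if_neg (by simpa using hk), zero_mul]
    refine ⟨summable_of_ne_finset_zero (s := {0}) fun k hk => by
      rw [Finset.prod_empty, hz k hk, norm_zero], ?_⟩
    rw [Finset.prod_empty, tsum_eq_sum hz]
    simp
  | insert i s hi ih =>
    rw [Finset.prod_insert hi, Finset.prod_insert hi]
    exact (h i (Finset.mem_insert_self _ _)).mul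
      (ih fun j hj => h j (Finset.mem_insert_of_mem hj))

lemma evalsTo_geom {r : ℂ} (hr : ‖r‖ < 1) :
    EvalsTo (PowerSeries.mk fun _ => 1) r (1 - r)⁻¹ := by
  simp only [EvalsTo, PowerSeries.coeff_mk, one_mul]
  refine ⟨?_, tsum_geometric_of_norm_lt_one hr⟩
  simp_rw [norm_pow]
  exact summable_geometric_of_lt_one (norm_nonneg _) hr

/-- The character `t ↦ exp (iπt)`. -/
def chr (t : ℝ) : ℂ := Complex.exp ((Real.pi * t : ℝ) * Complex.I)

lemma norm_chr (t : ℝ) : ‖chr t‖ = 1 := Complex.norm_exp_ofReal_mul_I _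

lemma chr_add (s t : ℝ) : chr (s + t) = chr s * chr t := by
  unfold chr; rw [← Complex.exp_add]; congr 1; push_cast; ring

lemma chr_neg_mul (t : ℝ) : chr (-t) * chr t = 1 := by
  rw [← chr_add]; simp [chr]

lemma chr_nat_mul (k : ℕ) (t : ℝ) : chr (k * t) = chr t ^ k := by
  unfold chr; rw [← Complex.exp_nat_mul]; congr 1; push_cast; ring

lemma continuous_chr : Continuous chr := by unfold chr; fun_prop

/-- The Poisson kernel `∑_k r^{|k|} cos (kπt)`, for a complex radius `r`. -/
def poissonKernel (r : ℂ) (t : ℝ) : ℂ := (1 - r ^ 2) / ((1 - r * chr t) * (1 - r * chr (-t)))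

lemma one_sub_mul_chr_ne_zero {r : ℂ} (hr : ‖r‖ < 1) (t : ℝ) : 1 - r * chr t ≠ 0 := by
  intro h
  have : ‖r * chr t‖ = 1 := by rw [← sub_eq_zero.1 h, norm_one]
  rw [norm_mul, norm_chr, mul_one] at this
  exact hr.ne this

lemma evalsTo_poissonKernel {r : ℂ} (hr : ‖r‖ < 1) (t : ℝ) :
    EvalsTo (PowerSeries.mk fun l : ℕ => ∑ k ∈ ({(l : ℤ), -(l : ℤ)} : Finset ℤ),
      (Real.cos (k * Real.pi * t) : ℂ)) r (poissonKernel r t) := by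
  have h1 : ‖r * chr t‖ < 1 := by rwa [norm_mul, norm_chr, mul_one]
  have h2 : ‖r * chr (-t)‖ < 1 := by rwa [norm_mul, norm_chr, mul_one]
  have hcos : ∀ k : ℕ, 2 * (Real.cos (k * Real.pi * t) : ℂ) = chr t ^ k + chr (-t) ^ k := by
    intro k
    rw [← chr_nat_mul, ← chr_nat_mul]
    unfold chr
    rw [Complex.ofReal_cos, Complex.two_cos]
    push_cast
    congr 2 <;> ring
  have e : ∀ k : ℕ, PowerSeries.coeff k (PowerSeries.mk fun l : ℕ =>
      ∑ k ∈ ({(l : ℤ), -(l : ℤ)} : Finset ℤ), (Real.cos (k * Real.pi * t) : ℂ)) * r ^ k =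
      (r * chr t) ^ k + (r * chr (-t)) ^ k - (if k = 0 then 1 else 0) := by
    intro k
    rw [PowerSeries.coeff_mk]
    rcases Nat.eq_zero_or_pos k with rfl | hk
    · simp
    · rw [Finset.sum_pair (by omega), if_neg hk.ne', mul_pow, mul_pow, sub_zero, ← mul_add,
        ← hcos]
      push_cast
      simp only [neg_mul, Complex.cos_neg]
      ring
  have s1 := summable_geometric_of_norm_lt_one h1
  have s2 := summable_geometric_of_norm_lt_one h2
  have s3 : HasSum (fun k : ℕ => if k = 0 then (1 : ℂ) else 0) 1 := hasSum_ite_eq 0 1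
  refine ⟨?_, ?_⟩
  · simp_rw [e]
    refine Summable.of_nonneg_of_le (fun _ => norm_nonneg _)
      (fun k => (norm_sub_le _ _).trans (add_le_add_left (norm_add_le _ _) _)) ?_
    refine Summable.add (Summable.add ?_ ?_) ?_
    · simp_rw [norm_pow]; exact summable_geometric_of_lt_one (norm_nonneg _) h1
    · simp_rw [norm_pow]; exact summable_geometric_of_lt_one (norm_nonneg _) h2
    · exact s3.summable.norm
  · simp_rw [e]
    have := ((hasSum_geometric_of_norm_lt_one h1).add (hasSum_geometric_of_norm_lt_one h2)).sub s3
    rw [this.tsum_eq]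
    have n1 := one_sub_mul_chr_ne_zero hr t
    have n2 := one_sub_mul_chr_ne_zero hr (-t)
    have h := chr_neg_mul t
    unfold poissonKernel
    field_simp
    linear_combination (-r ^ 2) * h

/-! ### The `L¹` norm of the Poisson kernel at a complex radius -/

lemma norm_one_sub_mul_chr_ge {ρ y : ℝ} (hρ : 1 / 2 ≤ ρ) (hρ1 : ρ < 1) (hy : |y| ≤ 1) :
    ((1 - ρ) + |y|) / 2 ≤ ‖1 - (ρ : ℂ) * chr y‖ := by
  have hsq : ‖1 - (ρ : ℂ) * chr y‖ ^ 2 = (1 - ρ) ^ 2 + 2 * ρ * (1 - Real.cos (Real.pi * y)) := by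
    rw [← Complex.normSq_eq_norm_sq, chr, Complex.normSq_apply]
    simp only [Complex.sub_re, Complex.one_re, Complex.mul_re, Complex.ofReal_re,
      Complex.exp_ofReal_mul_I_re, Complex.ofReal_im, Complex.exp_ofReal_mul_I_im, zero_mul,
      sub_zero, Complex.sub_im, Complex.one_im, Complex.mul_im, add_zero]
    have := Real.sin_sq_add_cos_sq (Real.pi * y)
    linear_combination (ρ ^ 2) * this
  have hc : Real.cos (Real.pi * y) ≤ 1 - 2 * y ^ 2 := by
    have h := Real.cos_le_one_sub_mul_cos_sq (x := Real.pi * y) (by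
      rw [abs_mul, abs_of_pos Real.pi_pos]
      exact mul_le_of_le_one_right Real.pi_pos.le hy)
    have e : 2 / Real.pi ^ 2 * (Real.pi * y) ^ 2 = 2 * y ^ 2 := by
      have := Real.pi_pos.ne'
      field_simp
    linarith
  have h0 : 0 ≤ 1 - ρ := by linarith
  refine le_of_sq_le_sq ?_ (norm_nonneg _)
  rw [hsq]
  have : 2 * y ^ 2 ≤ 2 * ρ * (1 - Real.cos (Real.pi * y)) := by nlinarith [sq_nonneg y]
  nlinarith [sq_abs y, sq_nonneg ((1 - ρ) - |y|), sq_nonneg y, sq_nonneg (1 - ρ)]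

lemma integral_norm_rpow_le {ρ s : ℝ} (hρ : 1 / 2 ≤ ρ) (hρ1 : ρ < 1) (hs : 1 < s) :
    ∫ y in (-1 : ℝ)..1, ‖1 - (ρ : ℂ) * chr y‖ ^ (-s) ≤
      2 ^ (s + 1) / (s - 1) * (1 - ρ) ^ (1 - s) := by
  have ha : 0 < 1 - ρ := by linarith
  set a := 1 - ρ with hadef
  have hcont : Continuous fun y : ℝ => 2 ^ s * (a + |y|) ^ (-s) := by
    refine continuous_const.mul (Continuous.rpow_const (by fun_prop) fun y => Or.inl ?_)
    positivity
  have hcont' : Continuous fun y : ℝ => ‖1 - (ρ : ℂ) * chr y‖ ^ (-s) := by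
    refine Continuous.rpow_const ?_ fun y => Or.inl ?_
    · have := continuous_chr; fun_prop
    · refine norm_ne_zero_iff.2 (one_sub_mul_chr_ne_zero ?_ y)
      rw [Complex.norm_real, Real.norm_of_nonneg (by linarith)]; exact hρ1
  have h1 : ∫ y in (-1 : ℝ)..1, ‖1 - (ρ : ℂ) * chr y‖ ^ (-s) ≤
      ∫ y in (-1 : ℝ)..1, 2 ^ s * (a + |y|) ^ (-s) := by
    refine intervalIntegral.integral_mono_on (by norm_num) (hcont'.intervalIntegrable _ _)
      (hcont.intervalIntegrable _ _) fun y hy => ?_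
    have hlow := norm_one_sub_mul_chr_ge hρ hρ1 (abs_le.2 hy)
    have hp : 0 < (a + |y|) / 2 := by positivity
    refine (Real.rpow_le_rpow_of_nonpos hp hlow (by linarith)).trans (le_of_eq ?_)
    rw [Real.div_rpow (by positivity) zero_le_two, Real.rpow_neg zero_le_two, div_inv_eq_mul,
      mul_comm]
  have h2 : ∫ y in (0 : ℝ)..1, (a + |y|) ^ (-s) ≤ a ^ (1 - s) / (s - 1) := by
    have e : ∫ y in (0 : ℝ)..1, (a + |y|) ^ (-s) = ∫ y in (0 : ℝ)..1, (a + y) ^ (-s) := by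
      refine intervalIntegral.integral_congr fun y hy => ?_
      rw [Set.uIcc_of_le zero_le_one] at hy
      simp only [abs_of_nonneg hy.1]
    rw [e, intervalIntegral.integral_comp_add_left (fun x => x ^ (-s)), integral_rpow]
    · have hpos : 0 ≤ (a + 1) ^ (1 - s) := by positivity
      have hs' : 0 < s - 1 := by linarith
      rw [add_zero, show -s + 1 = 1 - s by ring, ← neg_div_neg_eq, neg_sub, neg_sub]
      gcongr
      linarith
    · refine Or.inr ⟨by linarith, ?_⟩
      rw [add_zero, Set.uIcc_of_le (by linarith)]
      exact fun h => absurd h.1 (not_le.2 ha)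
  have h3 : ∫ y in (-1 : ℝ)..0, (a + |y|) ^ (-s) = ∫ y in (0 : ℝ)..1, (a + |y|) ^ (-s) := by
    have := intervalIntegral.integral_comp_neg (a := 0) (b := 1)
      (fun y : ℝ => (a + |y|) ^ (-s))
    simp only [abs_neg, neg_zero] at this
    exact this.symm
  have hci : ∀ u v : ℝ, IntervalIntegrable (fun y : ℝ => (a + |y|) ^ (-s)) volume u v := by
    intro u v
    refine Continuous.intervalIntegrable ?_ _ _
    refine Continuous.rpow_const (by fun_prop) fun y => Or.inl ?_
    positivity
  refine h1.trans ?_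
  rw [intervalIntegral.integral_const_mul,
    ← intervalIntegral.integral_add_adjacent_intervals (hci (-1) 0) (hci 0 1), h3,
    Real.rpow_add_one two_ne_zero]
  have h2s : (0 : ℝ) ≤ 2 ^ s := by positivity
  calc (2 : ℝ) ^ s * (_ + _) ≤ 2 ^ s * (a ^ (1 - s) / (s - 1) + a ^ (1 - s) / (s - 1)) := by gcongr
    _ = 2 ^ s * 2 / (s - 1) * a ^ (1 - s) := by ring

lemma chr_periodic : Function.Periodic chr 2 := by
  intro t
  unfold chr
  rw [show ((Real.pi * (t + 2) : ℝ) : ℂ) * Complex.I =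
    (Real.pi * t : ℝ) * Complex.I + 2 * Real.pi * Complex.I by push_cast; ring,
    Complex.exp_add, Complex.exp_two_pi_mul_I, mul_one]

lemma integral_norm_shift (ρ s τ : ℝ) :
    ∫ y in (-1 : ℝ)..1, ‖1 - (ρ : ℂ) * chr (τ + y)‖ ^ (-s) =
      ∫ y in (-1 : ℝ)..1, ‖1 - (ρ : ℂ) * chr y‖ ^ (-s) := by
  rw [intervalIntegral.integral_comp_add_left (fun y => ‖1 - (ρ : ℂ) * chr y‖ ^ (-s))]
  have hp : Function.Periodic (fun y => ‖1 - (ρ : ℂ) * chr y‖ ^ (-s)) 2 := fun y => by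
    simp only [chr_periodic y]
  have := hp.intervalIntegral_add_eq (τ + -1) (-1)
  rwa [show τ + -1 + 2 = τ + 1 by ring, show (-1 : ℝ) + 2 = 1 by norm_num] at this

/-- The bound interpolates between the numerator `|1 - r²|` and the sum of the two factors of the
denominator, which dominates it; the larger factor is then cancelled. -/
lemma norm_poissonKernel_le {r : ℂ} (hr : ‖r‖ < 1) {η : ℝ} (hη0 : 0 < η) (hη1 : η ≤ 1) (t : ℝ) :
    ‖poissonKernel r t‖ ≤ 2 * ‖1 - r ^ 2‖ ^ η *
      (‖1 - r * chr t‖ ^ (-(1 + η)) + ‖1 - r * chr (-t)‖ ^ (-(1 + η))) := by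
  have hA : 0 < ‖1 - r * chr t‖ := norm_pos_iff.2 (one_sub_mul_chr_ne_zero hr t)
  have hB : 0 < ‖1 - r * chr (-t)‖ := norm_pos_iff.2 (one_sub_mul_chr_ne_zero hr (-t))
  have hAB : ‖1 - r ^ 2‖ ≤ ‖1 - r * chr t‖ + ‖1 - r * chr (-t)‖ := by
    have e : 1 - r ^ 2 = (1 - r * chr t) + r * chr t * (1 - r * chr (-t)) := by
      linear_combination (r ^ 2) * chr_neg_mul t
    rw [e]
    refine (norm_add_le _ _).trans (add_le_add le_rfl ?_)
    rw [norm_mul, norm_mul, norm_chr, mul_one]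
    exact mul_le_of_le_one_left hB.le hr.le
  have hD : 0 ≤ ‖1 - r ^ 2‖ := norm_nonneg _
  unfold poissonKernel
  rw [norm_div, norm_mul]
  generalize ‖1 - r * chr t‖ = A at *
  generalize ‖1 - r * chr (-t)‖ = B at *
  generalize ‖1 - r ^ 2‖ = D at *
  -- the bound for the case in which `A` is the larger of the two factors
  have key : ∀ A B : ℝ, 0 < A → 0 < B → D ≤ A + B → B ≤ A →
      D / (A * B) ≤ 2 * D ^ η * B ^ (-(1 + η)) := by
    intro A B hA hB hAB hBA
    have h1 : D ≤ D ^ η * (2 * A ^ (1 - η)) := by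
      rcases hD.eq_or_lt with h0 | hpos
      · rw [← h0]; positivity
      · calc D = D ^ η * D ^ (1 - η) := by rw [← Real.rpow_add hpos]; simp
          _ ≤ D ^ η * (2 * A) ^ (1 - η) := by gcongr; linarith
          _ ≤ D ^ η * (2 * A ^ (1 - η)) := by
            rw [Real.mul_rpow zero_le_two hA.le]
            gcongr
            calc (2 : ℝ) ^ (1 - η) ≤ 2 ^ (1 : ℝ) :=
                  Real.rpow_le_rpow_of_exponent_le one_le_two (by linarith)
              _ = 2 := Real.rpow_one 2
    rw [div_le_iff₀ (by positivity)]
    calc D ≤ D ^ η * (2 * A ^ (1 - η)) := h1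
      _ = D ^ η * 2 * (A * A ^ (-η)) := by
          rw [show 1 - η = 1 + -η by ring, Real.rpow_add hA, Real.rpow_one]; ring
      _ ≤ D ^ η * 2 * (A * B ^ (-η)) := by
          gcongr ?_ * (?_ * ?_)
          exact Real.rpow_le_rpow_of_nonpos hB hBA (by linarith)
      _ = 2 * D ^ η * B ^ (-(1 + η)) * (A * B) := by
          rw [show -(1 + η) = -η - 1 by ring, Real.rpow_sub_one hB.ne']
          field_simp
  rcases le_total B A with h | h
  · refine (key A B hA hB hAB h).trans ?_
    gcongr
    have : 0 ≤ A ^ (-(1 + η)) := by positivity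
    linarith
  · rw [mul_comm A B]
    refine (key B A hB hA (by linarith) h).trans ?_
    gcongr
    have : 0 ≤ B ^ (-(1 + η)) := by positivity
    linarith

lemma continuous_poissonKernel {r : ℂ} (hr : ‖r‖ < 1) : Continuous (poissonKernel r) := by
  unfold poissonKernel
  have := continuous_chr
  refine Continuous.div (by fun_prop) (by fun_prop) fun t => ?_
  exact mul_ne_zero (one_sub_mul_chr_ne_zero hr t) (one_sub_mul_chr_ne_zero hr (-t))

/-- The `L¹` norm of the Poisson kernel at the complex radius `r` grows more slowly than any power
of `|1 - r| / (1 - |r|)`. -/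
lemma integral_norm_poissonKernel_le {ρ η : ℝ} (hρ : 1 / 2 ≤ ρ) (hρ1 : ρ < 1) (hη0 : 0 < η)
    (hη1 : η ≤ 1) (τ : ℝ) :
    ∫ t in (-1 : ℝ)..1, ‖poissonKernel (ρ * chr τ) t‖ ≤
      64 / η * (‖1 - (ρ : ℂ) * chr τ‖ / (1 - ρ)) ^ η := by
  set r : ℂ := ρ * chr τ with hrdef
  have hrn : ‖r‖ = ρ := by
    rw [hrdef, norm_mul, norm_chr, mul_one, Complex.norm_real, Real.norm_of_nonneg (by linarith)]
  have hr : ‖r‖ < 1 := by rw [hrn]; exact hρ1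
  have ha : 0 < 1 - ρ := by linarith
  have e1 : ∀ t, r * chr t = ρ * chr (τ + t) := fun t => by rw [hrdef, chr_add]; ring
  have hci : Continuous fun t : ℝ => ‖1 - (ρ : ℂ) * chr (τ + t)‖ ^ (-(1 + η)) := by
    refine Continuous.rpow_const ?_ fun y => Or.inl ?_
    · have := continuous_chr; fun_prop
    · rw [← e1]; exact norm_ne_zero_iff.2 (one_sub_mul_chr_ne_zero hr y)
  have hci' : Continuous fun t : ℝ => ‖1 - (ρ : ℂ) * chr (τ + -t)‖ ^ (-(1 + η)) :=
    hci.comp continuous_neg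
  have hb := integral_norm_rpow_le hρ hρ1 (s := 1 + η) (by linarith)
  have i1 := integral_norm_shift ρ (1 + η) τ
  have i2 : ∫ y in (-1 : ℝ)..1, ‖1 - (ρ : ℂ) * chr (τ + -y)‖ ^ (-(1 + η)) =
      ∫ y in (-1 : ℝ)..1, ‖1 - (ρ : ℂ) * chr y‖ ^ (-(1 + η)) := by
    rw [intervalIntegral.integral_comp_neg
      (fun y => ‖1 - (ρ : ℂ) * chr (τ + y)‖ ^ (-(1 + η))), neg_neg, i1]
  have hsq : ‖1 - r ^ 2‖ ^ η ≤ 2 * ‖1 - r‖ ^ η := by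
    have h2 : ‖1 - r ^ 2‖ ≤ 2 * ‖1 - r‖ := by
      rw [show 1 - r ^ 2 = (1 + r) * (1 - r) by ring, norm_mul]
      gcongr
      refine (norm_add_le _ _).trans ?_
      rw [norm_one]; linarith
    calc ‖1 - r ^ 2‖ ^ η ≤ (2 * ‖1 - r‖) ^ η := by gcongr
      _ = 2 ^ η * ‖1 - r‖ ^ η := Real.mul_rpow zero_le_two (norm_nonneg _)
      _ ≤ 2 * ‖1 - r‖ ^ η := by
        gcongr
        calc (2 : ℝ) ^ η ≤ 2 ^ (1 : ℝ) := Real.rpow_le_rpow_of_exponent_le one_le_two hη1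
          _ = 2 := Real.rpow_one 2
  calc ∫ t in (-1 : ℝ)..1, ‖poissonKernel r t‖
      ≤ ∫ t in (-1 : ℝ)..1, 2 * ‖1 - r ^ 2‖ ^ η * (‖1 - (ρ : ℂ) * chr (τ + t)‖ ^ (-(1 + η)) +
          ‖1 - (ρ : ℂ) * chr (τ + -t)‖ ^ (-(1 + η))) := by
        refine intervalIntegral.integral_mono_on (by norm_num)
          ((continuous_poissonKernel hr).norm.intervalIntegrable _ _)
          ((continuous_const.mul (hci.add hci')).intervalIntegrable _ _) fun t _ => ?_
        rw [← e1, ← e1]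
        exact norm_poissonKernel_le hr hη0 hη1 t
    _ = 2 * ‖1 - r ^ 2‖ ^ η * (2 * ∫ y in (-1 : ℝ)..1, ‖1 - (ρ : ℂ) * chr y‖ ^ (-(1 + η))) := by
        rw [intervalIntegral.integral_const_mul, intervalIntegral.integral_add
          (hci.intervalIntegrable _ _) (hci'.intervalIntegrable _ _), i1, i2, two_mul (∫ _ in _.._, _)]
    _ ≤ 2 * (2 * ‖1 - r‖ ^ η) * (2 * (8 / η * (1 - ρ) ^ (-η))) := by
        refine mul_le_mul (mul_le_mul_of_nonneg_left hsq zero_le_two)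
          (mul_le_mul_of_nonneg_left ?_ zero_le_two) ?_ (by positivity)
        · refine hb.trans ?_
          rw [show 1 + η - 1 = η by ring, show 1 - (1 + η) = -η by ring]
          gcongr
          calc (2 : ℝ) ^ (1 + η + 1) ≤ 2 ^ (3 : ℝ) :=
              Real.rpow_le_rpow_of_exponent_le one_le_two (by linarith)
            _ = 8 := by norm_num
        · refine mul_nonneg zero_le_two (intervalIntegral.integral_nonneg (by norm_num) fun _ _ => ?_)
          positivity
    _ = 64 / η * (‖1 - r‖ / (1 - ρ)) ^ η := by
        rw [Real.div_rpow (norm_nonneg _) ha.le, Real.rpow_neg ha.le]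
        ring

lemma integral_chr_int (k : ℤ) : ∫ τ in (-1 : ℝ)..1, chr (k * τ) = if k = 0 then 2 else 0 := by
  split_ifs with h
  · subst h
    simp only [Int.cast_zero, zero_mul, chr, mul_zero, Complex.ofReal_zero, Complex.exp_zero,
      intervalIntegral.integral_const]
    norm_num
  · have hc : (Real.pi * k * Complex.I : ℂ) ≠ 0 := by
      simp [Real.pi_ne_zero, h]
    have e : ∀ τ : ℝ, chr (k * τ) = Complex.exp (Real.pi * k * Complex.I * τ) := by
      intro τ; unfold chr; congr 1; push_cast; ring
    simp_rw [e]
    rw [integral_exp_mul_complex hc, div_eq_zero_iff]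
    left
    rw [sub_eq_zero, Complex.exp_eq_exp_iff_exists_int]
    exact ⟨k, by push_cast; ring⟩

/-- Cauchy's estimate for the coefficients of a power series, in mean over a circle. -/
lemma norm_coeff_mul_pow_le {P : PowerSeries ℂ} {ρ : ℝ} (hρ : 0 ≤ ρ) {W : ℝ → ℂ}
    (hW : ∀ τ, EvalsTo P (ρ * chr τ) (W τ)) (n : ℕ) :
    2 * (‖PowerSeries.coeff n P‖ * ρ ^ n) ≤ ∫ τ in (-1 : ℝ)..1, ‖W τ‖ := by
  have hsum : Summable fun k => ‖PowerSeries.coeff k P‖ * ρ ^ k := by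
    refine (hW 0).1.congr fun k => ?_
    rw [norm_mul, norm_pow, norm_mul, norm_chr, mul_one, Complex.norm_real,
      Real.norm_of_nonneg hρ]
  let F : ℕ → ℝ → ℂ := fun k τ => PowerSeries.coeff k P * ρ ^ k * chr (((k : ℤ) - n : ℤ) * τ)
  have hF : ∀ k τ, F k τ = PowerSeries.coeff k P * (ρ * chr τ) ^ k * chr (-(n * τ)) := by
    intro k τ
    simp only [F]
    rw [show (((k : ℤ) - n : ℤ) : ℝ) * τ = k * τ + -(n * τ) by push_cast; ring, chr_add,
      chr_nat_mul]
    ring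
  have hnF : ∀ k τ, ‖F k τ‖ = ‖PowerSeries.coeff k P‖ * ρ ^ k := by
    intro k τ
    simp only [F]
    rw [norm_mul, norm_mul, norm_chr, mul_one, norm_pow, Complex.norm_real,
      Real.norm_of_nonneg hρ]
  have hFc : ∀ k, Continuous (F k) := fun k =>
    continuous_const.mul (continuous_chr.comp (by fun_prop))
  have hs := hasSum_integral_of_summable_integral_norm
    (μ := volume.restrict (Set.Ioc (-1 : ℝ) 1)) (F := F)
    (fun k => (hFc k).integrableOn_Ioc) (by
      simp_rw [hnF]
      simp only [integral_const, smul_eq_mul]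
      exact hsum.mul_left _)
  have hint : ∀ k, ∫ τ in Set.Ioc (-1 : ℝ) 1, F k τ =
      if k = n then PowerSeries.coeff n P * ρ ^ n * 2 else 0 := by
    intro k
    rw [← intervalIntegral.integral_of_le (by norm_num)]
    simp only [F]
    rw [intervalIntegral.integral_const_mul, integral_chr_int]
    by_cases h : k = n
    · subst h; simp
    · rw [if_neg (by omega), if_neg h, mul_zero]
  simp_rw [hint] at hs
  have hu := hs.unique (hasSum_ite_eq n _)
  have hW' : ∀ τ, ∑' k, F k τ = W τ * chr (-(n * τ)) := by
    intro τ
    simp_rw [hF]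
    rw [tsum_mul_right, (hW τ).2]
  simp_rw [hW'] at hu
  rw [← intervalIntegral.integral_of_le (by norm_num)] at hu
  have hnorm := congrArg norm hu
  rw [norm_mul, norm_mul, norm_pow, Complex.norm_real, Real.norm_of_nonneg hρ,
    Complex.norm_ofNat] at hnorm
  rw [mul_comm, ← hnorm]
  refine (intervalIntegral.norm_integral_le_integral_norm (by norm_num)).trans (le_of_eq ?_)
  simp_rw [norm_mul, norm_chr, mul_one]

lemma norm_ofReal_mul_chr {ρ : ℝ} (hρ : 0 ≤ ρ) (τ : ℝ) : ‖(ρ : ℂ) * chr τ‖ = ρ := by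
  rw [norm_mul, norm_chr, mul_one, Complex.norm_real, Real.norm_of_nonneg hρ]

/-- The sum of the first `n + 1` Dirichlet kernels, as a coefficient of a power series. -/
lemma sum_dirichletKernel_eq_coeff {d : ℕ} (n : ℕ) (z : Fin d → ℝ) :
    ((∑ j ∈ Finset.range (n + 1), 2 ^ d * dirichletKernel j z : ℝ) : ℂ) =
      PowerSeries.coeff n ((∏ i, PowerSeries.mk fun l : ℕ =>
        ∑ k ∈ ({(l : ℤ), -(l : ℤ)} : Finset ℤ), (Real.cos (k * Real.pi * z i) : ℂ)) *
          PowerSeries.mk (fun _ => 1) * PowerSeries.mk (fun _ => 1)) := by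
  have h1 : ∀ (Q : PowerSeries ℂ) (m : ℕ), PowerSeries.coeff m (Q * PowerSeries.mk fun _ => 1) =
      ∑ j ∈ Finset.range (m + 1), PowerSeries.coeff j Q := by
    intro Q m
    rw [PowerSeries.coeff_mul, Finset.Nat.sum_antidiagonal_eq_sum_range_succ_mk]
    simp
  rw [h1, Complex.ofReal_sum]
  refine Finset.sum_congr rfl fun j _ => ?_
  rw [h1, ← sum_freqs_eq_sum_coeff (fun i (k : ℤ) => (Real.cos (k * Real.pi * z i) : ℂ)),
    dirichletKernel_eq_prod]
  push_cast
  rw [mul_div_cancel₀ _ (pow_ne_zero _ two_ne_zero)]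

/-- The Fejér means of the Fourier series over `ℓ¹` balls are bounded in `L¹`. -/
lemma exists_bound_integral_sum_dirichletKernel (d : ℕ) : ∃ C : ℝ, ∀ n : ℕ,
    ∫ z : Cube d, |∑ j ∈ Finset.range (n + 1), 2 ^ d * dirichletKernel j z.1| ≤ C * (n + 1) := by
  -- The `d` factors together contribute at most the power `1/2` of `|1 - r| / (1 - |r|)`.
  set η : ℝ := 1 / (2 * (d + 1)) with hη
  have hη0 : 0 < η := by positivity
  have hη1 : η ≤ 1 := by
    rw [hη, div_le_one (by positivity)]
    have : (0 : ℝ) ≤ d := Nat.cast_nonneg d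
    linarith
  have hdη : d * η ≤ 1 / 2 := by
    rw [hη, mul_one_div, div_le_iff₀ (by positivity)]
    linarith
  refine ⟨(3 / 2) * ((64 / η) ^ d * 32), fun n => ?_⟩
  -- This radius keeps `ρ⁻ⁿ ≤ e` bounded, with `1 - ρ = 1/(n + 2)`.
  set ρ : ℝ := (n + 1) / (n + 2) with hρdef
  have hn2 : (0 : ℝ) < n + 2 := by positivity
  have hρ : 1 / 2 ≤ ρ := by
    rw [hρdef, div_le_div_iff₀ two_pos hn2]
    have : (0 : ℝ) ≤ n := Nat.cast_nonneg n
    linarith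
  have h1ρ : 1 - ρ = 1 / (n + 2) := by rw [hρdef]; field_simp; ring
  have hρ1 : ρ < 1 := by
    have : 0 < 1 / ((n : ℝ) + 2) := by positivity
    linarith
  have hρ0 : 0 ≤ ρ := by linarith
  have ha : 0 < 1 - ρ := by linarith
  have hρn : ∀ τ, ‖(ρ : ℂ) * chr τ‖ < 1 := fun τ => by rw [norm_ofReal_mul_chr hρ0]; exact hρ1
  have hρpow : 1 ≤ 3 * ρ ^ n := by
    have h1 : (1 / ρ) ^ n ≤ 3 := by
      have e : 1 / ρ = 1 / ((n : ℝ) + 1) + 1 := by rw [hρdef]; field_simp; ring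
      calc (1 / ρ) ^ n ≤ (Real.exp (1 / ((n : ℝ) + 1))) ^ n := by
            rw [e]
            gcongr
            exact Real.add_one_le_exp _
        _ = Real.exp (n * (1 / ((n : ℝ) + 1))) := by rw [Real.exp_nat_mul]
        _ ≤ Real.exp 1 := by
            gcongr
            rw [mul_one_div, div_le_one (by positivity)]
            linarith
        _ ≤ 3 := Real.exp_one_lt_three.le
    have h2 : 0 < ρ ^ n := by positivity
    rw [div_pow, one_pow, div_le_iff₀ h2] at h1
    exact h1
  -- the generating function on the circle of radius `ρ`
  let W : (Fin d → ℝ) → ℝ → ℂ := fun z τ =>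
    (∏ i, poissonKernel (ρ * chr τ) (z i)) * (1 - ρ * chr τ)⁻¹ * (1 - ρ * chr τ)⁻¹
  have hcoeff : ∀ z : Fin d → ℝ, |∑ j ∈ Finset.range (n + 1), 2 ^ d * dirichletKernel j z| ≤
      3 / 2 * ∫ τ in (-1 : ℝ)..1, ‖W z τ‖ := by
    intro z
    have h := norm_coeff_mul_pow_le hρ0 (W := W z) (fun τ =>
      ((evalsTo_prod Finset.univ fun i _ => evalsTo_poissonKernel (hρn τ) (z i)).mul
        (evalsTo_geom (hρn τ))).mul (evalsTo_geom (hρn τ))) n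
    rw [← sum_dirichletKernel_eq_coeff, Complex.norm_real, Real.norm_eq_abs] at h
    have h0 := abs_nonneg (∑ j ∈ Finset.range (n + 1), 2 ^ d * dirichletKernel j z)
    nlinarith
  have hWnorm : ∀ z τ, ‖W z τ‖ =
      (∏ i, ‖poissonKernel (ρ * chr τ) (z i)‖) * ‖1 - (ρ : ℂ) * chr τ‖ ^ (-2 : ℝ) := by
    intro z τ
    simp only [W]
    rw [norm_mul, norm_mul, norm_prod, norm_inv, Real.rpow_neg (norm_nonneg _), mul_assoc]
    congr 1
    rw [show (2 : ℝ) = (2 : ℕ) by norm_num, Real.rpow_natCast, sq, mul_inv]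
  have hWc : Continuous (Function.uncurry W) := by
    have := continuous_chr
    have hne : ∀ τ s, 1 - (ρ : ℂ) * chr τ * chr s ≠ 0 := fun τ s =>
      one_sub_mul_chr_ne_zero (hρn τ) s
    have hne' : ∀ τ, 1 - (ρ : ℂ) * chr τ ≠ 0 := fun τ =>
      one_sub_mul_chr_ne_zero (r := ρ) (by
        rw [Complex.norm_real, Real.norm_of_nonneg hρ0]; exact hρ1) τ
    simp only [Function.uncurry_def, W, poissonKernel]
    refine Continuous.mul (Continuous.mul (continuous_finsetProd _ fun i _ => ?_) ?_) ?_
    · refine Continuous.div (by fun_prop) (by fun_prop) fun p => ?_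
      exact mul_ne_zero (hne _ _) (hne _ _)
    · exact Continuous.inv₀ (by fun_prop) fun p => hne' _
    · exact Continuous.inv₀ (by fun_prop) fun p => hne' _
  have hWint : Integrable (Function.uncurry fun (z : Cube d) (τ : ℝ) => ‖W z.1 τ‖)
      ((volume : Measure (Cube d)).prod lineMeasure) := by
    have hc : Continuous fun p : Cube d × ℝ => ‖W p.1.1 p.2‖ :=
      (hWc.comp (by fun_prop : Continuous fun p : Cube d × ℝ => (p.1.1, p.2))).norm
    obtain ⟨B, hB⟩ := (isCompact_univ.prod (isCompact_Icc (a := (-1 : ℝ)) (b := 1))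
      ).exists_bound_of_continuousOn (s := (Set.univ : Set (Cube d)) ×ˢ Set.Icc (-1 : ℝ) 1)
      hc.continuousOn
    refine Integrable.of_bound hc.aestronglyMeasurable B ?_
    have : ∀ᵐ p : Cube d × ℝ ∂((volume : Measure (Cube d)).prod lineMeasure),
        p.2 ∈ Set.Icc (-1 : ℝ) 1 :=
      Measure.quasiMeasurePreserving_snd.ae (ae_restrict_mem measurableSet_Icc)
    filter_upwards [this] with p hp
    exact hB p ⟨Set.mem_univ _, hp⟩
  have hstep : ∀ τ : ℝ, ∫ z : Cube d, ‖W z.1 τ‖ ≤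
      (64 / η) ^ d * ((1 - ρ) ^ (-(1 / 2) : ℝ) * ‖1 - (ρ : ℂ) * chr τ‖ ^ (-(3 / 2) : ℝ)) := by
    intro τ
    simp_rw [hWnorm]
    rw [integral_mul_const, integral_cube_prod
      (fun (_ : Fin d) (t : ℝ) => ‖poissonKernel (ρ * chr τ) t‖)]
    set b := ‖1 - (ρ : ℂ) * chr τ‖ with hb
    have hba : 1 - ρ ≤ b := by
      have := norm_sub_norm_le (1 : ℂ) (ρ * chr τ)
      rwa [norm_one, norm_ofReal_mul_chr hρ0] at this
    have hb0 : 0 < b := ha.trans_le hba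
    have h1 : ∏ i : Fin d, ∫ t in (-1 : ℝ)..1, ‖poissonKernel (ρ * chr τ) t‖ ≤
        (64 / η) ^ d * (b / (1 - ρ)) ^ (1 / 2 : ℝ) := by
      rw [Finset.prod_const, Finset.card_univ, Fintype.card_fin]
      refine (pow_le_pow_left₀ (intervalIntegral.integral_nonneg (by norm_num)
        fun _ _ => norm_nonneg _) (integral_norm_poissonKernel_le hρ hρ1 hη0 hη1 τ) d).trans ?_
      rw [mul_pow, ← Real.rpow_mul_natCast (by positivity)]
      refine mul_le_mul_of_nonneg_left ?_ (by positivity)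
      refine Real.rpow_le_rpow_of_exponent_le ?_ (by linarith)
      rwa [le_div_iff₀ ha, one_mul]
    refine (mul_le_mul_of_nonneg_right h1 (by positivity)).trans (le_of_eq ?_)
    rw [Real.div_rpow hb0.le ha.le, Real.rpow_neg ha.le, mul_assoc,
      show (-(3 / 2) : ℝ) = 1 / 2 + -2 by norm_num, Real.rpow_add hb0]
    ring
  have hfin := integral_norm_rpow_le hρ hρ1 (s := 3 / 2) (by norm_num)
  calc ∫ z : Cube d, |∑ j ∈ Finset.range (n + 1), 2 ^ d * dirichletKernel j z.1|
      ≤ ∫ z : Cube d, 3 / 2 * ∫ τ, ‖W z.1 τ‖ ∂lineMeasure := by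
        refine integral_mono (integrable_cube_of_continuous ?_) ?_ fun z => ?_
        · refine (continuous_finsetSum _ fun j _ => continuous_const.mul ?_).abs
          exact (continuous_dirichletKernel j).comp continuous_subtype_val
        · exact hWint.integral_prod_left.const_mul _
        · rw [integral_lineMeasure]; exact hcoeff z.1
    _ = 3 / 2 * ∫ τ, (∫ z : Cube d, ‖W z.1 τ‖) ∂lineMeasure := by
        rw [integral_const_mul, integral_integral_swap hWint]
    _ ≤ 3 / 2 * ∫ τ, (64 / η) ^ d *
          ((1 - ρ) ^ (-(1 / 2) : ℝ) * ‖1 - (ρ : ℂ) * chr τ‖ ^ (-(3 / 2) : ℝ)) ∂lineMeasure := by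
        refine mul_le_mul_of_nonneg_left (integral_mono hWint.integral_prod_right ?_ hstep)
          (by norm_num)
        refine Integrable.const_mul (Integrable.const_mul ?_ _) _
        refine Continuous.integrableOn_Icc (Continuous.rpow_const ?_ fun y => Or.inl ?_)
        · have := continuous_chr; fun_prop
        · exact norm_ne_zero_iff.2 (one_sub_mul_chr_ne_zero (r := ρ) (by
            rw [Complex.norm_real, Real.norm_of_nonneg hρ0]; exact hρ1) y)
    _ ≤ 3 / 2 * ((64 / η) ^ d * ((1 - ρ) ^ (-(1 / 2) : ℝ) *
          (2 ^ ((3 : ℝ) / 2 + 1) / (3 / 2 - 1) * (1 - ρ) ^ (1 - (3 : ℝ) / 2)))) := by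
        rw [integral_const_mul, integral_const_mul, integral_lineMeasure]
        gcongr
    _ ≤ 3 / 2 * ((64 / η) ^ d * (16 * (n + 2))) := by
        have e : (1 - ρ) ^ (-(1 / 2) : ℝ) * (1 - ρ) ^ (1 - (3 : ℝ) / 2) = n + 2 := by
          rw [← Real.rpow_add ha, h1ρ]; norm_num [Real.rpow_neg_one]
        have h8 : (2 : ℝ) ^ ((3 : ℝ) / 2 + 1) ≤ 8 := by
          calc (2 : ℝ) ^ ((3 : ℝ) / 2 + 1) ≤ 2 ^ (3 : ℝ) :=
              Real.rpow_le_rpow_of_exponent_le one_le_two (by norm_num)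
            _ = 8 := by norm_num
        refine mul_le_mul_of_nonneg_left (mul_le_mul_of_nonneg_left ?_ (by positivity)) (by norm_num)
        calc (1 - ρ) ^ (-(1 / 2) : ℝ) *
              (2 ^ ((3 : ℝ) / 2 + 1) / (3 / 2 - 1) * (1 - ρ) ^ (1 - (3 : ℝ) / 2))
            = (2 : ℝ) ^ ((3 : ℝ) / 2 + 1) * 2 *
              ((1 - ρ) ^ (-(1 / 2) : ℝ) * (1 - ρ) ^ (1 - (3 : ℝ) / 2)) := by
              rw [show (2 : ℝ) ^ ((3 : ℝ) / 2 + 1) / (3 / 2 - 1) = 2 ^ ((3 : ℝ) / 2 + 1) * 2 by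
                norm_num [div_eq_mul_inv]]
              exact mul_left_comm _ _ _
          _ ≤ 8 * 2 * (n + 2) := by rw [e]; gcongr
          _ = 16 * (n + 2) := by ring
    _ ≤ 3 / 2 * ((64 / η) ^ d * 32) * (n + 1) := by
        have : (0 : ℝ) ≤ n := Nat.cast_nonneg n
        have h64 : 0 ≤ (64 / η) ^ d := by positivity
        nlinarith [mul_nonneg h64 this]

/-- The de la Vallée Poussin kernels are bounded in `L¹`. -/
lemma exists_isVPBound (d : ℕ) : ∃ L : ℝ, IsVPBound d L := by
  obtain ⟨C, hC⟩ := exists_bound_integral_sum_dirichletKernel d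
  have hcont : ∀ n, Continuous fun z : Cube d =>
      |∑ j ∈ Finset.range (n + 1), 2 ^ d * dirichletKernel j z.1| := fun n =>
    (continuous_finsetSum _ fun j _ => continuous_const.mul
      ((continuous_dirichletKernel j).comp continuous_subtype_val)).abs
  have hC0 : 0 ≤ C := by
    have h := (integral_nonneg fun z : Cube d => abs_nonneg _).trans (hC 0)
    simpa using h
  refine ⟨3 * C, fun N hN hN2 => ?_⟩
  obtain ⟨k, rfl⟩ := hN2
  obtain ⟨m, rfl⟩ : ∃ m, k = m + 1 := ⟨k - 1, by omega⟩
  set N := m + 1 + (m + 1) with hNdef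
  have hN2 : N / 2 = m + 1 := by omega
  let E : ℕ → Cube d → ℝ := fun n z =>
    |∑ j ∈ Finset.range (n + 1), 2 ^ d * dirichletKernel j z.1|
  have hpt : ∀ z : Cube d, |vpKernel N z.1| ≤ (E N z + E m z) / (m + 2) := by
    intro z
    have hsplit : ∑ n ∈ Finset.Icc (N / 2) N, dirichletKernel n z.1 =
        ((∑ j ∈ Finset.range (N + 1), 2 ^ d * dirichletKernel j z.1) -
          ∑ j ∈ Finset.range (m + 1), 2 ^ d * dirichletKernel j z.1) / 2 ^ d := by
      rw [← Finset.mul_sum, ← Finset.mul_sum, ← mul_sub, mul_div_cancel_left₀ _ (by positivity),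
        eq_sub_iff_add_eq', hN2, ← Finset.sum_range_add_sum_Ico _ (show m + 1 ≤ N + 1 by omega)]
      rfl
    unfold vpKernel
    rw [hsplit, hN2, abs_div, abs_div, abs_of_pos (by positivity : (0 : ℝ) < 2 ^ d),
      abs_of_pos (by positivity : (0 : ℝ) < ((m + 1 : ℕ) : ℝ) + 1),
      show ((m + 1 : ℕ) : ℝ) + 1 = m + 2 by push_cast; ring]
    gcongr
    exact (div_le_self (abs_nonneg _) (one_le_pow₀ one_le_two)).trans (abs_sub _ _)
  calc ∫ z : Cube d, |vpKernel N z.1| ≤ ∫ z : Cube d, (E N z + E m z) / (m + 2) := by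
        refine integral_mono (integrable_cube_of_continuous ?_) (integrable_cube_of_continuous ?_) hpt
        · exact ((continuous_vpKernel N).comp continuous_subtype_val).abs
        · exact ((hcont N).add (hcont m)).div_const _
    _ = ((∫ z, E N z) + ∫ z, E m z) / (m + 2) := by
        rw [integral_div, integral_add (integrable_cube_of_continuous (hcont N))
          (integrable_cube_of_continuous (hcont m))]
    _ ≤ (C * (N + 1) + C * (m + 1)) / (m + 2) := by
        gcongr
        · exact hC N
        · exact hC m
    _ ≤ 3 * C := by
        rw [div_le_iff₀ (by positivity), hNdef]
        push_cast
        nlinarith [mul_nonneg hC0 (Nat.cast_nonneg (α := ℝ) m)]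

/-! ### Lower bounds for the norms of the kernels -/

lemma continuous_cube_coord {d : ℕ} (i : Fin d) : Continuous fun z : Cube d => z.1 i :=
  (continuous_apply i).comp continuous_subtype_val

lemma continuous_cos_coord {d : ℕ} (c : ℝ) (i : Fin d) :
    Continuous fun z : Cube d => (Real.cos (c * z.1 i) : ℂ) :=
  Complex.continuous_ofReal.comp
    (Real.continuous_cos.comp (continuous_const.mul (continuous_cube_coord i)))

lemma zero_mem_cube (d : ℕ) : (0 : Fin d → ℝ) ∈ Set.Icc (-1 : Fin d → ℝ) 1 :=
  ⟨fun i => by simp, fun i => by simp⟩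

lemma one_mem_trigSpan (d N : ℕ) : (fun _ => 1 : (Fin d → ℝ) → ℝ) ∈ trigSpan d N := by
  have h : basisFn (0 : Fin d → ℤ) = fun _ => 1 := by
    ext x; simp [basisFn, nsoc_zero]
  rw [← h]
  exact basisFn_mem_trigSpan (mem_freqs.2 (by simp))

lemma cos_mem_trigSpan {d N : ℕ} (hN : 1 ≤ N) (j : Fin d) :
    (fun x => Real.cos (Real.pi * x j) : (Fin d → ℝ) → ℝ) ∈ trigSpan d N := by
  have h : (fun x => Real.cos (Real.pi * x j) : (Fin d → ℝ) → ℝ) =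
      (√2)⁻¹ • basisFn (Pi.single j (-1) : Fin d → ℤ) := by
    ext x
    rw [Pi.smul_apply, basisFn, ← Finset.mul_prod_erase _ _ (Finset.mem_univ j),
      Finset.prod_eq_one fun i hi => ?_, Pi.single_eq_same, nsoc_neg (by norm_num), mul_one,
      smul_eq_mul, inv_mul_cancel_left₀ (by positivity)]
    · simp
    · rw [Pi.single_eq_of_ne (Finset.ne_of_mem_erase hi), nsoc_zero]
  rw [h]
  refine Submodule.smul_mem _ _ (basisFn_mem_trigSpan (mem_freqs.2 ?_))
  rw [Finset.sum_eq_single j (fun i _ hi => by rw [Pi.single_eq_of_ne hi, abs_zero]) (by simp)]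
  simpa using hN

lemma integral_mul_vpKernel {d N : ℕ} (hN : Even N) {P : (Fin d → ℝ) → ℝ}
    (hP : P ∈ trigSpan d (N / 2)) : ∫ z : Cube d, P z.1 * vpKernel N z.1 = P 0 := by
  have h := circConv_vpKernel_self hN hP ⟨0, zero_mem_cube d⟩
  rw [← h]
  unfold circConv
  simp only [zero_sub, vpKernel_neg]

lemma integral_vpKernel (d : ℕ) {N : ℕ} (hN : Even N) : ∫ z : Cube d, vpKernel N z.1 = 1 := by
  simpa using integral_mul_vpKernel hN (one_mem_trigSpan d (N / 2))

lemma continuous_vpKernel_val (d N : ℕ) : Continuous fun z : Cube d => vpKernel N z.1 :=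
  (continuous_vpKernel N).comp continuous_subtype_val

lemma IsVPBound.one_le {d : ℕ} {L : ℝ} (hL : IsVPBound d L) : 1 ≤ L := by
  refine le_trans ?_ (hL 2 two_pos even_two)
  rw [← integral_vpKernel d even_two]
  exact integral_mono (integrable_cube_of_continuous (continuous_vpKernel_val d 2))
    (integrable_cube_of_continuous (continuous_vpKernel_val d 2).abs) fun z => le_abs_self _

lemma betaPos_sub_betaNeg (d : ℕ) {N : ℕ} (hN : Even N) : betaPos d N - betaNeg d N = 1 := by
  have hc := continuous_vpKernel_val d N
  unfold betaPos betaNeg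
  rw [← integral_sub (integrable_cube_of_continuous (hc.max continuous_const))
    (integrable_cube_of_continuous (f := fun z => max (-vpKernel N z.1) 0)
      (hc.neg.max continuous_const)), ← integral_vpKernel d hN]
  refine integral_congr_ae (Filter.Eventually.of_forall fun z => ?_)
  simp only [max_def]
  split_ifs <;> linarith

lemma betaPos_add_betaNeg (d N : ℕ) :
    betaPos d N + betaNeg d N = ∫ z : Cube d, |vpKernel N z.1| := by
  have hc := continuous_vpKernel_val d N
  unfold betaPos betaNeg
  rw [← integral_add (integrable_cube_of_continuous (hc.max continuous_const))
    (integrable_cube_of_continuous (f := fun z => max (-vpKernel N z.1) 0)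
      (hc.neg.max continuous_const))]
  refine integral_congr_ae (Filter.Eventually.of_forall fun z => ?_)
  simp only [max_def, abs_eq_max_neg]
  split_ifs <;> linarith

lemma betaNeg_nonneg (d N : ℕ) : 0 ≤ betaNeg d N := integral_nonneg fun _ => le_max_right _ _

lemma betaPos_pos (d : ℕ) {N : ℕ} (hN : Even N) : 0 < betaPos d N := by
  linarith [betaNeg_nonneg d N, betaPos_sub_betaNeg d hN]

/-- The de la Vallée Poussin kernel takes negative values: a probability density that reproduces
`cos (πx_j)` would be concentrated at `x_j = 0`. -/
lemma betaNeg_pos {d : ℕ} (hd : 0 < d) {N : ℕ} (hN0 : 0 < N) (hN : Even N) : 0 < betaNeg d N := by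
  refine (betaNeg_nonneg d N).lt_of_ne' fun h0 => ?_
  have hc := continuous_vpKernel_val d N
  let j : Fin d := ⟨0, hd⟩
  have hN2 : 1 ≤ N / 2 := by obtain ⟨k, rfl⟩ := hN; omega
  have hnn : 0 ≤ᵐ[volume] fun z : Cube d => vpKernel N z.1 := by
    have := (integral_eq_zero_iff_of_nonneg (fun _ => le_max_right _ _)
      (integrable_cube_of_continuous (f := fun z => max (-vpKernel N z.1) 0)
      (hc.neg.max continuous_const))).1 h0
    filter_upwards [this] with z hz
    have h1 : -vpKernel N z.1 ≤ 0 := (le_max_left _ _).trans_eq hz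
    simpa using h1
  have hint : ∫ z : Cube d, (1 - Real.cos (Real.pi * z.1 j)) * vpKernel N z.1 = 0 := by
    have := integral_mul_vpKernel hN
      (Submodule.sub_mem _ (one_mem_trigSpan d (N / 2)) (cos_mem_trigSpan hN2 j))
    simpa using this
  have hz := (integral_eq_zero_iff_of_nonneg_ae (by
    filter_upwards [hnn] with z hz
    exact mul_nonneg (sub_nonneg.2 (Real.cos_le_one _)) hz)
    (integrable_cube_of_continuous ((continuous_const.sub (Real.continuous_cos.comp
      (continuous_const.mul (continuous_cube_coord j)))).mul hc))).1 hint
  have hne : ∀ᵐ z : Cube d, z.1 j ≠ 0 :=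
    (measurePreserving_cubeVal d).quasiMeasurePreserving.ae (by
      have : NullSingletonClass lineMeasure := by
        unfold lineMeasure
        exact Measure.restrict.instNullSingletonClass _
      exact Measure.ae_eval_ne (μ := fun _ : Fin d => lineMeasure) j 0)
  have hzero : ∫ z : Cube d, vpKernel N z.1 = 0 := by
    rw [← integral_zero (Cube d) ℝ]
    refine integral_congr_ae ?_
    filter_upwards [hz, hne] with z h1 h2
    rcases mul_eq_zero.1 h1 with h | h
    · exfalso
      have hcos : Real.cos (Real.pi * z.1 j) = 1 := (sub_eq_zero.1 h).symm
      have hb1 := z.2.1 j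
      have hb2 := z.2.2 j
      simp only [Pi.neg_apply, Pi.one_apply] at hb1 hb2
      have := (Real.cos_eq_one_iff_of_lt_of_lt (x := Real.pi * z.1 j)
        (by nlinarith [Real.pi_pos]) (by nlinarith [Real.pi_pos])).1 hcos
      exact h2 ((mul_eq_zero.1 this).resolve_left Real.pi_ne_zero)
    · exact h
  rw [integral_vpKernel d hN] at hzero
  exact one_ne_zero hzero

lemma coeff_one_add_C_mul_X_pow (b : ℂ) (d n : ℕ) :
    PowerSeries.coeff n ((1 + PowerSeries.C b * PowerSeries.X) ^ d : PowerSeries ℂ) =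
      d.choose n * b ^ n := by
  have h : (1 + PowerSeries.C b * PowerSeries.X : PowerSeries ℂ) =
      PowerSeries.rescale b (1 + PowerSeries.X) := by
    ext k
    rw [PowerSeries.coeff_rescale, map_add, map_add, PowerSeries.coeff_C_mul,
      PowerSeries.coeff_X, PowerSeries.coeff_one]
    by_cases h0 : k = 0
    · subst h0; simp
    · by_cases h1 : k = 1
      · subst h1; simp
      · simp [h0, h1]
  have h2 : ((1 + PowerSeries.X) ^ d : PowerSeries ℂ) =
      ((1 + Polynomial.X) ^ d : Polynomial ℂ) := by
    push_cast; rfl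
  rw [h, ← map_pow, PowerSeries.coeff_rescale, h2, Polynomial.coeff_coe,
    Polynomial.coeff_one_add_X_pow, mul_comm]

lemma integral_cos_mul_riesz (a : ℝ) (k : ℤ) :
    ∫ t in (-1 : ℝ)..1, (Real.cos (k * Real.pi * t) : ℂ) *
      (1 + Complex.I * a * (Real.cos (Real.pi * t) : ℂ)) =
      2 * (if k = 0 then 1 else if k = 1 ∨ k = -1 then Complex.I * a / 2 else 0) := by
  have e : ∀ t : ℝ, (Real.cos (k * Real.pi * t) : ℂ) *
      (1 + Complex.I * a * (Real.cos (Real.pi * t) : ℂ)) =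
      ((Real.cos (k * Real.pi * t) : ℝ) : ℂ) + Complex.I * a / 2 *
        ((Real.cos ((k + 1 : ℤ) * Real.pi * t) + Real.cos ((k - 1 : ℤ) * Real.pi * t) : ℝ) : ℂ) := by
    intro t
    have : Real.cos ((k + 1 : ℤ) * Real.pi * t) + Real.cos ((k - 1 : ℤ) * Real.pi * t) =
        2 * (Real.cos (k * Real.pi * t) * Real.cos (Real.pi * t)) := by
      push_cast
      rw [add_mul, add_mul, sub_mul, sub_mul, one_mul, Real.cos_add, Real.cos_sub]
      ring
    rw [this]
    push_cast
    ring
  simp_rw [e]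
  rw [intervalIntegral.integral_add, intervalIntegral.integral_const_mul,
    intervalIntegral.integral_ofReal, intervalIntegral.integral_ofReal,
    intervalIntegral.integral_add (intervalIntegrable_cos_int _) (intervalIntegrable_cos_int _),
    integral_cos_int, integral_cos_int, integral_cos_int]
  · by_cases h0 : k = 0
    · subst h0; simp
    · by_cases h1 : k = 1
      · subst h1; simp; ring
      · by_cases h2 : k = -1
        · subst h2; simp; ring
        · rw [if_neg h0, if_neg (by omega), if_neg (by omega), if_neg h0, if_neg (by tauto)]
          simp
  · exact Continuous.intervalIntegrable (by fun_prop) _ _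
  · exact Continuous.intervalIntegrable (by fun_prop) _ _

lemma integral_dirichletKernel_mul_riesz (d n : ℕ) (a : ℝ) :
    ∫ z : Cube d, (dirichletKernel n z.1 : ℂ) *
      ∏ i, (1 + Complex.I * a * (Real.cos (Real.pi * z.1 i) : ℂ)) =
      ∑ j ∈ Finset.range (n + 1), d.choose j * (Complex.I * a) ^ j := by
  have e : ∀ z : Cube d, (dirichletKernel n z.1 : ℂ) *
      ∏ i, (1 + Complex.I * a * (Real.cos (Real.pi * z.1 i) : ℂ)) =
      ∑ k ∈ freqs d n, (∏ i, (Real.cos (k i * Real.pi * z.1 i) : ℂ) *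
        (1 + Complex.I * a * (Real.cos (Real.pi * z.1 i) : ℂ))) / 2 ^ d := by
    intro z
    rw [dirichletKernel_eq_prod, ← Finset.sum_div, Complex.ofReal_div, Complex.ofReal_sum,
      Complex.ofReal_pow, Complex.ofReal_ofNat, div_mul_eq_mul_div, Finset.sum_mul]
    simp_rw [Finset.prod_mul_distrib, Complex.ofReal_prod]
  simp_rw [e]
  rw [integral_finsetSum]
  · simp_rw [integral_div]
    have : ∀ k : Fin d → ℤ, (∫ z : Cube d, ∏ i, (Real.cos (k i * Real.pi * z.1 i) : ℂ) *
        (1 + Complex.I * a * (Real.cos (Real.pi * z.1 i) : ℂ))) / 2 ^ d =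
        ∏ i, (fun (_ : Fin d) (k : ℤ) =>
          (if k = 0 then 1 else if k = 1 ∨ k = -1 then Complex.I * a / 2 else 0 : ℂ)) i (k i) := by
      intro k
      rw [integral_cube_prod (fun i (t : ℝ) => (Real.cos (k i * Real.pi * t) : ℂ) *
        (1 + Complex.I * a * (Real.cos (Real.pi * t) : ℂ)))]
      simp_rw [integral_cos_mul_riesz, Finset.prod_mul_distrib]
      rw [Finset.prod_const, Finset.card_univ, Fintype.card_fin,
        mul_div_cancel_left₀ _ (pow_ne_zero _ two_ne_zero)]
    rw [Finset.sum_congr rfl fun k _ => this k, sum_freqs_eq_sum_coeff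
      (fun (_ : Fin d) (k : ℤ) =>
        (if k = 0 then 1 else if k = 1 ∨ k = -1 then Complex.I * a / 2 else 0 : ℂ))]
    refine Finset.sum_congr rfl fun j _ => ?_
    rw [Finset.prod_const, Finset.card_univ, Fintype.card_fin, ← coeff_one_add_C_mul_X_pow]
    congr 2
    ext l
    rw [PowerSeries.coeff_mk, map_add, PowerSeries.coeff_C_mul, PowerSeries.coeff_X,
      PowerSeries.coeff_one]
    rcases l with _ | _ | l
    · simp
    · simp
    · rw [Finset.sum_pair (by push_cast; omega)]
      push_cast
      rw [if_neg (by omega), if_neg (by omega), if_neg (by omega), if_neg (by omega)]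
      simp
  · intro k _
    refine Integrable.div_const ?_ _
    have hc : Continuous fun z : Cube d => ∏ i, (Real.cos (k i * Real.pi * z.1 i) : ℂ) *
        (1 + Complex.I * a * (Real.cos (Real.pi * z.1 i) : ℂ)) :=
      continuous_finsetProd _ fun i _ => (continuous_cos_coord _ i).mul
        (continuous_const.add (continuous_const.mul (continuous_cos_coord _ i)))
    obtain ⟨B, hB⟩ := isCompact_univ.exists_bound_of_continuousOn hc.continuousOn
    exact Integrable.of_bound hc.aestronglyMeasurable B
      (Filter.Eventually.of_forall fun z => hB z (Set.mem_univ z))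

/-- The norms of the de la Vallée Poussin kernels grow at least linearly in the dimension. This is
seen by testing the kernel of degree `2` against a Riesz product. -/
lemma IsVPBound.dim_le {d : ℕ} {L : ℝ} (hL : IsVPBound d L) : (d : ℝ) ≤ 13 * L := by
  have hL1 := hL.one_le
  rcases Nat.eq_zero_or_pos d with rfl | hd
  · push_cast; linarith
  have hd' : (0 : ℝ) < d := by exact_mod_cast hd
  -- With `a = 1/√d` the Riesz product has absolute value at most `√e ≤ 2`, whereas its part of
  -- degree `2`, on which `D_2` acts with weight `1/2`, contributes a real term `-(d - 1)/4`.
  set a : ℝ := 1 / √d with hadef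
  have ha2 : a ^ 2 = 1 / d := by rw [hadef, div_pow, Real.sq_sqrt hd'.le, one_pow]
  let g : Cube d → ℂ := fun z => ∏ i, (1 + Complex.I * a * (Real.cos (Real.pi * z.1 i) : ℂ))
  have hgc : Continuous g := continuous_finsetProd _ fun i _ =>
    continuous_const.add (continuous_const.mul (continuous_cos_coord _ i))
  have hg : ∀ z, ‖g z‖ ≤ 2 := by
    intro z
    have h1 : ‖g z‖ ^ 2 ≤ 2 ^ 2 := by
      simp only [g]
      rw [norm_prod, ← Finset.prod_pow]
      calc ∏ i, ‖1 + Complex.I * a * (Real.cos (Real.pi * z.1 i) : ℂ)‖ ^ 2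
          ≤ ∏ _i : Fin d, Real.exp (1 / d) := by
            refine Finset.prod_le_prod (fun _ _ => by positivity) fun i _ => ?_
            have hn : ‖1 + Complex.I * a * (Real.cos (Real.pi * z.1 i) : ℂ)‖ ^ 2 =
                1 + a ^ 2 * Real.cos (Real.pi * z.1 i) ^ 2 := by
              rw [← Complex.normSq_eq_norm_sq, mul_assoc, mul_comm, ← Complex.ofReal_mul,
                ← Complex.ofReal_one, Complex.normSq_add_mul_I]
              ring
            rw [hn, ha2]
            have h2 := Real.cos_sq_le_one (Real.pi * z.1 i)
            have h3 := Real.add_one_le_exp (1 / (d : ℝ))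
            have h4 : 0 ≤ 1 / (d : ℝ) := by positivity
            nlinarith
        _ = Real.exp 1 := by
            rw [Finset.prod_const, Finset.card_univ, Fintype.card_fin, ← Real.exp_nat_mul,
              mul_one_div_cancel hd'.ne']
        _ ≤ 2 ^ 2 := by linarith [Real.exp_one_lt_three]
    exact le_of_sq_le_sq h1 zero_le_two
  have hI : ∀ {F : Cube d → ℂ}, Continuous F → Integrable F := fun {F} hF => by
    obtain ⟨B, hB⟩ := isCompact_univ.exists_bound_of_continuousOn hF.continuousOn
    exact Integrable.of_bound hF.aestronglyMeasurable B
      (Filter.Eventually.of_forall fun z => hB z (Set.mem_univ z))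
  have hcD : ∀ n, Continuous fun z : Cube d => (dirichletKernel n z.1 : ℂ) * g z := fun n =>
    (Complex.continuous_ofReal.comp
      ((continuous_dirichletKernel n).comp continuous_subtype_val)).mul hgc
  have hval : ∫ z : Cube d, (vpKernel 2 z.1 : ℂ) * g z =
      1 + Complex.I * (d * a) - ((d - 1) / 4 : ℝ) := by
    have e : ∀ z : Cube d, (vpKernel 2 z.1 : ℂ) * g z =
        ((dirichletKernel 1 z.1 : ℂ) * g z + (dirichletKernel 2 z.1 : ℂ) * g z) / 2 := by
      intro z
      have : vpKernel 2 z.1 = (dirichletKernel 1 z.1 + dirichletKernel 2 z.1) / 2 := by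
        unfold vpKernel
        rw [show Finset.Icc (2 / 2) 2 = {1, 2} by rfl, Finset.sum_pair (by norm_num)]
        norm_num
      rw [this]
      push_cast
      ring
    simp_rw [e]
    rw [integral_div, integral_add (hI (hcD 1)) (hI (hcD 2))]
    simp only [g]
    rw [integral_dirichletKernel_mul_riesz, integral_dirichletKernel_mul_riesz]
    simp only [Finset.sum_range_succ, Finset.sum_range_zero]
    have hch : ((d.choose 2 : ℕ) : ℂ) = d * (d - 1) / 2 := by
      rw [Nat.cast_choose_two]
    have ha2' : (a : ℂ) ^ 2 = 1 / d := by rw [← Complex.ofReal_pow, ha2]; push_cast; rfl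
    have hdC : (d : ℂ) ≠ 0 := by exact_mod_cast hd.ne'
    rw [hch, mul_pow Complex.I _ 2, Complex.I_sq, ha2']
    push_cast
    simp only [Nat.choose_zero_right, Nat.choose_one_right]
    field_simp
    ring
  have hre : |1 - ((d : ℝ) - 1) / 4| ≤ 2 * L := by
    have h1 : |(∫ z : Cube d, (vpKernel 2 z.1 : ℂ) * g z).re| ≤
        ∫ z : Cube d, |vpKernel 2 z.1| * 2 := by
      refine (Complex.abs_re_le_norm _).trans ((norm_integral_le_integral_norm _).trans ?_)
      refine integral_mono (hI ((Complex.continuous_ofReal.comp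
        (continuous_vpKernel_val d 2)).mul hgc)).norm
        ((integrable_cube_of_continuous (continuous_vpKernel_val d 2).abs).mul_const 2)
        fun z => ?_
      simp only [norm_mul, Complex.norm_real, Real.norm_eq_abs]
      exact mul_le_mul_of_nonneg_left (hg z) (abs_nonneg _)
    rw [hval, integral_mul_const] at h1
    have h2 := hL 2 two_pos even_two
    have e : (1 + Complex.I * (d * a) - ((d - 1) / 4 : ℝ) : ℂ).re = 1 - ((d : ℝ) - 1) / 4 := by
      simp
    rw [e] at h1
    linarith
  have := (abs_le.1 hre).1
  linarith

/-! ### Finite differences and the `C^{ν,1}` norm -/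

/-- `DiffBound r M G` says that every `r`-fold difference of `G`, with increments
`t₁, …, t_r` in coordinate directions, is bounded by `M |t₁| ⋯ |t_r|`. -/
def DiffBound {d : ℕ} : ℕ → ℝ → ((Fin d → ℝ) → ℝ) → Prop
  | 0, M, G => ∀ x, |G x| ≤ M
  | r + 1, M, G => ∀ (j : Fin d) (t : ℝ), DiffBound r (M * |t|) fun x => G (x + Pi.single j t) - G x

lemma DiffBound.mono {d r : ℕ} {M M' : ℝ} {G : (Fin d → ℝ) → ℝ} (h : DiffBound r M G)
    (hM : M ≤ M') : DiffBound r M' G := by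
  induction r generalizing M M' G with
  | zero => exact fun x => (h x).trans hM
  | succ r ih => exact fun j t => ih (h j t) (mul_le_mul_of_nonneg_right hM (abs_nonneg t))

lemma DiffBound.translate {d r : ℕ} {M : ℝ} {G : (Fin d → ℝ) → ℝ} (h : DiffBound r M G)
    (a : Fin d → ℝ) : DiffBound r M fun x => G (x + a) := by
  induction r generalizing M G with
  | zero => exact fun x => h (x + a)
  | succ r ih =>
    intro j t
    have := ih (h j t)
    convert this using 4
    rw [add_right_comm]

lemma DiffBound.const_mul {d r : ℕ} {M : ℝ} {G : (Fin d → ℝ) → ℝ} (h : DiffBound r M G) (c : ℝ) :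
    DiffBound r (|c| * M) fun x => c * G x := by
  induction r generalizing M G with
  | zero =>
    intro x
    rw [abs_mul]
    exact mul_le_mul_of_nonneg_left (h x) (abs_nonneg c)
  | succ r ih =>
    intro j t
    have := ih (h j t)
    simp only [mul_sub] at this
    rwa [mul_assoc]

lemma DiffBound.add {d r : ℕ} {M M' : ℝ} {G G' : (Fin d → ℝ) → ℝ} (h : DiffBound r M G)
    (h' : DiffBound r M' G') : DiffBound r (M + M') fun x => G x + G' x := by
  induction r generalizing M M' G G' with
  | zero => exact fun x => (abs_add_le _ _).trans (add_le_add (h x) (h' x))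
  | succ r ih =>
    intro j t
    have := ih (h j t) (h' j t)
    rw [add_mul]
    convert this using 2
    ring

lemma diffBound_zero {d r : ℕ} : DiffBound r 0 (fun _ : Fin d → ℝ => 0) := by
  induction r with
  | zero => intro x; simp
  | succ r ih => intro j t; simpa using ih

lemma DiffBound.of_tendsto {d r : ℕ} {ι : Type*} {l : Filter ι} [l.NeBot] {M : ℝ}
    {F : ι → (Fin d → ℝ) → ℝ} {G : (Fin d → ℝ) → ℝ} (h : ∀ᶠ i in l, DiffBound r M (F i))
    (hlim : ∀ x, Filter.Tendsto (fun i => F i x) l (nhds (G x))) : DiffBound r M G := by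
  induction r generalizing M F G with
  | zero => exact fun x => le_of_tendsto (hlim x).abs (h.mono fun i hi => hi x)
  | succ r ih =>
    intro j t
    exact ih (h.mono fun i hi => hi j t) fun x => (hlim _).sub (hlim _)

/-- Differences of an average of functions are averages of differences. -/
lemma DiffBound.integral {d r : ℕ} {Ω : Type*} [MeasurableSpace Ω] {μ : Measure Ω}
    {m : Ω → ℝ} (hm : Integrable m μ) {F : Ω → (Fin d → ℝ) → ℝ}
    (hF : ∀ x, Integrable (fun ω => F ω x) μ) (h : ∀ᵐ ω ∂μ, DiffBound r (m ω) (F ω)) :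
    DiffBound r (∫ ω, m ω ∂μ) fun x => ∫ ω, F ω x ∂μ := by
  induction r generalizing m F with
  | zero =>
    intro x
    refine (norm_integral_le_integral_norm _).trans (integral_mono_ae (hF x).norm hm ?_)
    filter_upwards [h] with ω hω
    exact hω x
  | succ r ih =>
    intro j t
    have := ih (hm.mul_const |t|) (F := fun ω x => F ω (x + Pi.single j t) - F ω x)
      (fun x => (hF _).sub (hF x)) (h.mono fun ω hω => hω j t)
    rw [integral_mul_const] at this
    convert this using 2 with x
    rw [integral_sub (hF _) (hF x)]

/-- Increments in an arbitrary direction, by telescoping over the coordinates. -/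
lemma DiffBound.increment {d r : ℕ} {M : ℝ} {G : (Fin d → ℝ) → ℝ} (h : DiffBound (r + 1) M G)
    (s : Fin d → ℝ) : DiffBound r (M * ∑ j, |s j|) fun x => G (x + s) - G x := by
  classical
  have key : ∀ S : Finset (Fin d), DiffBound r (M * ∑ j ∈ S, |s j|)
      fun x => G (x + ∑ j ∈ S, Pi.single j (s j)) - G x := by
    intro S
    induction S using Finset.induction_on with
    | empty => simpa using diffBound_zero
    | insert j S hj ih =>
      have h2 := ((h j (s j)).translate (∑ j ∈ S, Pi.single j (s j))).add ih
      rw [Finset.sum_insert hj, Finset.sum_insert hj, mul_add]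
      convert h2 using 2
      rw [show ∀ x : Fin d → ℝ, x + (Pi.single j (s j) + ∑ j ∈ S, Pi.single j (s j)) =
        x + ∑ j ∈ S, Pi.single j (s j) + Pi.single j (s j) by intro x; abel]
      ring
  have := key Finset.univ
  rwa [Finset.univ_sum_single] at this

/-- For a `C¹` function, differences of order `r + 1` correspond to differences of order `r` of
the first partial derivatives. -/
lemma diffBound_succ_iff {d r : ℕ} {M : ℝ} {G : (Fin d → ℝ) → ℝ} (hG : ContDiff ℝ 1 G) :
    DiffBound (r + 1) M G ↔
      ∀ j : Fin d, DiffBound r M fun x => fderiv ℝ G x (Pi.single j 1) := by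
  have hline : ∀ (x : Fin d → ℝ) (j : Fin d) (s : ℝ), HasDerivAt
      (fun s : ℝ => G (x + s • Pi.single j 1)) (fderiv ℝ G (x + s • Pi.single j 1) (Pi.single j 1))
      s := by
    intro x j s
    have h1 : HasDerivAt (fun s : ℝ => x + s • (Pi.single j 1 : Fin d → ℝ)) (Pi.single j 1) s := by
      simpa using ((hasDerivAt_id s).smul_const (Pi.single j 1 : Fin d → ℝ)).const_add x
    exact ((hG.differentiable one_ne_zero _).hasFDerivAt).comp_hasDerivAt s h1
  have hsingle : ∀ (j : Fin d) (t : ℝ), Pi.single j t = t • (Pi.single j 1 : Fin d → ℝ) := by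
    intro j t
    rw [← Pi.single_smul, smul_eq_mul, mul_one]
  constructor
  · intro h j
    refine DiffBound.of_tendsto (l := nhdsWithin 0 {0}ᶜ)
      (F := fun t x => t⁻¹ * (G (x + Pi.single j t) - G x)) ?_ fun x => ?_
    · filter_upwards [self_mem_nhdsWithin] with t ht
      have := (h j t).const_mul t⁻¹
      refine this.mono (le_of_eq ?_)
      rw [abs_inv, mul_left_comm, inv_mul_cancel₀ (abs_ne_zero.2 ht), mul_one]
    · have := (hline x j 0).tendsto_slope_zero
      simpa [← hsingle] using this
  · intro h j t
    have hc : Continuous fun p : ℝ × (Fin d → ℝ) =>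
        t * fderiv ℝ G (p.2 + p.1 • Pi.single j t) (Pi.single j 1) :=
      continuous_const.mul (((hG.continuous_fderiv one_ne_zero).comp (by fun_prop)).clm_apply
        continuous_const)
    have hFT : ∀ x, G (x + Pi.single j t) - G x = ∫ s in Set.Icc (0 : ℝ) 1,
        t * fderiv ℝ G (x + s • Pi.single j t) (Pi.single j 1) := by
      intro x
      have hd : ∀ s ∈ Set.uIcc (0 : ℝ) 1, HasDerivAt (fun s : ℝ => G (x + s • Pi.single j t))
          (t * fderiv ℝ G (x + s • Pi.single j t) (Pi.single j 1)) s := by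
        intro s _
        have h1 := (hline x j (s * t)).comp s ((hasDerivAt_id s).mul_const t)
        simp only [one_mul] at h1
        have e : (fun s : ℝ => G (x + s • Pi.single j t)) =
            (fun s : ℝ => G (x + s • Pi.single j 1)) ∘ fun s => id s * t := by
          ext s
          rw [hsingle j t, Function.comp_apply, smul_smul, id]
        rw [mul_comm t, hsingle j t, smul_smul, ← hsingle j t, e]
        exact h1
      have := intervalIntegral.integral_eq_sub_of_hasDerivAt hd
        ((hc.comp (by fun_prop : Continuous fun s : ℝ => (s, x))).intervalIntegrable _ _)
      rw [integral_Icc_eq_integral_Ioc, ← intervalIntegral.integral_of_le zero_le_one]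
      simpa using this.symm
    simp_rw [hFT]
    have hb : DiffBound r (∫ _s in Set.Icc (0 : ℝ) 1, M * |t|) fun x => ∫ s in Set.Icc (0 : ℝ) 1,
        t * fderiv ℝ G (x + s • Pi.single j t) (Pi.single j 1) := by
      refine DiffBound.integral (integrable_const _) (fun x => ?_)
        (Filter.Eventually.of_forall fun s => ?_)
      · exact (hc.comp (by fun_prop : Continuous fun s : ℝ => (s, x))).integrableOn_Icc
      · have := ((h j).translate (s • Pi.single j t)).const_mul t
        rwa [mul_comm M]
    simpa using hb

lemma contDiff_partialDeriv {d k ν n : ℕ} {F : (Fin d → ℝ) → ℝ} (hF : ContDiff ℝ ν F)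
    (hk : n + k ≤ ν) (i : Fin k → Fin d) : ContDiff ℝ n (partialDeriv F i) := by
  unfold partialDeriv
  have h : ContDiff ℝ n (iteratedFDeriv ℝ k F) :=
    hF.iteratedFDeriv_right (m := n) (by exact_mod_cast hk)
  exact (ContinuousMultilinearMap.apply ℝ (fun _ : Fin k => Fin d → ℝ) ℝ
    (fun j => Pi.single (i j) 1)).contDiff.comp h

lemma diffBound_add_iff {d k ν : ℕ} {F : (Fin d → ℝ) → ℝ} (hF : ContDiff ℝ ν F) (hk : k ≤ ν)
    (r : ℕ) (M : ℝ) :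
    DiffBound (k + r) M F ↔ ∀ i : Fin k → Fin d, DiffBound r M (partialDeriv F i) := by
  induction k generalizing r with
  | zero =>
    have : ∀ i : Fin 0 → Fin d, partialDeriv F i = F := by
      intro i; ext x; simp [partialDeriv]
    simp [this]
  | succ k ih =>
    rw [show k + 1 + r = k + (r + 1) by ring, ih (by omega) (r + 1)]
    have hder : ∀ (i : Fin k → Fin d) (j : Fin d), partialDeriv F (Fin.cons j i : Fin (k + 1) → _) =
        fun x => fderiv ℝ (partialDeriv F i) x (Pi.single j 1) := by
      intro i j
      ext x
      have hd : DifferentiableAt ℝ (iteratedFDeriv ℝ k F) x :=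
        (hF.differentiable_iteratedFDeriv (by exact_mod_cast hk)) x
      unfold partialDeriv
      rw [iteratedFDeriv_succ_apply_left]
      have h2 := ((ContinuousMultilinearMap.apply ℝ (fun _ : Fin k => Fin d → ℝ) ℝ
        (fun l => Pi.single (i l) 1)).hasFDerivAt.comp x hd.hasFDerivAt).fderiv
      have h3 := DFunLike.congr_fun h2 (Pi.single j 1)
      simp only [Fin.cons_zero, ContinuousLinearMap.comp_apply] at h3 ⊢
      exact h3.symm
    have hstep : ∀ i : Fin k → Fin d, DiffBound (r + 1) M (partialDeriv F i) ↔
        ∀ j, DiffBound r M (partialDeriv F (Fin.cons j i : Fin (k + 1) → _)) := by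
      intro i
      rw [diffBound_succ_iff (contDiff_partialDeriv (n := 1) hF (by omega) i)]
      simp_rw [hder]
    simp_rw [hstep]
    constructor
    · intro h i
      have := h (Fin.tail i) (i 0)
      rwa [Fin.cons_self_tail] at this
    · intro h i j
      exact h _

lemma enorm_le_ofReal_iff {a M : ℝ} (hM : 0 ≤ M) : ‖a‖ₑ ≤ ENNReal.ofReal M ↔ |a| ≤ M := by
  rw [Real.enorm_eq_ofReal_abs, ENNReal.ofReal_le_ofReal_iff hM]

lemma diffBound_one_iff {d : ℕ} {M : ℝ} (G : (Fin d → ℝ) → ℝ) : DiffBound 1 M G ↔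
    ∀ (j : Fin d) (x : Fin d → ℝ) (t : ℝ), t ≠ 0 → |(G (x + Pi.single j t) - G x) / t| ≤ M := by
  simp only [DiffBound]
  constructor
  · intro h j x t ht
    rw [abs_div, div_le_iff₀ (abs_pos.2 ht)]
    exact h j t x
  · intro h j t x
    by_cases ht : t = 0
    · subst ht; simp
    · have := h j x t ht
      rwa [abs_div, div_le_iff₀ (abs_pos.2 ht)] at this

/-- The `C^{ν,1}` norm is the best constant in the bounds for the finite differences of
order at most `ν + 1`. -/
lemma cNorm_le_iff {d ν : ℕ} {f : Cube d → ℝ} (hf : ContDiff ℝ ν (periodicExt f)) {M : ℝ}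
    (hM : 0 ≤ M) :
    cNorm ν f ≤ ENNReal.ofReal M ↔ ∀ k ≤ ν + 1, DiffBound k M (periodicExt f) := by
  unfold cNorm
  simp only [sup_le_iff, iSup_le_iff, enorm_le_ofReal_iff hM]
  have h1 : ∀ k ≤ ν, ((∀ (i : Fin k → Fin d) x, |partialDeriv (periodicExt f) i x| ≤ M) ↔
      DiffBound k M (periodicExt f)) := fun k hk => (diffBound_add_iff hf hk 0 M).symm
  have h2 : (∀ (i : Fin ν → Fin d) (j : Fin d) (x : Fin d → ℝ) (t : ℝ), t ≠ 0 →
      |(partialDeriv (periodicExt f) i (x + Pi.single j t) -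
        partialDeriv (periodicExt f) i x) / t| ≤ M) ↔ DiffBound (ν + 1) M (periodicExt f) := by
    rw [diffBound_add_iff hf le_rfl 1 M]
    simp_rw [diffBound_one_iff]
  rw [h2]
  constructor
  · rintro ⟨ha, hb⟩ k hk
    rcases Nat.lt_or_ge ν k with h | h
    · obtain rfl : k = ν + 1 := by omega
      exact hb
    · exact (h1 k h).1 (ha k h)
  · intro h
    exact ⟨fun k hk => (h1 k hk).2 (h k (by omega)), h _ le_rfl⟩

lemma MemCp.continuous {d ν : ℕ} {f : Cube d → ℝ} (hf : MemCp ν f) : Continuous f := by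
  have : f = fun z : Cube d => periodicExt f z.1 := funext fun z => (hf.boundary z).symm
  rw [this]
  exact hf.contDiff.continuous.comp continuous_subtype_val

lemma periodicExt_of_mem_trigSpan {d N : ℕ} {f : Cube d → ℝ} {P : (Fin d → ℝ) → ℝ}
    (hP : P ∈ trigSpan d N) (hf : ∀ z, f z = P z.1) : periodicExt f = P := by
  ext x
  rw [periodicExt, hf, (isPeriodic_of_mem_trigSpan hP).wrap]

/-- The circular convolution of a kernel with a function on `ℝ^d`. -/
def perConv {d : ℕ} (D G : (Fin d → ℝ) → ℝ) (x : Fin d → ℝ) : ℝ :=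
  ∫ t : Cube d, G (x - t.1) * D t.1

lemma periodicExt_circConv {d : ℕ} {D : (Fin d → ℝ) → ℝ} (hD : IsPeriodic D) (hDc : Continuous D)
    {f : Cube d → ℝ} (hf : Measurable f) :
    periodicExt (circConv D f) = perConv D (periodicExt f) := by
  ext x
  rw [periodicExt, circConv_eq hD hDc.measurable hf, perConv]
  congr 1
  ext t
  congr 1
  have := ((isPeriodic_periodicExt f).comp_add (-t.1)).wrap x
  rwa [neg_add_eq_sub, neg_add_eq_sub] at this

lemma integrable_perConv {d : ℕ} {D G : (Fin d → ℝ) → ℝ} (hD : Continuous D) (hG : Continuous G)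
    (x : Fin d → ℝ) : Integrable fun t : Cube d => G (x - t.1) * D t.1 :=
  integrable_cube_of_continuous (by fun_prop)

lemma DiffBound.perConv_le {d r : ℕ} {M : ℝ} {D G : (Fin d → ℝ) → ℝ} (hD : Continuous D)
    (hG : Continuous G) (h : DiffBound r M G) :
    DiffBound r ((∫ t : Cube d, |D t.1|) * M) (perConv D G) := by
  have := DiffBound.integral (r := r) (μ := (volume : Measure (Cube d)))
    (m := fun t => |D t.1| * M) (F := fun t x => G (x - t.1) * D t.1)
    ((integrable_cube_of_continuous (by fun_prop)).mul_const _)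
    (integrable_perConv hD hG) (Filter.Eventually.of_forall fun t => by
      have := (h.translate (-t.1)).const_mul (D t.1)
      simpa only [← sub_eq_add_neg, mul_comm (D t.1)] using this)
  rwa [integral_mul_const] at this

/-- Convolution with the de la Vallée Poussin kernel is bounded on `C^{ν,1}`. -/
lemma MemCp.circConv_vpKernel {d ν N : ℕ} {f : Cube d → ℝ} (hf : MemCp ν f) {M : ℝ} (hM : 0 ≤ M)
    (hfM : cNorm ν f ≤ ENNReal.ofReal M) {L : ℝ} (hL : ∫ z : Cube d, |vpKernel N z.1| ≤ L) :
    MemCp ν (circConv (vpKernel N) f) ∧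
      cNorm ν (circConv (vpKernel N) f) ≤ ENNReal.ofReal (L * M) := by
  obtain ⟨P, hP, hfP⟩ := circConv_vpKernel_mem N (integrable_cube_of_continuous hf.continuous)
  have hext := periodicExt_of_mem_trigSpan hP hfP
  have hcd : ContDiff ℝ ν (periodicExt (circConv (vpKernel N) f)) := by
    rw [hext]; exact (contDiff_of_mem_trigSpan hP).of_le (by exact_mod_cast le_top)
  have hL0 : 0 ≤ L := (integral_nonneg fun _ => abs_nonneg _).trans hL
  have hn : cNorm ν (circConv (vpKernel N) f) ≤ ENNReal.ofReal (L * M) := by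
    rw [cNorm_le_iff hcd (mul_nonneg hL0 hM)]
    intro k hk
    rw [periodicExt_circConv (isPeriodic_vpKernel N) (continuous_vpKernel N)
      hf.continuous.measurable]
    exact (((cNorm_le_iff hf.contDiff hM).1 hfM k hk).perConv_le (continuous_vpKernel N)
      hf.contDiff.continuous).mono (mul_le_mul_of_nonneg_right hL hM)
  refine ⟨⟨fun z => ?_, hcd, hn.trans_lt ENNReal.ofReal_lt_top⟩, hn⟩
  rw [hext, hfP]

/-! ### Approximation by trigonometric polynomials -/

/-- The values `sin (jπ/(m+2))`, for `j = 1, …, m + 1`, are the coefficients of the polynomial whose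
squared modulus is the Fejér–Korovkin kernel. They form an eigenvector of the path graph. -/
def fkCoeff (m : ℕ) (j : ℕ) : ℝ := Real.sin (j * (Real.pi / (m + 2)))

/-- The sum of the squares of the coefficients. -/
def fkMass (m : ℕ) : ℝ := ∑ j ∈ Finset.Icc 1 (m + 1), fkCoeff m j ^ 2

/-- The Fejér–Korovkin kernel of degree `m`, a nonnegative cosine polynomial. -/
def fkKernel (m : ℕ) (t : ℝ) : ℝ :=
  (∑ p ∈ Finset.Icc 1 (m + 1) ×ˢ Finset.Icc 1 (m + 1), fkCoeff m p.1 * fkCoeff m p.2 *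
    Real.cos (((p.1 : ℤ) - p.2 : ℤ) * Real.pi * t)) / (2 * fkMass m)

lemma fkMass_pos (m : ℕ) : 0 < fkMass m := by
  refine Finset.sum_pos' (fun _ _ => sq_nonneg _) ⟨1, by simp, ?_⟩
  have : 0 < fkCoeff m 1 := by
    unfold fkCoeff
    have hm : (0 : ℝ) ≤ m := Nat.cast_nonneg m
    refine Real.sin_pos_of_pos_of_lt_pi (by have := Real.pi_pos; positivity) ?_
    rw [Nat.cast_one, one_mul]
    exact div_lt_self Real.pi_pos (by linarith)
  positivity

lemma fkKernel_nonneg (m : ℕ) (t : ℝ) : 0 ≤ fkKernel m t := by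
  unfold fkKernel
  refine div_nonneg ?_ (by have := fkMass_pos m; positivity)
  have e : ∑ p ∈ Finset.Icc 1 (m + 1) ×ˢ Finset.Icc 1 (m + 1), fkCoeff m p.1 * fkCoeff m p.2 *
      Real.cos (((p.1 : ℤ) - p.2 : ℤ) * Real.pi * t) =
      (∑ j ∈ Finset.Icc 1 (m + 1), fkCoeff m j * Real.cos (j * Real.pi * t)) ^ 2 +
      (∑ j ∈ Finset.Icc 1 (m + 1), fkCoeff m j * Real.sin (j * Real.pi * t)) ^ 2 := by
    rw [sq, sq, Finset.sum_mul_sum, Finset.sum_mul_sum, ← Finset.sum_product',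
      ← Finset.sum_product', ← Finset.sum_add_distrib]
    refine Finset.sum_congr rfl fun p _ => ?_
    push_cast
    rw [sub_mul, sub_mul, Real.cos_sub]
    ring
  rw [e]
  positivity

lemma continuous_fkKernel (m : ℕ) : Continuous (fkKernel m) := by
  unfold fkKernel
  fun_prop

lemma integral_fkKernel (m : ℕ) : ∫ t in (-1 : ℝ)..1, fkKernel m t = 1 := by
  have hS := fkMass_pos m
  unfold fkKernel
  rw [intervalIntegral.integral_div, intervalIntegral.integral_finsetSum
    fun p _ => (intervalIntegrable_cos_int _).const_mul _]
  simp_rw [intervalIntegral.integral_const_mul, integral_cos_int]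
  rw [Finset.sum_product, div_eq_one_iff_eq (by positivity), fkMass, Finset.mul_sum]
  refine Finset.sum_congr rfl fun j hj => ?_
  rw [Finset.sum_eq_single j]
  · simp; ring
  · intro l _ hl
    rw [if_neg (by omega), mul_zero]
  · intro h; exact absurd hj h

lemma integral_fkKernel_mul_cos (m : ℕ) :
    ∫ t in (-1 : ℝ)..1, fkKernel m t * Real.cos (Real.pi * t) = Real.cos (Real.pi / (m + 2)) := by
  have hS := fkMass_pos m
  have e : ∀ t, fkKernel m t * Real.cos (Real.pi * t) =
      (∑ p ∈ Finset.Icc 1 (m + 1) ×ˢ Finset.Icc 1 (m + 1), fkCoeff m p.1 * fkCoeff m p.2 *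
        ((Real.cos (((p.1 : ℤ) - p.2 + 1 : ℤ) * Real.pi * t) +
          Real.cos (((p.1 : ℤ) - p.2 - 1 : ℤ) * Real.pi * t)) / 2)) / (2 * fkMass m) := by
    intro t
    unfold fkKernel
    rw [div_mul_eq_mul_div, Finset.sum_mul]
    congr 1
    refine Finset.sum_congr rfl fun p _ => ?_
    rw [mul_assoc]
    congr 1
    push_cast
    generalize ((p.1 : ℝ) - p.2) = k
    rw [add_mul, add_mul, sub_mul, sub_mul, one_mul, Real.cos_add, Real.cos_sub]
    ring
  simp_rw [e]
  rw [intervalIntegral.integral_div, intervalIntegral.integral_finsetSum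
    fun p _ => (((intervalIntegrable_cos_int _).add (intervalIntegrable_cos_int _)).div_const
      2).const_mul _]
  simp_rw [intervalIntegral.integral_const_mul, intervalIntegral.integral_div]
  rw [div_eq_iff (by positivity)]
  have h2 : ∀ p ∈ Finset.Icc 1 (m + 1) ×ˢ Finset.Icc 1 (m + 1), fkCoeff m p.1 * fkCoeff m p.2 *
      ((∫ t in (-1 : ℝ)..1, (Real.cos (((p.1 : ℤ) - p.2 + 1 : ℤ) * Real.pi * t) +
          Real.cos (((p.1 : ℤ) - p.2 - 1 : ℤ) * Real.pi * t))) / 2) =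
      (if p.2 = p.1 + 1 then fkCoeff m p.1 * fkCoeff m p.2 else 0) +
      (if p.2 = p.1 - 1 then fkCoeff m p.1 * fkCoeff m p.2 else 0) := by
    rintro ⟨j, l⟩ hp
    rw [Finset.mem_product, Finset.mem_Icc, Finset.mem_Icc] at hp
    dsimp only at hp ⊢
    rw [intervalIntegral.integral_add (intervalIntegrable_cos_int _) (intervalIntegrable_cos_int _),
      integral_cos_int, integral_cos_int]
    by_cases h1 : l = j + 1
    · rw [if_pos (by omega), if_neg (by omega), if_pos h1, if_neg (by omega)]; ring
    · by_cases h2 : l = j - 1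
      · rw [if_neg (by omega), if_pos (by omega), if_neg h1, if_pos h2]; ring
      · rw [if_neg (by omega), if_neg (by omega), if_neg h1, if_neg h2]; ring
  have hθ : ((m : ℝ) + 2) * (Real.pi / (m + 2)) = Real.pi := by field_simp
  have hend : fkCoeff m (m + 2) = 0 := by
    unfold fkCoeff; push_cast; rw [hθ, Real.sin_pi]
  have hbeg : fkCoeff m 0 = 0 := by unfold fkCoeff; simp
  rw [Finset.sum_congr rfl h2, Finset.sum_product, fkMass, Finset.mul_sum, Finset.mul_sum]
  refine Finset.sum_congr rfl fun j hj => ?_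
  rw [Finset.mem_Icc] at hj
  dsimp only
  rw [Finset.sum_add_distrib, Finset.sum_ite_eq', Finset.sum_ite_eq']
  -- the boundary terms vanish, since the coefficients with indices `0` and `m + 2` do
  have r1 : (if j + 1 ∈ Finset.Icc 1 (m + 1) then fkCoeff m j * fkCoeff m (j + 1) else 0) =
      fkCoeff m j * fkCoeff m (j + 1) := by
    split_ifs with h
    · rfl
    · rw [Finset.mem_Icc] at h
      obtain rfl : j = m + 1 := by omega
      rw [show m + 1 + 1 = m + 2 by ring, hend, mul_zero]
  have r2 : (if j - 1 ∈ Finset.Icc 1 (m + 1) then fkCoeff m j * fkCoeff m (j - 1) else 0) =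
      fkCoeff m j * fkCoeff m (j - 1) := by
    split_ifs with h
    · rfl
    · rw [Finset.mem_Icc] at h
      obtain rfl : j = 1 := by omega
      rw [show 1 - 1 = 0 by rfl, hbeg, mul_zero]
  rw [r1, r2]
  have h3 : fkCoeff m (j + 1) + fkCoeff m (j - 1) =
      2 * Real.cos (Real.pi / (m + 2)) * fkCoeff m j := by
    unfold fkCoeff
    rw [Nat.cast_sub hj.1]
    push_cast
    rw [add_mul, sub_mul, one_mul, Real.sin_add, Real.sin_sub]
    ring
  linear_combination fkCoeff m j * h3

lemma integral_abs_mul_fkKernel_le {m : ℕ} (hm : 0 < m) :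
    ∫ t in (-1 : ℝ)..1, |t| * fkKernel m t ≤ 2 / m := by
  have hm' : (0 : ℝ) < m := by exact_mod_cast hm
  have hc := continuous_fkKernel m
  set θ : ℝ := Real.pi / (m + 2) with hθ
  have hθ0 : 0 < θ := by have := Real.pi_pos; positivity
  -- weighted arithmetic–geometric mean inequality, with the second moment `1 - cos θ ≤ θ² / 2`
  have hpt : ∀ t ∈ Set.Icc (-1 : ℝ) 1, |t| * fkKernel m t ≤
      θ / 4 * fkKernel m t + 1 / (2 * θ) * (fkKernel m t - fkKernel m t * Real.cos (Real.pi * t)) := by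
    intro t ht
    have hk := fkKernel_nonneg m t
    have hcos : Real.cos (Real.pi * t) ≤ 1 - 2 * t ^ 2 := by
      have h := Real.cos_le_one_sub_mul_cos_sq (x := Real.pi * t) (by
        rw [abs_mul, abs_of_pos Real.pi_pos]
        exact mul_le_of_le_one_right Real.pi_pos.le (abs_le.2 ht))
      have e : 2 / Real.pi ^ 2 * (Real.pi * t) ^ 2 = 2 * t ^ 2 := by
        have := Real.pi_pos.ne'
        field_simp
      linarith
    have h1 : |t| ≤ θ / 4 + 1 / (2 * θ) * (1 - Real.cos (Real.pi * t)) := by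
      have h2 : 1 / (2 * θ) * (2 * t ^ 2) ≤ 1 / (2 * θ) * (1 - Real.cos (Real.pi * t)) := by
        gcongr
        linarith
      refine le_trans ?_ (add_le_add le_rfl h2)
      have e : θ / 4 + 1 / (2 * θ) * (2 * t ^ 2) - |t| = (θ / 2 - |t|) ^ 2 / θ := by
        rw [← sq_abs t]
        field_simp
        ring
      have : 0 ≤ (θ / 2 - |t|) ^ 2 / θ := by positivity
      linarith
    calc |t| * fkKernel m t ≤ (θ / 4 + 1 / (2 * θ) * (1 - Real.cos (Real.pi * t))) * fkKernel m t := by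
          gcongr
      _ = _ := by ring
  have hI : ∀ {f : ℝ → ℝ}, Continuous f → IntervalIntegrable f volume (-1) 1 :=
    fun hf => hf.intervalIntegrable _ _
  calc ∫ t in (-1 : ℝ)..1, |t| * fkKernel m t
      ≤ ∫ t in (-1 : ℝ)..1, (θ / 4 * fkKernel m t +
          1 / (2 * θ) * (fkKernel m t - fkKernel m t * Real.cos (Real.pi * t))) :=
        intervalIntegral.integral_mono_on (by norm_num) (hI (by fun_prop)) (hI (by fun_prop)) hpt
    _ = θ / 4 * 1 + 1 / (2 * θ) * (1 - Real.cos θ) := by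
        rw [intervalIntegral.integral_add (hI (by fun_prop)) (hI (by fun_prop)),
          intervalIntegral.integral_const_mul, intervalIntegral.integral_const_mul,
          intervalIntegral.integral_sub (hI (by fun_prop)) (hI (by fun_prop)), integral_fkKernel,
          integral_fkKernel_mul_cos]
    _ ≤ θ / 4 * 1 + 1 / (2 * θ) * (θ ^ 2 / 2) := by
        gcongr
        linarith [Real.one_sub_sq_div_two_le_cos (x := θ)]
    _ = θ / 2 := by field_simp; ring
    _ ≤ 2 / m := by
        rw [hθ, div_div, div_le_div_iff₀ (by positivity) hm']
        nlinarith [Real.pi_lt_four]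

/-- The tensor product Fejér–Korovkin kernel. -/
def jacksonKernel {d : ℕ} (m : ℕ) (x : Fin d → ℝ) : ℝ := ∏ i, fkKernel m (x i)

lemma jacksonKernel_nonneg {d : ℕ} (m : ℕ) (x : Fin d → ℝ) : 0 ≤ jacksonKernel m x :=
  Finset.prod_nonneg fun _ _ => fkKernel_nonneg m _

lemma continuous_jacksonKernel {d : ℕ} (m : ℕ) :
    Continuous (jacksonKernel m : (Fin d → ℝ) → ℝ) := by
  unfold jacksonKernel
  have := continuous_fkKernel m
  fun_prop

lemma integral_jacksonKernel (d m : ℕ) : ∫ z : Cube d, jacksonKernel m z.1 = 1 := by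
  unfold jacksonKernel
  rw [integral_cube_prod (fun _ t => fkKernel m t)]
  simp [integral_fkKernel]

lemma integral_sum_abs_mul_jacksonKernel_le (d : ℕ) {m : ℕ} (hm : 0 < m) :
    ∫ z : Cube d, (∑ j, |z.1 j|) * jacksonKernel m z.1 ≤ d * (2 / m) := by
  classical
  have hcoord : ∀ j : Fin d, Continuous fun z : Cube d => |z.1 j| * jacksonKernel m z.1 := fun j =>
    (continuous_cube_coord j).abs.mul ((continuous_jacksonKernel m).comp continuous_subtype_val)
  simp_rw [Finset.sum_mul]
  rw [integral_finsetSum _ fun j _ => integrable_cube_of_continuous (hcoord j)]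
  have h : ∀ j : Fin d, ∫ z : Cube d, |z.1 j| * jacksonKernel m z.1 ≤ 2 / m := by
    intro j
    have e : ∀ z : Cube d, |z.1 j| * jacksonKernel m z.1 =
        ∏ i, (fun i t => if i = j then |t| * fkKernel m t else fkKernel m t) i (z.1 i) := by
      intro z
      unfold jacksonKernel
      rw [← Finset.mul_prod_erase _ _ (Finset.mem_univ j),
        ← Finset.mul_prod_erase _ _ (Finset.mem_univ j), ← mul_assoc]
      congr 1
      · simp
      · exact Finset.prod_congr rfl fun i hi => by simp [Finset.ne_of_mem_erase hi]
    rw [integral_congr_ae (Filter.Eventually.of_forall e),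
      integral_cube_prod (fun i t => if i = j then |t| * fkKernel m t else fkKernel m t),
      ← Finset.mul_prod_erase _ _ (Finset.mem_univ j),
      Finset.prod_eq_one fun i hi => ?_]
    · simpa using integral_abs_mul_fkKernel_le hm
    · simp [Finset.ne_of_mem_erase hi, integral_fkKernel]
  refine (Finset.sum_le_sum fun j _ => h j).trans ?_
  simp

lemma fkKernel_sub (m : ℕ) : ∃ β : ℤ → ℝ, ∀ x y : ℝ,
    fkKernel m (x - y) = ∑ n ∈ Finset.Icc (-(m : ℤ)) m, β n * (nsoc n x * nsoc n y) := by
  classical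
  set s := Finset.Icc 1 (m + 1) ×ˢ Finset.Icc 1 (m + 1) with hs
  let β : ℤ → ℝ := fun n => (∑ p ∈ s with ((p.1 : ℤ) - p.2 : ℤ) = n,
    fkCoeff m p.1 * fkCoeff m p.2) / (2 * fkMass m)
  have heven : ∀ n, β (-n) = β n := by
    intro n
    simp only [β]
    congr 1
    refine Finset.sum_bij' (fun p _ => p.swap) (fun p _ => p.swap) ?_ ?_ ?_ ?_ ?_
    · rintro ⟨j, l⟩ h
      simp only [hs, Finset.mem_filter, Finset.mem_product, Prod.swap] at h ⊢
      exact ⟨⟨h.1.2, h.1.1⟩, by omega⟩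
    · rintro ⟨j, l⟩ h
      simp only [hs, Finset.mem_filter, Finset.mem_product, Prod.swap] at h ⊢
      exact ⟨⟨h.1.2, h.1.1⟩, by omega⟩
    · intro p _; rfl
    · intro p _; rfl
    · intro p _; exact mul_comm _ _
  refine ⟨β, fun x y => ?_⟩
  have h1 : fkKernel m (x - y) =
      ∑ n ∈ Finset.Icc (-(m : ℤ)) m, β n * Real.cos (n * Real.pi * (x - y)) := by
    unfold fkKernel
    rw [← Finset.sum_fiberwise_of_maps_to (s := s) (t := Finset.Icc (-(m : ℤ)) m)
      (g := fun p => (p.1 : ℤ) - p.2), Finset.sum_div]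
    · refine Finset.sum_congr rfl fun n _ => ?_
      simp only [β]
      rw [div_mul_eq_mul_div, Finset.sum_mul]
      congr 1
      refine Finset.sum_congr rfl fun p hp => ?_
      rw [(Finset.mem_filter.1 hp).2]
    · intro p hp
      simp only [hs, Finset.mem_product, Finset.mem_Icc] at hp ⊢
      omega
  have hflip : ∑ n ∈ Finset.Icc (-(m : ℤ)) m, β n * (nsoc n x * nsoc n y) =
      ∑ n ∈ Finset.Icc (-(m : ℤ)) m, β n * (nsoc (-n) x * nsoc (-n) y) := by
    refine Finset.sum_bij' (fun n _ => -n) (fun n _ => -n) ?_ ?_ ?_ ?_ ?_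
    · intro n hn; rw [Finset.mem_Icc] at *; omega
    · intro n hn; rw [Finset.mem_Icc] at *; omega
    · intro n _; simp
    · intro n _; simp
    · intro n _; rw [heven, neg_neg]
  have h2 : 2 * fkKernel m (x - y) =
      2 * ∑ n ∈ Finset.Icc (-(m : ℤ)) m, β n * (nsoc n x * nsoc n y) := by
    rw [two_mul (∑ n ∈ Finset.Icc (-(m : ℤ)) m, _)]
    nth_rewrite 2 [hflip]
    rw [← Finset.sum_add_distrib, h1, Finset.mul_sum]
    refine Finset.sum_congr rfl fun n _ => ?_
    have := nsoc_mul_add_nsoc_neg_mul n x y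
    linear_combination (-β n) * this
  linarith

lemma isPeriodic_jacksonKernel {d : ℕ} (m : ℕ) :
    IsPeriodic (jacksonKernel m : (Fin d → ℝ) → ℝ) := by
  obtain ⟨β, hβ⟩ := fkKernel_sub m
  intro x k
  unfold jacksonKernel
  refine Finset.prod_congr rfl fun i _ => ?_
  have h1 := hβ (x i + k i * 2) 0
  have h2 := hβ (x i) 0
  rw [sub_zero] at h1 h2
  rw [h1, h2]
  simp_rw [nsoc_add_period]

/-- Convolution with the tensor product kernel produces trigonometric polynomials. -/
lemma perConv_jacksonKernel_mem {d : ℕ} (m : ℕ) {G : (Fin d → ℝ) → ℝ} (hG : Continuous G)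
    (hGp : IsPeriodic G) : perConv (jacksonKernel m) G ∈ trigSpan d (d * m) := by
  classical
  obtain ⟨β, hβ⟩ := fkKernel_sub m
  have hGm : Measurable fun z : Cube d => G z.1 := (hG.comp continuous_subtype_val).measurable
  have hext : periodicExt (fun z : Cube d => G z.1) = G := by
    ext x; rw [periodicExt, hGp.wrap]
  set box : Finset (Fin d → ℤ) := Fintype.piFinset fun _ => Finset.Icc (-(m : ℤ)) m with hbox
  let Q : (Fin d → ℝ) → ℝ := ∑ n ∈ box,
    ((∏ i, β (n i)) * ∫ y : Cube d, G y.1 * basisFn n y.1) • basisFn n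
  have hQ : Q ∈ trigSpan d (d * m) := by
    refine Submodule.sum_mem _ fun n hn => Submodule.smul_mem _ _ (basisFn_mem_trigSpan ?_)
    rw [mem_freqs]
    calc ∑ i, |n i| ≤ ∑ _i : Fin d, (m : ℤ) := by
          refine Finset.sum_le_sum fun i _ => ?_
          have := Fintype.mem_piFinset.1 hn i
          rw [Finset.mem_Icc] at this
          exact abs_le.2 this
      _ = ((d * m : ℕ) : ℤ) := by simp
  have hval : ∀ x : Cube d, circConv (jacksonKernel m) (fun z : Cube d => G z.1) x = Q x.1 := by
    intro x
    unfold circConv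
    have e : ∀ y : Cube d, G y.1 * jacksonKernel m (x.1 - y.1) =
        ∑ n ∈ box, ((∏ i, β (n i)) * basisFn n x.1) * (G y.1 * basisFn n y.1) := by
      intro y
      unfold jacksonKernel basisFn
      simp_rw [Pi.sub_apply, hβ]
      rw [Finset.prod_univ_sum, Finset.mul_sum]
      refine Finset.sum_congr rfl fun n _ => ?_
      rw [Finset.prod_mul_distrib, Finset.prod_mul_distrib]
      ring
    simp_rw [e]
    rw [integral_finsetSum]
    · simp_rw [integral_const_mul]
      simp only [Q, Finset.sum_apply, Pi.smul_apply, smul_eq_mul]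
      exact Finset.sum_congr rfl fun n _ => by ring
    · intro n _
      exact (integrable_cube_of_continuous ((hG.comp continuous_subtype_val).mul
        ((contDiff_basisFn n).continuous.comp continuous_subtype_val))).const_mul _
  have := periodicExt_circConv (isPeriodic_jacksonKernel m) (continuous_jacksonKernel m) hGm
  rw [hext, periodicExt_of_mem_trigSpan hQ hval] at this
  rw [← this]
  exact hQ

/-- One step of the approximation scheme gains a factor `2d/m` at the cost of one difference. -/
lemma DiffBound.sub_perConv {d r m : ℕ} (hm : 0 < m) {M : ℝ} (hM : 0 ≤ M) {G : (Fin d → ℝ) → ℝ}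
    (hG : Continuous G) (h : DiffBound (r + 1) M G) :
    DiffBound r (M * (d * (2 / m))) fun x => G x - perConv (jacksonKernel m) G x := by
  have hK : Continuous (jacksonKernel m : (Fin d → ℝ) → ℝ) := continuous_jacksonKernel m
  have e : ∀ x, G x - perConv (jacksonKernel m) G x =
      ∫ t : Cube d, (-jacksonKernel m t.1) * (G (x + -t.1) - G x) := by
    intro x
    have h1 : ∀ t : Cube d, (-jacksonKernel m t.1) * (G (x + -t.1) - G x) =
        G x * jacksonKernel m t.1 - G (x - t.1) * jacksonKernel m t.1 := by
      intro t; rw [← sub_eq_add_neg]; ring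
    simp_rw [h1]
    rw [integral_sub ((integrable_cube_of_continuous (f := fun t : Cube d => jacksonKernel m t.1)
        (hK.comp continuous_subtype_val)).const_mul _)
      (integrable_perConv hK hG x), integral_const_mul, integral_jacksonKernel, mul_one, perConv]
  simp_rw [e]
  have hc : Continuous fun t : Cube d => (∑ j, |t.1 j|) * jacksonKernel m t.1 :=
    (continuous_finsetSum _ fun j _ => (continuous_cube_coord j).abs).mul
      (hK.comp continuous_subtype_val)
  have := DiffBound.integral (r := r) (μ := (volume : Measure (Cube d)))
    (m := fun t => M * ((∑ j, |t.1 j|) * jacksonKernel m t.1))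
    (F := fun t x => (-jacksonKernel m t.1) * (G (x + -t.1) - G x))
    ((integrable_cube_of_continuous hc).const_mul M)
    (fun x => integrable_cube_of_continuous (by fun_prop)) (Filter.Eventually.of_forall fun t => by
      have := (h.increment (-t.1)).const_mul (-jacksonKernel m t.1)
      refine this.mono (le_of_eq ?_)
      rw [abs_neg, abs_of_nonneg (jacksonKernel_nonneg m _)]
      simp only [Pi.neg_apply, abs_neg]
      ring)
  refine this.mono ?_
  rw [integral_const_mul]
  exact mul_le_mul_of_nonneg_left (integral_sum_abs_mul_jacksonKernel_le d hm) hM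

/-- Iterating the approximation step leaves a remainder that is controlled by the differences of
the order of the number of steps. -/
lemma exists_trigSpan_approx {d m : ℕ} (hm : 0 < m) (r : ℕ) {M : ℝ} (hM : 0 ≤ M)
    {G : (Fin d → ℝ) → ℝ} (hG : Continuous G) (hGp : IsPeriodic G) (h : DiffBound r M G) :
    ∃ P ∈ trigSpan d (d * m), ∀ x, |G x - P x| ≤ M * (d * (2 / m)) ^ r := by
  induction r generalizing M G with
  | zero => exact ⟨0, Submodule.zero_mem _, fun x => by simpa using h x⟩
  | succ r ih =>
    have hJ := perConv_jacksonKernel_mem m hG hGp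
    obtain ⟨P, hP, hb⟩ := ih (M := M * (d * (2 / m)))
      (G := fun x => G x - perConv (jacksonKernel m) G x) (by positivity)
      (hG.sub (continuous_of_mem_trigSpan hJ))
      (fun x n => by simp only [hGp x n, isPeriodic_of_mem_trigSpan hJ x n]) (h.sub_perConv hm hM hG)
    refine ⟨perConv (jacksonKernel m) G + P, Submodule.add_mem _ hJ hP, fun x => ?_⟩
    rw [Pi.add_apply, ← sub_sub, pow_succ', ← mul_assoc]
    exact hb x

lemma abs_circConv_le {d : ℕ} {D : (Fin d → ℝ) → ℝ} (hDp : IsPeriodic D) (hDc : Continuous D)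
    {f : Cube d → ℝ} (hf : Measurable f) {B : ℝ} (hB : ∀ z, |f z| ≤ B) {L : ℝ}
    (hL : ∫ z : Cube d, |D z.1| ≤ L) (x : Cube d) : |circConv D f x| ≤ L * B := by
  have hB0 : 0 ≤ B := (abs_nonneg _).trans (hB x)
  rw [circConv_eq hDp hDc.measurable hf]
  rw [← Real.norm_eq_abs]
  refine (norm_integral_le_integral_norm _).trans ?_
  calc ∫ t : Cube d, ‖periodicExt f (x.1 - t.1) * D t.1‖ ≤ ∫ t : Cube d, |D t.1| * B := by
        refine integral_mono_of_nonneg (Filter.Eventually.of_forall fun _ => norm_nonneg _)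
          ((integrable_cube_of_continuous (by fun_prop)).mul_const B)
          (Filter.Eventually.of_forall fun t => ?_)
        simp only [Real.norm_eq_abs, abs_mul, mul_comm |D t.1|]
        exact mul_le_mul_of_nonneg_right (hB _) (abs_nonneg _)
    _ ≤ L * B := by rw [integral_mul_const]; exact mul_le_mul_of_nonneg_right hL hB0

/-- Jackson's inequality for the de la Vallée Poussin means. -/
lemma MemCp.abs_circConv_sub_le {d ν m : ℕ} (hm : 0 < m) {f : Cube d → ℝ} (hf : MemCp ν f) {M : ℝ}
    (hM : 0 ≤ M) (hfM : cNorm ν f ≤ ENNReal.ofReal M) {L : ℝ}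
    (hL : ∫ z : Cube d, |vpKernel (2 * (d * m)) z.1| ≤ L) (x : Cube d) :
    |f x - circConv (vpKernel (2 * (d * m))) f x| ≤ (1 + L) * (M * (d * (2 / m)) ^ (ν + 1)) := by
  set N := 2 * (d * m) with hN
  have hNe : Even N := even_two_mul _
  have hN2 : N / 2 = d * m := by omega
  obtain ⟨P, hP, hb⟩ := exists_trigSpan_approx hm (ν + 1) hM hf.contDiff.continuous
    (isPeriodic_periodicExt f) ((cNorm_le_iff hf.contDiff hM).1 hfM _ le_rfl)
  have hfc := hf.continuous
  have hPc : Continuous fun z : Cube d => P z.1 :=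
    (continuous_of_mem_trigSpan hP).comp continuous_subtype_val
  have hb' : ∀ z : Cube d, |f z - P z.1| ≤ M * (d * (2 / m)) ^ (ν + 1) := by
    intro z
    rw [← hf.boundary z]
    exact hb z.1
  have hrep := circConv_vpKernel_self hNe (by rw [hN2]; exact hP) x
  have hlin : circConv (vpKernel N) f x = P x.1 +
      circConv (vpKernel N) (fun z : Cube d => f z - P z.1) x := by
    rw [← hrep]
    unfold circConv
    rw [← integral_add (integrable_mul_continuous (integrable_cube_of_continuous hPc)
        (continuous_vpKernel N) x)
      (integrable_mul_continuous (f := fun z : Cube d => f z - P z.1)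
        (integrable_cube_of_continuous (hfc.sub hPc)) (continuous_vpKernel N) x)]
    congr 1
    ext y
    ring
  have h2 := abs_circConv_le (isPeriodic_vpKernel N) (continuous_vpKernel N)
    (hfc.sub hPc).measurable hb' hL x
  rw [hlin, ← sub_sub]
  refine (abs_sub _ _).trans ?_
  rw [add_mul, one_mul]
  exact add_le_add (hb' x) h2

/-! ### Barrier argument for sums of rank-one matrices -/

/-- The inequality between power sums that controls the lower barrier when it moves up by `1`:
with `Δ = ∑ (1/(s-1) - 1/s)`, the Cauchy–Schwarz inequality gives `Δ² ≤ ∑ 1/((s-1)² s) · ∑ 1/s`. -/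
theorem barrier_sum_le {ι : Type*} [Fintype ι] (s : ι → ℝ) (hs : ∀ i, 0 < s i)
    (hsum : ∑ i, (s i)⁻¹ ≤ 1 / 4) :
    (∀ i, 4 ≤ s i) ∧
    (∑ i, (s i - 1)⁻¹ - ∑ i, (s i)⁻¹) * (3 / 4 + ∑ i, (s i - 1)⁻¹) ≤ ∑ i, (s i - 1)⁻¹ ^ 2 := by
  have h4 : ∀ i, 4 ≤ s i := by
    intro i
    have h1 : (s i)⁻¹ ≤ 1 / 4 :=
      (Finset.single_le_sum (f := fun i => (s i)⁻¹) (fun j _ => (inv_pos.2 (hs j)).le)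
        (Finset.mem_univ i)).trans hsum
    rw [inv_le_comm₀ (hs i) (by norm_num)] at h1
    linarith
  refine ⟨h4, ?_⟩
  have hb : ∀ i, 0 < s i - 1 := fun i => by linarith [h4 i]
  set Δ := ∑ i, ((s i - 1)⁻¹ - (s i)⁻¹) with hΔ
  set X := ∑ i, ((s i - 1)⁻¹ ^ 2 * (s i)⁻¹)
  set Φ := ∑ i, (s i)⁻¹
  have hΔ0 : 0 ≤ Δ := Finset.sum_nonneg fun i _ => by
    have := inv_anti₀ (hb i) (by linarith : s i - 1 ≤ s i)
    linarith
  have hsplit : ∑ i, (s i - 1)⁻¹ = Φ + Δ := by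
    simp [hΔ, Φ, Finset.sum_sub_distrib]
  have hsq : ∑ i, (s i - 1)⁻¹ ^ 2 = Δ + X := by
    rw [hΔ, ← Finset.sum_add_distrib]
    refine Finset.sum_congr rfl fun i _ => ?_
    have := (hb i).ne'
    have := (hs i).ne'
    field_simp
    ring
  have hcs : Δ ^ 2 ≤ X * Φ := by
    refine Finset.sum_sq_le_sum_mul_sum_of_sq_le_mul _ (fun i _ => ?_) (fun i _ => ?_)
      fun i _ => le_of_eq ?_
    · have := hs i; positivity
    · have := hs i; positivity
    · have := (hb i).ne'
      have := (hs i).ne'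
      field_simp
      ring
  have hX : 0 ≤ X := Finset.sum_nonneg fun i _ => by have := hs i; positivity
  rw [hsq, hsplit, add_sub_cancel_left]
  nlinarith

open Matrix in
/-- One step of the barrier argument in a basis of eigenvectors. The inverse of the updated matrix
is given by the Sherman–Morrison formula. -/
theorem barrier_diagonal {ι : Type*} [Fintype ι] [DecidableEq ι] (s w : ι → ℝ) (hs : ∀ i, 0 < s i)
    (hsum : ∑ i, (s i)⁻¹ ≤ 1 / 4)
    (hw : ∑ i, ((s i - 1)⁻¹ ^ 2 - (∑ j, (s j - 1)⁻¹ - ∑ j, (s j)⁻¹) * (s i - 1)⁻¹) ≤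
      ∑ i, ((s i - 1)⁻¹ ^ 2 - (∑ j, (s j - 1)⁻¹ - ∑ j, (s j)⁻¹) * (s i - 1)⁻¹) * w i ^ 2) :
    (diagonal (fun i => s i - 1) + (4 / 3 : ℝ) • vecMulVec w w).PosDef ∧
    ∃ T, (diagonal (fun i => s i - 1) + (4 / 3 : ℝ) • vecMulVec w w) * T = 1 ∧
      T.trace ≤ 1 / 4 := by
  obtain ⟨h4, hmain⟩ := barrier_sum_le s hs hsum
  have hb : ∀ i, 0 < s i - 1 := fun i => by linarith [h4 i]
  set Δ := ∑ j, (s j - 1)⁻¹ - ∑ j, (s j)⁻¹ with hΔ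
  refine ⟨(PosDef.diagonal hb).add_posSemidef
    ((posSemidef_vecMulVec_self_star w).smul (by norm_num)), ?_⟩
  set u : ι → ℝ := fun i => (s i - 1)⁻¹ * w i with hu
  set q := w ⬝ᵥ u with hq
  have hq' : q = ∑ i, (s i - 1)⁻¹ * w i ^ 2 := by
    simp only [hq, hu, dotProduct]
    exact Finset.sum_congr rfl fun i _ => by ring
  have hq0 : 0 ≤ q := by
    rw [hq']
    exact Finset.sum_nonneg fun i _ => mul_nonneg (inv_pos.2 (hb i)).le (sq_nonneg _)
  refine ⟨diagonal (fun i => (s i - 1)⁻¹) - ((4 / 3) / (1 + 4 / 3 * q)) • vecMulVec u u, ?_, ?_⟩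
  · have h1 : diagonal (fun i => s i - 1) * diagonal (fun i => (s i - 1)⁻¹) =
        (1 : Matrix ι ι ℝ) := by
      rw [diagonal_mul_diagonal, ← diagonal_one]
      congr 1
      ext i
      exact mul_inv_cancel₀ (hb i).ne'
    have h2 : diagonal (fun i => s i - 1) *ᵥ u = w := by
      ext i
      rw [mulVec_diagonal, hu]
      exact mul_inv_cancel_left₀ (hb i).ne' _
    have h3 : w ᵥ* diagonal (fun i => (s i - 1)⁻¹) = u := by
      ext i
      rw [vecMul_diagonal, hu, mul_comm]
    have h4 : 1 + 4 / 3 * q ≠ 0 := by positivity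
    rw [mul_sub, add_mul, h1, Matrix.mul_smul, add_mul, mul_vecMulVec, h2, Matrix.smul_mul,
      vecMulVec_mul, h3, Matrix.smul_mul, vecMulVec_mul_vecMulVec, ← hq, vecMulVec_smul, smul_smul,
      add_sub_assoc, add_eq_left, sub_eq_zero]
    change (4 / 3 : ℝ) • vecMulVec w u = (4 / 3 / (1 + 4 / 3 * q)) •
      (vecMulVec w u + (4 / 3 * q) • vecMulVec w u)
    ext i j
    simp only [Matrix.smul_apply, Matrix.add_apply, smul_eq_mul]
    field_simp
  · rw [trace_sub, trace_diagonal, trace_smul, trace_vecMulVec]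
    have hp : u ⬝ᵥ u = ∑ i, (s i - 1)⁻¹ ^ 2 * w i ^ 2 := by
      simp only [hu, dotProduct]
      exact Finset.sum_congr rfl fun i _ => by ring
    have hw' : ∑ i, (s i - 1)⁻¹ ^ 2 - Δ * ∑ i, (s i - 1)⁻¹ ≤ u ⬝ᵥ u - Δ * q := by
      rw [hp, hq', Finset.mul_sum, Finset.mul_sum, ← Finset.sum_sub_distrib,
        ← Finset.sum_sub_distrib]
      refine hw.trans (le_of_eq (Finset.sum_congr rfl fun i _ => by ring))
    have hkey : Δ * (1 + 4 / 3 * q) ≤ 4 / 3 * (u ⬝ᵥ u) := by nlinarith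
    have h5 : Δ ≤ (4 / 3) / (1 + 4 / 3 * q) * (u ⬝ᵥ u) := by
      rw [div_mul_eq_mul_div, le_div_iff₀ (by positivity)]
      exact hkey
    rw [smul_eq_mul]
    linarith

open Matrix in
/-- One step of the barrier argument: if the vectors `a z` are, on average, isotropic, one of them
allows the barrier to move up without an increase of the potential `tr S⁻¹`. -/
theorem barrier_step {ι Z : Type*} [Fintype ι] [DecidableEq ι] (a : Z → ι → ℝ)
    (ha : ∀ C : Matrix ι ι ℝ, ∃ z, C.trace ≤ a z ⬝ᵥ C *ᵥ a z)
    (S T : Matrix ι ι ℝ) (hS : S.PosDef) (hST : S * T = 1) (hT : T.trace ≤ 1 / 4) :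
    ∃ z, (S - 1 + (4 / 3 : ℝ) • vecMulVec (a z) (a z)).PosDef ∧
    ∃ T', (S - 1 + (4 / 3 : ℝ) • vecMulVec (a z) (a z)) * T' = 1 ∧ T'.trace ≤ 1 / 4 := by
  set s := hS.isHermitian.eigenvalues with hs
  set U : Matrix ι ι ℝ := (hS.isHermitian.eigenvectorUnitary : Matrix ι ι ℝ) with hU
  have hUU : U * Uᵀ = 1 := by
    have := (mem_unitaryGroup_iff (A := U)).1 hS.isHermitian.eigenvectorUnitary.2
    rwa [star_eq_conjTranspose, conjTranspose_eq_transpose_of_trivial] at this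
  have hUU' : Uᵀ * U = 1 := mul_eq_one_comm.1 hUU
  have hspec : S = U * diagonal s * Uᵀ := by
    have := hS.isHermitian.spectral_theorem
    rw [Unitary.conjStarAlgAut_apply, star_eq_conjTranspose,
      conjTranspose_eq_transpose_of_trivial] at this
    exact this
  have hspos : ∀ i, 0 < s i := hS.eigenvalues_pos
  have hconj_trace : ∀ X : Matrix ι ι ℝ, (U * X * Uᵀ).trace = X.trace := by
    intro X
    rw [trace_mul_cycle, hUU', one_mul]
  have hTeq : T = U * diagonal (fun i => (s i)⁻¹) * Uᵀ := by
    have h1 : S * (U * diagonal (fun i => (s i)⁻¹) * Uᵀ) = 1 := by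
      rw [hspec]
      calc _ = U * (diagonal s * (Uᵀ * U) * diagonal (fun i => (s i)⁻¹)) * Uᵀ := by
            simp only [Matrix.mul_assoc]
        _ = 1 := by
            rw [hUU', Matrix.mul_one, diagonal_mul_diagonal]
            simp only [mul_inv_cancel₀ (hspos _).ne', diagonal_one, Matrix.mul_one, hUU]
    exact (inv_eq_right_inv hST).symm.trans (inv_eq_right_inv h1)
  have hsum : ∑ i, (s i)⁻¹ ≤ 1 / 4 := by
    rwa [hTeq, hconj_trace, trace_diagonal] at hT
  set c : ι → ℝ := fun i => (s i - 1)⁻¹ ^ 2 - (∑ j, (s j - 1)⁻¹ - ∑ j, (s j)⁻¹) * (s i - 1)⁻¹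
    with hc
  obtain ⟨z, hz⟩ := ha (U * diagonal c * Uᵀ)
  have hzw : a z ⬝ᵥ (U * diagonal c * Uᵀ) *ᵥ a z = ∑ i, c i * (Uᵀ *ᵥ a z) i ^ 2 := by
    rw [← mulVec_mulVec, ← mulVec_mulVec, dotProduct_mulVec, ← mulVec_transpose]
    simp only [dotProduct, mulVec_diagonal]
    exact Finset.sum_congr rfl fun i _ => by ring
  rw [hconj_trace, trace_diagonal, hzw] at hz
  obtain ⟨hpd, T', hT', htr⟩ := barrier_diagonal s (Uᵀ *ᵥ a z) hspos hsum hz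
  have hnew : S - 1 + (4 / 3 : ℝ) • vecMulVec (a z) (a z) =
      U * (diagonal (fun i => s i - 1) +
        (4 / 3 : ℝ) • vecMulVec (Uᵀ *ᵥ a z) (Uᵀ *ᵥ a z)) * Uᵀ := by
    rw [mul_add, add_mul, Matrix.mul_smul, Matrix.smul_mul, mul_vecMulVec, vecMulVec_mul, mulVec_mulVec, hUU,
      one_mulVec, vecMul_transpose, mulVec_mulVec, hUU, one_mulVec,
      ← diagonal_sub, diagonal_one, mul_sub, sub_mul, ← hspec, mul_one, hUU]
  refine ⟨z, ?_, U * T' * Uᵀ, ?_, ?_⟩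
  · rw [hnew]
    have := hpd.mul_mul_conjTranspose_same (B := U) fun x y hxy => by
      have := congrArg (fun v => v ᵥ* Uᵀ) hxy
      simpa only [vecMul_vecMul, hUU, vecMul_one] using this
    rwa [conjTranspose_eq_transpose_of_trivial] at this
  · rw [hnew]
    set D := diagonal (fun i => s i - 1) + (4 / 3 : ℝ) • vecMulVec (Uᵀ *ᵥ a z) (Uᵀ *ᵥ a z)
    calc U * D * Uᵀ * (U * T' * Uᵀ) = U * (D * (Uᵀ * U) * T') * Uᵀ := by
          simp only [Matrix.mul_assoc]
      _ = 1 := by rw [hUU', Matrix.mul_one, hT', Matrix.mul_one, hUU]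
  · rwa [hconj_trace]

open Matrix in
theorem dotProduct_sum_vecMulVec {ι κ : Type*} [Fintype ι] (s : Finset κ) (a : κ → ι → ℝ)
    (u : ι → ℝ) :
    u ⬝ᵥ (∑ j ∈ s, vecMulVec (a j) (a j)) *ᵥ u = ∑ j ∈ s, (a j ⬝ᵥ u) ^ 2 := by
  rw [sum_mulVec, dotProduct_sum]
  refine Finset.sum_congr rfl fun j _ => ?_
  rw [vecMulVec_mulVec, dotProduct_smul, dotProduct_comm u]
  simp [sq]

open Matrix in
/-- Among vectors that are isotropic on average, `12 |ι|` of them have a frame operator which is at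
least half of its expected value. -/
theorem exists_frame {ι Z : Type*} [Fintype ι] [DecidableEq ι] [Nonempty ι] (a : Z → ι → ℝ)
    (ha : ∀ C : Matrix ι ι ℝ, ∃ z, C.trace ≤ a z ⬝ᵥ C *ᵥ a z) {m : ℕ} (hm : m = Fintype.card ι) :
    ∃ z : Fin (12 * m) → Z, ∀ u : ι → ℝ, 6 * m * (u ⬝ᵥ u) ≤ ∑ j, (a (z j) ⬝ᵥ u) ^ 2 := by
  have hm0 : 0 < m := hm ▸ Fintype.card_pos
  -- The barrier starts at `4m` times the identity, the inverse of which has trace `1/4`. Each step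
  -- subtracts the identity and adds `4/3` of a rank-one matrix, so that after `12m` steps
  -- `(4/3) ∑ v vᵀ` exceeds `8m` times the identity.
  have key : ∀ k : ℕ, ∃ z : Fin k → Z,
      (((4 : ℝ) * m - k) • (1 : Matrix ι ι ℝ) +
        (4 / 3 : ℝ) • ∑ j, vecMulVec (a (z j)) (a (z j))).PosDef ∧
      ∃ T, (((4 : ℝ) * m - k) • (1 : Matrix ι ι ℝ) +
        (4 / 3 : ℝ) • ∑ j, vecMulVec (a (z j)) (a (z j))) * T = 1 ∧ T.trace ≤ 1 / 4 := by
    intro k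
    induction k with
    | zero =>
      refine ⟨Fin.elim0, ?_, ((4 : ℝ) * m)⁻¹ • (1 : Matrix ι ι ℝ), ?_, ?_⟩
      · simpa using PosDef.one.smul (by positivity : (0 : ℝ) < 4 * m)
      · have : (4 : ℝ) * m ≠ 0 := by positivity
        simp only [Finset.univ_eq_empty, Finset.sum_empty, smul_zero, add_zero, Nat.cast_zero,
          sub_zero, Matrix.smul_mul, Matrix.mul_smul, Matrix.one_mul, smul_smul]
        rw [inv_mul_cancel₀ this, one_smul]
      · rw [trace_smul, trace_one, ← hm, smul_eq_mul]
        apply le_of_eq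
        field_simp
    | succ k ih =>
      obtain ⟨z, hpd, T, hT, htr⟩ := ih
      obtain ⟨y, hy⟩ := barrier_step a ha _ T hpd hT htr
      refine ⟨Fin.snoc z y, ?_⟩
      have heq : ((4 : ℝ) * m - (k + 1 : ℕ)) • (1 : Matrix ι ι ℝ) + (4 / 3 : ℝ) •
            ∑ j, vecMulVec (a ((Fin.snoc z y : Fin (k + 1) → Z) j))
              (a ((Fin.snoc z y : Fin (k + 1) → Z) j)) =
          ((4 : ℝ) * m - k) • (1 : Matrix ι ι ℝ) +
            (4 / 3 : ℝ) • ∑ j, vecMulVec (a (z j)) (a (z j)) - 1 +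
            (4 / 3 : ℝ) • vecMulVec (a y) (a y) := by
        rw [Fin.sum_univ_castSucc]
        simp only [Fin.snoc_castSucc, Fin.snoc_last]
        push_cast
        module
      rw [heq]
      exact hy
  obtain ⟨z, hpd, -⟩ := key (12 * m)
  refine ⟨z, fun u => ?_⟩
  have h := hpd.posSemidef.dotProduct_mulVec_nonneg u
  rw [star_trivial, add_mulVec, dotProduct_add, smul_mulVec, smul_mulVec, one_mulVec,
    dotProduct_smul, dotProduct_smul, dotProduct_sum_vecMulVec, smul_eq_mul, smul_eq_mul] at h
  push_cast at h
  linarith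

/-! ### Existence of quasi-optimal designs -/

open Matrix in
theorem exists_trace_le_basisFn {d : ℕ} (N : ℕ) (C : Matrix (FeatIdx d N) (FeatIdx d N) ℝ) :
    ∃ z : Cube d, C.trace ≤
      (fun n : FeatIdx d N => basisFn n.1 z.1) ⬝ᵥ C *ᵥ (fun n : FeatIdx d N => basisFn n.1 z.1) := by
  have hcont : ∀ n : FeatIdx d N, Continuous fun z : Cube d => basisFn n.1 z.1 := fun n =>
    (contDiff_basisFn n.1).continuous.comp continuous_subtype_val
  set f : Cube d → ℝ := fun z => ∑ n : FeatIdx d N, ∑ k : FeatIdx d N,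
    C n k * (basisFn n.1 z.1 * basisFn k.1 z.1) with hf
  have hfc : Continuous f := continuous_finsetSum _ fun n _ => continuous_finsetSum _ fun k _ =>
    continuous_const.mul ((hcont n).mul (hcont k))
  have hint : ∫ z, f z = 2 ^ d * C.trace := by
    have hi : ∀ n k : FeatIdx d N,
        Integrable (fun z : Cube d => C n k * (basisFn n.1 z.1 * basisFn k.1 z.1)) := fun n k =>
      integrable_cube_of_continuous (continuous_const.mul ((hcont n).mul (hcont k)))
    rw [hf, integral_finsetSum _ fun n _ => integrable_finsetSum _ fun k _ => hi n k]
    simp only [integral_finsetSum _ fun k _ => hi _ k, integral_const_mul, integral_basisFn_mul,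
      Subtype.val_inj, mul_ite, mul_zero, Finset.sum_ite_eq, Finset.mem_univ, if_true, trace,
      diag_apply, Finset.mul_sum, mul_comm]
  have hne : (volume : Measure (Cube d)) ≠ 0 := by
    intro h
    have := volume_real_cube d
    rw [h] at this
    simp at this
    exact absurd this.symm (by positivity)
  obtain ⟨z, hz⟩ := exists_average_le hne (integrable_cube_of_continuous hfc)
  refine ⟨z, ?_⟩
  rw [average_eq, volume_real_cube, hint, smul_eq_mul, inv_mul_cancel_left₀ (by positivity)] at hz
  refine hz.trans (le_of_eq ?_)
  simp only [hf, dotProduct, mulVec, Finset.mul_sum]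
  exact Finset.sum_congr rfl fun n _ => Finset.sum_congr rfl fun k _ => by ring

open Matrix in
theorem Design.dotProduct_covariance {d N : ℕ} (ρ : Design d) (u : FeatIdx d N → ℝ) :
    u ⬝ᵥ ρ.covariance N *ᵥ u = ∑ z ∈ ρ.weight.support, ρ.weight z * (feature N z ⬝ᵥ u) ^ 2 := by
  rw [Design.covariance, Finsupp.sum, sum_mulVec, dotProduct_sum]
  refine Finset.sum_congr rfl fun z _ => ?_
  rw [smul_mulVec, vecMulVec_mulVec, dotProduct_smul, dotProduct_smul, dotProduct_comm u]
  simp [sq]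

theorem card_featIdx (d N : ℕ) : Fintype.card (FeatIdx d N) = numFeatures d N := by
  rw [Fintype.card_coe, numFeatures]

open Matrix in
/-- The design is uniform on the points of a frame for the orthonormal basis; in that basis the
features have squared norm `Ñ` at every point, and the covariance matrix is at least `1/2`. -/
theorem exists_isQuasiOptimal (d N : ℕ)
    (hN : 12 ≤ 4 * Real.log (Real.log (numFeatures d N))) :
    ∃ ρ : Design d, ρ.IsQuasiOptimal N := by
  have hm0 : 0 < numFeatures d N := by
    rcases Nat.eq_zero_or_pos (numFeatures d N) with h | h
    · rw [h] at hN
      norm_num at hN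
    · exact h
  have hne : Nonempty (FeatIdx d N) := Fintype.card_pos_iff.1 (by rwa [card_featIdx])
  obtain ⟨m, hm⟩ : ∃ m, m = numFeatures d N := ⟨_, rfl⟩
  obtain ⟨z, hz⟩ := exists_frame (fun (z : Cube d) (n : FeatIdx d N) => basisFn n.1 z.1)
    (exists_trace_le_basisFn N) (hm.trans (card_featIdx d N).symm)
  rw [← hm] at hN hm0
  have hmpos : (0 : ℝ) < m := by exact_mod_cast hm0
  set w : Cube d →₀ ℝ := ∑ j, Finsupp.single (z j) ((12 * m : ℝ)⁻¹) with hw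
  have hsum : ∀ g : Cube d → ℝ, (w.sum fun x c => c * g x) = (12 * m : ℝ)⁻¹ * ∑ j, g (z j) := by
    intro g
    rw [hw, ← Finsupp.sum_finsetSum_index (fun x => zero_mul _) fun x b c => add_mul b c _,
      Finset.mul_sum]
    exact Finset.sum_congr rfl fun j _ => Finsupp.sum_single_index (zero_mul _)
  let ρ : Design d :=
    { weight := w
      nonneg := fun x => by
        rw [hw, Finsupp.finsetSum_apply]
        refine Finset.sum_nonneg fun j _ => ?_
        rw [Finsupp.single_apply]
        split_ifs <;> positivity
      sum_eq_one := by
        have := hsum fun _ => 1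
        simp only [mul_one, Finset.sum_const, Finset.card_univ, Fintype.card_fin, nsmul_eq_mul]
          at this
        rw [this]
        push_cast
        exact inv_mul_cancel₀ (by positivity) }
  -- The vector of the coefficients in the orthonormal basis.
  let r : (FeatIdx d N → ℝ) → FeatIdx d N → ℝ := fun u n => u n / normFactor n.1
  have hr : ∀ (x : Cube d) (u : FeatIdx d N → ℝ),
      (fun n : FeatIdx d N => basisFn n.1 x.1) ⬝ᵥ r u = feature N x ⬝ᵥ u := by
    intro x u
    refine Finset.sum_congr rfl fun n _ => ?_
    have := (normFactor_pos n.1).ne'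
    simp only [r, basisFn_eq_feature]
    field_simp
  have hlow : ∀ u : FeatIdx d N → ℝ, r u ⬝ᵥ r u / 2 ≤ u ⬝ᵥ ρ.covariance N *ᵥ u := by
    intro u
    have h1 : u ⬝ᵥ ρ.covariance N *ᵥ u = (12 * m : ℝ)⁻¹ * ∑ j, (feature N (z j) ⬝ᵥ u) ^ 2 := by
      rw [ρ.dotProduct_covariance]
      exact hsum fun x => (feature N x ⬝ᵥ u) ^ 2
    have h2 := hz (r u)
    simp only [hr] at h2
    rw [h1, inv_mul_eq_div, le_div_iff₀ (by positivity)]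
    linarith
  have hinv : IsUnit (ρ.covariance N).det := by
    rw [← isUnit_iff_isUnit_det, ← mulVec_injective_iff_isUnit]
    refine (injective_iff_map_eq_zero (ρ.covariance N).mulVecLin).2 fun u hu => ?_
    have h1 := hlow u
    rw [mulVecLin_apply] at hu
    rw [hu, dotProduct_zero] at h1
    have h2 : r u = 0 := by
      rw [← dotProduct_self_eq_zero]
      have : 0 ≤ r u ⬝ᵥ r u := Finset.sum_nonneg fun n _ => mul_self_nonneg _
      linarith
    ext n
    have h3 := congrFun h2 n
    simpa [r, (normFactor_pos n.1).ne'] using h3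
  refine ⟨ρ, ?_, hinv, fun x => ?_⟩
  · have hsub : w.support ⊆ Finset.univ.image z := by
      classical
      refine Finsupp.support_finsetSum.trans (Finset.biUnion_subset.2 fun j _ => ?_)
      refine Finsupp.support_single_subset.trans ?_
      simp
    have hcard : w.support.card ≤ 12 * m :=
      (Finset.card_le_card hsub).trans (Finset.card_image_le.trans (by simp))
    calc (w.support.card : ℝ) ≤ 12 * m := by exact_mod_cast hcard
      _ ≤ 4 * Real.log (Real.log m) * m := by gcongr
      _ = 4 * numFeatures d N * Real.log (Real.log (numFeatures d N)) := by rw [← hm]; ring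
  · set v := (ρ.covariance N)⁻¹ *ᵥ feature N x with hv
    have hcv : ρ.covariance N *ᵥ v = feature N x := by
      rw [hv, mulVec_mulVec, mul_nonsing_inv _ hinv, one_mulVec]
    have h1 := hlow v
    rw [hcv, dotProduct_comm] at h1
    rw [dotProduct_comm v] at h1
    set q := feature N x ⬝ᵥ v
    have h2 : q ^ 2 ≤ m * (r v ⬝ᵥ r v) := by
      have h3 : q = ∑ n : FeatIdx d N, basisFn n.1 x.1 * r v n := (hr x v).symm
      have h4 : ∑ n : FeatIdx d N, basisFn n.1 x.1 ^ 2 = m := by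
        rw [hm, ← sum_basisFn_sq N x.1]
        exact Finset.sum_coe_sort (freqs d N) fun n => basisFn n x.1 ^ 2
      have h5 : r v ⬝ᵥ r v = ∑ n, r v n ^ 2 := Finset.sum_congr rfl fun n _ => (sq _).symm
      rw [h3, ← h4, h5]
      exact Finset.sum_mul_sq_le_sq_mul_sq _ _ _
    rw [← hm]
    have h0 : 0 ≤ r v ⬝ᵥ r v := Finset.sum_nonneg fun n _ => mul_self_nonneg _
    by_contra! hlt
    nlinarith

/-! ### The Bellman operators -/

variable {dS dA H : ℕ}

theorem continuous_pair : Continuous fun q : Cube dS × Cube dA => pair q.1 q.2 := by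
  refine Continuous.subtype_mk (continuous_pi fun i => ?_) _
  refine Fin.addCases (fun j => ?_) (fun j => ?_) i
  · simp only [Fin.append_left]
    exact (continuous_apply j).comp (continuous_subtype_val.comp continuous_fst)
  · simp only [Fin.append_right]
    exact (continuous_apply j).comp (continuous_subtype_val.comp continuous_snd)

instance nonempty_cube (d : ℕ) : Nonempty (Cube d) := ⟨wrap 0⟩

theorem continuous_valueOf {f : Cube (dS + dA) → ℝ} (hf : Continuous f) :
    Continuous (valueOf f : Cube dS → ℝ) := by
  have h := isCompact_univ.continuous_sSup
    (f := fun (s : Cube dS) (a : Cube dA) => f (pair s a)) (hf.comp continuous_pair)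
  simp only [Set.image_univ] at h
  exact h

theorem bddAbove_range_of_abs_le {ι : Type*} {f : ι → ℝ} {B : ℝ} (hf : ∀ i, |f i| ≤ B) :
    BddAbove (Set.range f) :=
  ⟨B, by rintro _ ⟨i, rfl⟩; exact (abs_le.1 (hf i)).2⟩

theorem abs_valueOf_le {f : Cube (dS + dA) → ℝ} {B : ℝ} (hf : ∀ z, |f z| ≤ B) (s : Cube dS) :
    |valueOf f s| ≤ B := by
  refine abs_le.2 ⟨?_, ciSup_le fun a => (abs_le.1 (hf _)).2⟩
  obtain ⟨a⟩ := nonempty_cube dA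
  exact (abs_le.1 (hf (pair s a))).1.trans
    (le_ciSup (bddAbove_range_of_abs_le fun a => hf (pair s a)) a)

theorem valueOf_le_add {f g : Cube (dS + dA) → ℝ} {B D : ℝ} (hg : ∀ z, |g z| ≤ B)
    (hD : ∀ z, |f z - g z| ≤ D) (s : Cube dS) : valueOf f s ≤ valueOf g s + D := by
  refine ciSup_le fun a => ?_
  have h1 := (abs_le.1 (hD (pair s a))).2
  have h2 := le_ciSup (bddAbove_range_of_abs_le fun a => hg (pair s a)) a
  change g (pair s a) ≤ valueOf g s at h2
  linarith

theorem abs_valueOf_sub_le {f g : Cube (dS + dA) → ℝ} {A B D : ℝ} (hf : ∀ z, |f z| ≤ A)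
    (hg : ∀ z, |g z| ≤ B) (hD : ∀ z, |f z - g z| ≤ D) (s : Cube dS) :
    |valueOf f s - valueOf g s| ≤ D := by
  have h1 := valueOf_le_add hg hD s
  have h2 := valueOf_le_add hf (fun z => by rw [abs_sub_comm]; exact hD z) s
  exact abs_le.2 ⟨by linarith, by linarith⟩

theorem exists_abs_le_of_continuous {d : ℕ} {f : Cube d → ℝ} (hf : Continuous f) :
    ∃ B, ∀ z, |f z| ≤ B := by
  obtain ⟨B, hB⟩ := isCompact_univ.exists_bound_of_continuousOn hf.continuousOn
  exact ⟨B, fun z => hB z (Set.mem_univ z)⟩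

theorem MDP.integrable_of_continuous (M : MDP dS dA H) (h : Fin H) (z : Cube (dS + dA))
    {V : Cube dS → ℝ} (hV : Continuous V) : Integrable V (M.p h z) := by
  have := M.markov h
  obtain ⟨B, hB⟩ := exists_abs_le_of_continuous hV
  exact Integrable.of_bound hV.measurable.aestronglyMeasurable B (ae_of_all _ hB)

theorem MDP.abs_bellman_sub_le (M : MDP dS dA H) (h : Fin H) {f g : Cube (dS + dA) → ℝ}
    (hf : Continuous f) (hg : Continuous g) {D : ℝ} (hD : ∀ z, |f z - g z| ≤ D)
    (z : Cube (dS + dA)) : |M.bellman h f z - M.bellman h g z| ≤ D := by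
  have := M.markov h
  obtain ⟨A, hA⟩ := exists_abs_le_of_continuous hf
  obtain ⟨B, hB⟩ := exists_abs_le_of_continuous hg
  rw [bellman, bellman, add_sub_add_left_eq_sub,
    ← integral_sub (M.integrable_of_continuous h z (continuous_valueOf hf))
      (M.integrable_of_continuous h z (continuous_valueOf hg))]
  have := norm_integral_le_of_norm_le_const (μ := M.p h z)
    (f := fun s => valueOf f s - valueOf g s) (ae_of_all _ (abs_valueOf_sub_le hA hB hD))
  simpa using this

theorem MDP.abs_bellman_le (M : MDP dS dA H) (h : Fin H) {f : Cube (dS + dA) → ℝ} {B : ℝ}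
    (hB : ∀ z, |f z| ≤ B) (z : Cube (dS + dA)) : |M.bellman h f z| ≤ 1 + B := by
  have := M.markov h
  have h1 := norm_integral_le_of_norm_le_const (μ := M.p h z)
    (f := fun s => valueOf f s) (ae_of_all _ (abs_valueOf_le hB))
  have h2 : |∫ s, valueOf f s ∂(M.p h z)| ≤ B := by simpa using h1
  obtain ⟨h3, h4⟩ := M.R_mem h z
  exact (abs_add_le _ _).trans (add_le_add (abs_le.2 ⟨by linarith, h4⟩) h2)

theorem memCp_zero {d : ℕ} (ν : ℕ) : MemCp ν (0 : Cube d → ℝ) ∧ cNorm ν (0 : Cube d → ℝ) = 0 := by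
  have h0 : periodicExt (0 : Cube d → ℝ) = 0 := rfl
  have h1 : cNorm ν (0 : Cube d → ℝ) = 0 := by
    simp [cNorm, partialDeriv, h0]
  refine ⟨⟨fun z => rfl, ?_, ?_⟩, h1⟩
  · rw [h0]
    exact contDiff_const
  · rw [h1]
    exact ENNReal.zero_lt_top

theorem MDP.IsSmooth.measurable_reward {M : MDP dS dA H} {ν : ℕ} {CT : ℝ} (hM : M.IsSmooth ν CT)
    (h : Fin H) : Measurable (M.R h) := by
  have h1 : M.bellman h 0 = M.R h := by
    ext z
    simp [MDP.bellman, valueOf]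
  rw [← h1]
  exact ((hM h 0 (memCp_zero ν).1).1).continuous.measurable

theorem MDP.IsSmooth.measurable_bellman {M : MDP dS dA H} {ν : ℕ} {CT : ℝ}
    (hM : M.IsSmooth ν CT) (h : Fin H) {f : Cube (dS + dA) → ℝ} (hf : Continuous f) :
    Measurable (M.bellman h f) :=
  (hM.measurable_reward h).add
    ((continuous_valueOf hf).measurable.stronglyMeasurable.integral_kernel.measurable)

theorem MemCp.abs_le {d ν : ℕ} {f : Cube d → ℝ} (hf : MemCp ν f) {B : ℝ} (hB : 0 ≤ B)
    (h : cNorm ν f ≤ ENNReal.ofReal B) (z : Cube d) : |f z| ≤ B := by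
  rw [← hf.boundary z]
  exact (cNorm_le_iff hf.contDiff hB).1 h 0 (Nat.zero_le _) z.1

/-! ### Regularity and bias of the perturbed action-value functions -/

section

variable {M : MDP dS dA H} {ν : ℕ} {CT L : ℝ}

theorem MDP.Qstar_last (M : MDP dS dA H) : M.Qstar (Fin.last H) = 0 := by
  rw [MDP.Qstar, Fin.reverseInduction_last]; rfl

theorem MDP.Qstar_castSucc (M : MDP dS dA H) (h : Fin H) :
    M.Qstar h.castSucc = M.bellman h (M.Qstar h.succ) := by
  rw [MDP.Qstar, Fin.reverseInduction_castSucc]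

theorem MDP.Qtilde_last (M : MDP dS dA H) (N : ℕ) : M.Qtilde N (Fin.last H) = 0 := by
  rw [MDP.Qtilde, Fin.reverseInduction_last]; rfl

theorem MDP.Qtilde_castSucc (M : MDP dS dA H) (N : ℕ) (h : Fin H) :
    M.Qtilde N h.castSucc = circConv (vpKernel N) (M.bellman h (M.Qtilde N h.succ)) := by
  rw [MDP.Qtilde, Fin.reverseInduction_castSucc]

theorem MDP.IsSmooth.memCp_Qstar (hM : M.IsSmooth ν CT) (h : Fin (H + 1)) :
    MemCp ν (M.Qstar h) := by
  induction h using Fin.reverseInduction with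
  | last => rw [M.Qstar_last]; exact (memCp_zero ν).1
  | cast h ih => rw [M.Qstar_castSucc]; exact (hM h _ ih).1

theorem MDP.IsSmooth.cNorm_bellman_le (hM : M.IsSmooth ν CT) (h : Fin H)
    {f : Cube (dS + dA) → ℝ} (hf : MemCp ν f) {B : ℝ} (hB : 0 ≤ B)
    (hfB : cNorm ν f ≤ ENNReal.ofReal B) :
    cNorm ν (M.bellman h f) ≤ ENNReal.ofReal (max CT 1 * (B + 1)) := by
  refine (hM h f hf).2.trans ?_
  rw [ENNReal.ofReal_mul (by positivity), ENNReal.ofReal_add hB zero_le_one, ENNReal.ofReal_one]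
  gcongr
  exact le_max_left _ _

/-- The norm of `Q̃_h` is bounded by `x^k - 1`, where `x = 2CL` and `k` is the number of stages from
`h` on. The bound propagates since `L C ((x^k - 1) + 1) ≤ x^{k+1} - 1`. -/
theorem MDP.IsSmooth.memCp_Qtilde (hM : M.IsSmooth ν CT) (hL : IsVPBound (dS + dA) L) {N : ℕ}
    (hN0 : 0 < N) (hN : Even N) (h : Fin (H + 1)) :
    MemCp ν (M.Qtilde N h) ∧
      cNorm ν (M.Qtilde N h) ≤ ENNReal.ofReal ((2 * max CT 1 * L) ^ (H - (h : ℕ)) - 1) := by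
  have hL1 := hL.one_le
  have hC : 1 ≤ max CT 1 := le_max_right _ _
  have hCL : 1 ≤ max CT 1 * L := one_le_mul_of_one_le_of_one_le hC hL1
  induction h using Fin.reverseInduction with
  | last =>
    rw [M.Qtilde_last, (memCp_zero ν).2]
    exact ⟨(memCp_zero ν).1, zero_le⟩
  | cast h ih =>
    have hk : H - (h.castSucc : ℕ) = H - (h.succ : ℕ) + 1 := by
      have := h.2
      simp only [Fin.val_castSucc, Fin.val_succ]
      omega
    have hx : 1 ≤ (2 * max CT 1 * L) ^ (H - (h.succ : ℕ)) := one_le_pow₀ (by linarith)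
    have h1 := hM.cNorm_bellman_le h ih.1 (by linarith) ih.2
    have h2 := (hM h _ ih.1).1.circConv_vpKernel (by rw [sub_add_cancel]; positivity) h1
      (hL N hN0 hN)
    rw [M.Qtilde_castSucc]
    refine ⟨h2.1, h2.2.trans (ENNReal.ofReal_le_ofReal ?_)⟩
    rw [hk, pow_succ, sub_add_cancel]
    nlinarith

theorem MDP.IsSmooth.abs_Qtilde_le (hM : M.IsSmooth ν CT) (hL : IsVPBound (dS + dA) L) {N : ℕ}
    (hN0 : 0 < N) (hN : Even N) (h : Fin (H + 1)) (z : Cube (dS + dA)) :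
    |M.Qtilde N h z| ≤ (2 * max CT 1 * L) ^ H := by
  have hx : 1 ≤ 2 * max CT 1 * L := by nlinarith [hL.one_le, le_max_right CT 1]
  obtain ⟨h1, h2⟩ := hM.memCp_Qtilde hL hN0 hN h
  have h3 : 1 ≤ (2 * max CT 1 * L) ^ (H - (h : ℕ)) := one_le_pow₀ hx
  have h4 := h1.abs_le (by linarith) h2 z
  have h5 : (2 * max CT 1 * L) ^ (H - (h : ℕ)) ≤ (2 * max CT 1 * L) ^ H :=
    pow_le_pow_right₀ hx (Nat.sub_le _ _)
  linarith

/-- The bias. The operators `T_h` do not increase sup norms, so that the errors made when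
`T_h Q̃_{h+1}` is replaced by `D_N * T_h Q̃_{h+1}` add up. -/
theorem MDP.IsSmooth.abs_Qstar_sub_Qtilde_le (hM : M.IsSmooth ν CT)
    (hL : IsVPBound (dS + dA) L) (hd : 0 < dS + dA) {m : ℕ} (hm : 0 < m) (h : Fin (H + 1))
    (z : Cube (dS + dA)) :
    |M.Qstar h z - M.Qtilde (2 * ((dS + dA) * m)) h z| ≤ (H - (h : ℕ) : ℕ) *
      ((1 + L) * ((2 * max CT 1 * L) ^ H * ((dS + dA : ℕ) * (2 / m)) ^ (ν + 1))) := by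
  set N := 2 * ((dS + dA) * m) with hNdef
  have hN0 : 0 < N := by positivity
  have hN : Even N := even_two_mul _
  have hL1 := hL.one_le
  have hC : 1 ≤ max CT 1 := le_max_right _ _
  have hx : 1 ≤ 2 * max CT 1 * L := by nlinarith
  set J := (1 + L) * ((2 * max CT 1 * L) ^ H * ((dS + dA : ℕ) * (2 / m : ℝ)) ^ (ν + 1)) with hJ
  induction h using Fin.reverseInduction generalizing z with
  | last => simp [M.Qstar_last, M.Qtilde_last]
  | cast h ih =>
    obtain ⟨h1, h2⟩ := hM.memCp_Qtilde hL hN0 hN h.succ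
    have hk : H - (h.castSucc : ℕ) = H - (h.succ : ℕ) + 1 := by
      have := h.2
      simp only [Fin.val_castSucc, Fin.val_succ]
      omega
    have hx1 : 1 ≤ (2 * max CT 1 * L) ^ (H - (h.succ : ℕ)) := one_le_pow₀ hx
    have h3 : cNorm ν (M.bellman h (M.Qtilde N h.succ)) ≤
        ENNReal.ofReal ((2 * max CT 1 * L) ^ H) := by
      refine (hM.cNorm_bellman_le h h1 (by linarith) h2).trans (ENNReal.ofReal_le_ofReal ?_)
      rw [sub_add_cancel]
      calc max CT 1 * (2 * max CT 1 * L) ^ (H - (h.succ : ℕ))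
          ≤ (2 * max CT 1 * L) * (2 * max CT 1 * L) ^ (H - (h.succ : ℕ)) := by
            gcongr
            nlinarith
        _ = (2 * max CT 1 * L) ^ (H - (h.succ : ℕ) + 1) := by rw [pow_succ]; ring
        _ ≤ (2 * max CT 1 * L) ^ H := pow_le_pow_right₀ hx (by rw [← hk]; exact Nat.sub_le _ _)
    have h4 := (hM h _ h1).1.abs_circConv_sub_le hm (by positivity) h3 (hL N hN0 hN) z
    have h5 := M.abs_bellman_sub_le h (hM.memCp_Qstar h.succ).continuous h1.continuous ih z
    rw [M.Qstar_castSucc, M.Qtilde_castSucc, hk]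
    push_cast
    rw [add_one_mul]
    exact (abs_sub_le _ (M.bellman h (M.Qtilde N h.succ) z) _).trans (add_le_add h5 h4)

/-- Propagation of the regression errors: each stage multiplies the error by at most
`‖D_N‖_{L¹} ≤ L`. -/
theorem MDP.IsSmooth.abs_Qtilde_sub_le (hM : M.IsSmooth ν CT) (hL : IsVPBound (dS + dA) L)
    {N : ℕ} (hN0 : 0 < N) (hN : Even N) (Q : Fin (H + 1) → Cube (dS + dA) → ℝ)
    (hQ : ∀ h, Continuous (Q h)) (hlast : Q (Fin.last H) = 0) {τ : ℝ} (hτ : 0 ≤ τ) (k : Fin (H + 1))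
    (hstep : ∀ h : Fin H, k ≤ h.castSucc → ∀ z,
      |Q h.castSucc z - circConv (vpKernel N) (M.bellman h (Q h.succ)) z| ≤ τ)
    (z : Cube (dS + dA)) :
    |M.Qtilde N k z - Q k z| ≤ (H - (k : ℕ) : ℕ) * L ^ (H - (k : ℕ)) * τ := by
  have hL1 := hL.one_le
  induction k using Fin.reverseInduction generalizing z with
  | last => simp [M.Qtilde_last, hlast]
  | cast h ih =>
    have hk : H - (h.castSucc : ℕ) = H - (h.succ : ℕ) + 1 := by
      have := h.2
      simp only [Fin.val_castSucc, Fin.val_succ]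
      omega
    have ih := ih fun h' hh' => hstep h' ((Fin.castSucc_lt_succ (i := h)).le.trans hh')
    have hc := (hM.memCp_Qtilde hL hN0 hN h.succ).1.continuous
    set k := H - (h.succ : ℕ)
    set D := (k : ℝ) * L ^ k * τ
    have hint : ∀ f : Cube (dS + dA) → ℝ, Continuous f →
        Integrable fun y : Cube (dS + dA) => M.bellman h f y * vpKernel N (z.1 - y.1) := by
      intro f hf
      obtain ⟨B, hB⟩ := exists_abs_le_of_continuous hf
      exact integrable_mul_continuous
        (integrable_cube (hM.measurable_bellman h hf) (M.abs_bellman_le h hB))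
        (continuous_vpKernel N) z
    have h1 : |circConv (vpKernel N) (M.bellman h (M.Qtilde N h.succ)) z -
        circConv (vpKernel N) (M.bellman h (Q h.succ)) z| ≤ L * D := by
      have hsub : circConv (vpKernel N) (M.bellman h (M.Qtilde N h.succ)) z -
          circConv (vpKernel N) (M.bellman h (Q h.succ)) z =
          circConv (vpKernel N)
            (fun z => M.bellman h (M.Qtilde N h.succ) z - M.bellman h (Q h.succ) z) z := by
        simp only [circConv, sub_mul]
        rw [integral_sub (hint _ hc) (hint _ (hQ h.succ))]
      rw [hsub]
      exact abs_circConv_le (isPeriodic_vpKernel N) (continuous_vpKernel N)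
        ((hM.measurable_bellman h hc).sub (hM.measurable_bellman h (hQ h.succ)))
        (M.abs_bellman_sub_le h hc (hQ h.succ) ih) (hL N hN0 hN) z
    have h2 := hstep h le_rfl z
    rw [abs_sub_comm] at h2
    rw [M.Qtilde_castSucc, hk]
    refine (abs_sub_le _ (circConv (vpKernel N) (M.bellman h (Q h.succ)) z) _).trans
      ((add_le_add h1 h2).trans ?_)
    have h3 : 1 ≤ L ^ (k + 1) := one_le_pow₀ hL1
    have h4 : L * D = k * L ^ (k + 1) * τ := by simp only [D]; ring
    push_cast
    nlinarith

end

/-! ### Least squares -/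

open Matrix

/-- The Gram matrix `∑_j x_j x_jᵀ`. -/
def gram {I J : Type} [Fintype J] (x : J → I → ℝ) : Matrix I I ℝ := ∑ j, vecMulVec (x j) (x j)

theorem gram_mulVec {I J : Type} [Fintype I] [Fintype J] (x : J → I → ℝ) (u : I → ℝ) : gram x *ᵥ u = ∑ j, (x j ⬝ᵥ u) • x j := by
  rw [gram, sum_mulVec]
  refine Finset.sum_congr rfl fun j _ => ?_
  rw [vecMulVec_mulVec, op_smul_eq_smul]

theorem gram_transpose {I J : Type} [Fintype J] (x : J → I → ℝ) : (gram x)ᵀ = gram x := by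
  rw [gram, transpose_sum]
  exact Finset.sum_congr rfl fun j _ => transpose_vecMulVec _ _

theorem dotProduct_gram {I J : Type} [Fintype I] [Fintype J] (x : J → I → ℝ) (u : I → ℝ) :
    u ⬝ᵥ gram x *ᵥ u = ∑ j, (x j ⬝ᵥ u) ^ 2 :=
  dotProduct_sum_vecMulVec _ _ _

theorem dotProduct_mulVec_comm {I : Type} [Fintype I] {A : Matrix I I ℝ} (hA : Aᵀ = A)
    (u v : I → ℝ) : u ⬝ᵥ A *ᵥ v = v ⬝ᵥ A *ᵥ u := by
  rw [dotProduct_mulVec, ← mulVec_transpose, hA, dotProduct_comm]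

section

variable {I J : Type} [Fintype I] [DecidableEq I] [Fintype J] (x : J → I → ℝ)

/-- The normal equations. -/
theorem leastSquares_eq (hG : IsUnit (gram x).det) (y : J → ℝ) :
    leastSquares x y = (gram x)⁻¹ *ᵥ ∑ j, y j • x j := by
  set θ := (gram x)⁻¹ *ᵥ ∑ j, y j • x j with hθ
  have hnormal : ∑ j, (x j ⬝ᵥ θ - y j) • x j = 0 := by
    simp only [sub_smul, Finset.sum_sub_distrib, ← gram_mulVec, hθ]
    rw [mulVec_mulVec, mul_nonsing_inv _ hG, one_mulVec, sub_self]
  have hpyth : ∀ θ' : I → ℝ, ∑ j, (x j ⬝ᵥ θ' - y j) ^ 2 =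
      ∑ j, (x j ⬝ᵥ θ - y j) ^ 2 + ∑ j, (x j ⬝ᵥ (θ' - θ)) ^ 2 := by
    intro θ'
    have h0 : ∑ j, (x j ⬝ᵥ θ - y j) * (x j ⬝ᵥ (θ' - θ)) = 0 := by
      have := congrArg (fun v => v ⬝ᵥ (θ' - θ)) hnormal
      simpa only [sum_dotProduct, smul_dotProduct, smul_eq_mul, zero_dotProduct] using this
    have h1 : ∀ j, (x j ⬝ᵥ θ' - y j) ^ 2 = (x j ⬝ᵥ θ - y j) ^ 2 + (x j ⬝ᵥ (θ' - θ)) ^ 2 +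
        2 * ((x j ⬝ᵥ θ - y j) * (x j ⬝ᵥ (θ' - θ))) := fun j => by
      rw [dotProduct_sub]; ring
    simp only [h1, Finset.sum_add_distrib, ← Finset.mul_sum, h0, mul_zero, add_zero]
  have hspec := Classical.epsilon_spec (p := fun θ : I → ℝ => ∀ θ' : I → ℝ,
    ∑ j, (x j ⬝ᵥ θ - y j) ^ 2 ≤ ∑ j, (x j ⬝ᵥ θ' - y j) ^ 2) ⟨θ, fun θ' => by
      rw [hpyth θ']
      exact le_add_of_nonneg_right (Finset.sum_nonneg fun j _ => sq_nonneg _)⟩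
  change ∀ θ' : I → ℝ, ∑ j, (x j ⬝ᵥ leastSquares x y - y j) ^ 2 ≤ _ at hspec
  have h1 := hspec θ
  rw [hpyth (leastSquares x y)] at h1
  have h2 : ∑ j, (x j ⬝ᵥ (leastSquares x y - θ)) ^ 2 = 0 :=
    le_antisymm (by linarith) (Finset.sum_nonneg fun j _ => sq_nonneg _)
  have h3 : gram x *ᵥ (leastSquares x y - θ) = 0 := by
    rw [gram_mulVec]
    refine Finset.sum_eq_zero fun j hj => ?_
    have := (Finset.sum_eq_zero_iff_of_nonneg fun j _ => sq_nonneg _).1 h2 j hj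
    rw [pow_eq_zero_iff two_ne_zero] at this
    rw [this, zero_smul]
  have h4 := congrArg (fun v => (gram x)⁻¹ *ᵥ v) h3
  simp only [mulVec_mulVec, nonsing_inv_mul _ hG, one_mulVec, mulVec_zero] at h4
  exact sub_eq_zero.1 h4

theorem dotProduct_leastSquares_sub (hG : IsUnit (gram x).det) (y : J → ℝ) (φ θ : I → ℝ) :
    φ ⬝ᵥ leastSquares x y - φ ⬝ᵥ θ =
      ∑ j, (φ ⬝ᵥ (gram x)⁻¹ *ᵥ x j) * (y j - x j ⬝ᵥ θ) := by
  have h1 : θ = (gram x)⁻¹ *ᵥ ∑ j, (x j ⬝ᵥ θ) • x j := by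
    rw [← gram_mulVec, mulVec_mulVec, nonsing_inv_mul _ hG, one_mulVec]
  have h2 : φ ⬝ᵥ θ = φ ⬝ᵥ (gram x)⁻¹ *ᵥ ∑ j, (x j ⬝ᵥ θ) • x j := congrArg _ h1
  rw [leastSquares_eq x hG, h2, ← dotProduct_sub, ← mulVec_sub, ← Finset.sum_sub_distrib,
    mulVec_sum, dotProduct_sum]
  refine Finset.sum_congr rfl fun j _ => ?_
  rw [← sub_smul, mulVec_smul, dotProduct_smul, smul_eq_mul, mul_comm]

theorem sum_leverage_sq (hG : IsUnit (gram x).det) (φ : I → ℝ) :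
    ∑ j, (φ ⬝ᵥ (gram x)⁻¹ *ᵥ x j) ^ 2 = φ ⬝ᵥ (gram x)⁻¹ *ᵥ φ := by
  have hsym : ((gram x)⁻¹)ᵀ = (gram x)⁻¹ := by rw [transpose_nonsing_inv, gram_transpose]
  have h1 : ∀ j, φ ⬝ᵥ (gram x)⁻¹ *ᵥ x j = x j ⬝ᵥ (gram x)⁻¹ *ᵥ φ := fun j =>
    dotProduct_mulVec_comm hsym _ _
  simp only [h1]
  rw [← dotProduct_gram, mulVec_mulVec, mul_nonsing_inv _ hG, one_mulVec, dotProduct_comm]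

end

/-! ### Regression on a quasi-optimal design -/

section

variable {d N ntot : ℕ} {ρ : Design d}

/-- The features of the dataset of a stage. -/
def Design.sampleFeature (ρ : Design d) (N ntot : ℕ) (j : ρ.SampleIdx ntot) : FeatIdx d N → ℝ :=
  feature N j.1.1

theorem Design.covariance_transpose : (ρ.covariance N)ᵀ = ρ.covariance N := by
  rw [Design.covariance, Finsupp.sum, transpose_sum]
  exact Finset.sum_congr rfl fun z _ => by rw [transpose_smul, transpose_vecMulVec]

theorem Design.le_dotProduct_gram (u : FeatIdx d N → ℝ) :
    ntot * (u ⬝ᵥ ρ.covariance N *ᵥ u) ≤ u ⬝ᵥ gram (ρ.sampleFeature N ntot) *ᵥ u := by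
  rw [ρ.dotProduct_covariance, dotProduct_gram, Fintype.sum_sigma, Finset.mul_sum,
    ← Finset.sum_coe_sort ρ.weight.support]
  refine Finset.sum_le_sum fun z _ => ?_
  simp only [Design.sampleFeature, Finset.sum_const, Finset.card_univ, Fintype.card_fin,
    nsmul_eq_mul, ← mul_assoc]
  gcongr
  exact Nat.le_ceil _

theorem Design.covariance_mulVec_eq_zero {u : FeatIdx d N → ℝ}
    (hu : u ⬝ᵥ ρ.covariance N *ᵥ u ≤ 0) : ρ.covariance N *ᵥ u = 0 := by
  rw [ρ.dotProduct_covariance] at hu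
  have h0 : ∀ z ∈ ρ.weight.support, 0 ≤ ρ.weight z * (feature N z ⬝ᵥ u) ^ 2 := fun z _ =>
    mul_nonneg (ρ.nonneg z) (sq_nonneg _)
  have h1 := (Finset.sum_eq_zero_iff_of_nonneg h0).1 (le_antisymm hu (Finset.sum_nonneg h0))
  rw [Design.covariance, Finsupp.sum, sum_mulVec]
  refine Finset.sum_eq_zero fun z hz => ?_
  have h2 := (mul_eq_zero.1 (h1 z hz)).resolve_left (Finsupp.mem_support_iff.1 hz)
  rw [pow_eq_zero_iff two_ne_zero] at h2
  rw [smul_mulVec, vecMulVec_mulVec, h2]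
  simp

theorem Design.IsQuasiOptimal.isUnit_gram (hρ : ρ.IsQuasiOptimal N) (hn : 0 < ntot) :
    IsUnit (gram (ρ.sampleFeature N ntot)).det := by
  rw [← isUnit_iff_isUnit_det, ← mulVec_injective_iff_isUnit]
  refine (injective_iff_map_eq_zero (gram (ρ.sampleFeature N ntot)).mulVecLin).2 fun u hu => ?_
  rw [mulVecLin_apply] at hu
  have h1 := ρ.le_dotProduct_gram (ntot := ntot) u
  rw [hu, dotProduct_zero] at h1
  have hn' : (0 : ℝ) < ntot := by exact_mod_cast hn
  have h2 : ρ.covariance N *ᵥ u = 0 :=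
    ρ.covariance_mulVec_eq_zero (nonpos_of_mul_nonpos_right h1 hn')
  have h3 := congrArg (fun v => (ρ.covariance N)⁻¹ *ᵥ v) h2
  simpa only [mulVec_mulVec, nonsing_inv_mul _ hρ.invertible, one_mulVec, mulVec_zero] using h3

/-- The rounded design has a Gram matrix `G ≥ ntot Σ`; hence `G⁻¹ ≤ (ntot Σ)⁻¹`. -/
theorem Design.IsQuasiOptimal.leverage_le (hρ : ρ.IsQuasiOptimal N) (hn : 0 < ntot) (z : Cube d) :
    feature N z ⬝ᵥ (gram (ρ.sampleFeature N ntot))⁻¹ *ᵥ feature N z ≤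
      2 * numFeatures d N / ntot := by
  have hn' : (0 : ℝ) < ntot := by exact_mod_cast hn
  have hG := hρ.isUnit_gram hn
  set φ := feature N z
  set w := (gram (ρ.sampleFeature N ntot))⁻¹ *ᵥ φ with hw
  set v := (ρ.covariance N)⁻¹ *ᵥ φ with hv
  have hGw : gram (ρ.sampleFeature N ntot) *ᵥ w = φ := by
    rw [hw, mulVec_mulVec, mul_nonsing_inv _ hG, one_mulVec]
  have hSv : ρ.covariance N *ᵥ v = φ := by
    rw [hv, mulVec_mulVec, mul_nonsing_inv _ hρ.invertible, one_mulVec]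
  have h1 := ρ.le_dotProduct_gram (ntot := ntot) w
  rw [hGw, dotProduct_comm w φ] at h1
  have h2 : φ ⬝ᵥ v ≤ 2 * numFeatures d N := hρ.norm_le z
  have h3 : 0 ≤ ((ntot : ℝ) • w - v) ⬝ᵥ ρ.covariance N *ᵥ ((ntot : ℝ) • w - v) := by
    rw [ρ.dotProduct_covariance]
    exact Finset.sum_nonneg fun z _ => mul_nonneg (ρ.nonneg z) (sq_nonneg _)
  rw [mulVec_sub, mulVec_smul, hSv, sub_dotProduct, dotProduct_sub, dotProduct_sub, smul_dotProduct,
    smul_dotProduct, dotProduct_smul, dotProduct_smul, dotProduct_mulVec_comm ρ.covariance_transpose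
    v w, hSv, dotProduct_comm w φ, dotProduct_comm v φ] at h3
  simp only [smul_eq_mul] at h3
  rw [le_div_iff₀ hn']
  nlinarith

end

/-! ### A finite net for trigonometric polynomials -/

/-- The points of a regular grid of mesh `2/K` on the cube. -/
def gridPoint {d K : ℕ} (k : Fin d → Fin K) : Cube d :=
  ⟨fun i => -1 + (2 * (k i : ℕ) + 1) / K, fun i => by
    simp only [Pi.neg_apply, Pi.one_apply]
    have : (0 : ℝ) ≤ (2 * (k i : ℕ) + 1) / K := by positivity
    linarith, fun i => by
    simp only [Pi.one_apply]
    have hK : (0 : ℝ) < K := by exact_mod_cast (k i).pos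
    have h1 : ((k i : ℕ) : ℝ) + 1 ≤ K := by exact_mod_cast (k i).2
    have : (2 * (k i : ℕ) + 1) / (K : ℝ) ≤ 2 := by rw [div_le_iff₀ hK]; linarith
    linarith⟩

theorem exists_gridPoint_close {d K : ℕ} (hK : 0 < K) (x : Cube d) :
    ∃ k : Fin d → Fin K, ∀ i, |x.1 i - (gridPoint k).1 i| ≤ 1 / K := by
  have hK' : (0 : ℝ) < K := by exact_mod_cast hK
  have key : ∀ i, ∃ k : Fin K, |x.1 i - (-1 + (2 * (k : ℕ) + 1) / K)| ≤ 1 / (K : ℝ) := by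
    intro i
    have h1 : -1 ≤ x.1 i := x.2.1 i
    have h2 : x.1 i ≤ 1 := x.2.2 i
    set t := (x.1 i + 1) * K / 2 with ht
    have ht0 : 0 ≤ t := by
      have : 0 ≤ x.1 i + 1 := by linarith
      positivity
    have htK : t ≤ K := by rw [ht]; nlinarith
    have hx : x.1 i = -1 + 2 * t / K := by rw [ht]; field_simp; ring
    -- The last cell is closed, so that its right end point does not need a cell of its own.
    rcases htK.lt_or_eq with hlt | heq
    · refine ⟨⟨⌊t⌋₊, (Nat.floor_lt ht0).2 hlt⟩, ?_⟩
      have h3 := Nat.floor_le ht0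
      have h4 := Nat.lt_floor_add_one t
      have : x.1 i - (-1 + (2 * (⌊t⌋₊ : ℝ) + 1) / K) = (2 * t - (2 * ⌊t⌋₊ + 1)) / K := by
        rw [hx]; ring
      simp only
      rw [this, abs_div, abs_of_pos hK']
      gcongr
      exact abs_le.2 ⟨by linarith, by linarith⟩
    · refine ⟨⟨K - 1, by omega⟩, ?_⟩
      have h5 : ((K - 1 : ℕ) : ℝ) = K - 1 := by rw [Nat.cast_sub hK]; simp
      have : x.1 i - (-1 + (2 * ((K - 1 : ℕ) : ℝ) + 1) / K) = 1 / K := by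
        rw [hx, h5, heq]; field_simp; ring
      simp only
      rw [this, abs_of_pos (by positivity)]
  choose k hk using key
  exact ⟨k, hk⟩

/-- A trigonometric polynomial of degree `N` is controlled by its values on a grid: between a
point where `|P|` is largest and the nearest grid point, `P` varies by at most half of that
maximum. -/
theorem abs_le_of_abs_gridPoint_le {d N : ℕ} {P : (Fin d → ℝ) → ℝ}
    (hP : P ∈ trigSpan d N) {τ : ℝ} {K : ℕ} (hK0 : 0 < K) (hK : 7 * N * numFeatures d N ≤ K)
    (hτ : ∀ k : Fin d → Fin K, |P (gridPoint k).1| ≤ τ) (z : Cube d) : |P z.1| ≤ 2 * τ := by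
  have hcont : Continuous fun z : Cube d => |P z.1| :=
    ((continuous_of_mem_trigSpan hP).comp continuous_subtype_val).abs
  obtain ⟨x, -, hx⟩ := isCompact_univ.exists_isMaxOn Set.univ_nonempty hcont.continuousOn
  have hmax : ∀ z : Cube d, |P z.1| ≤ |P x.1| := fun z => hx (Set.mem_univ z)
  obtain ⟨k, hk⟩ := exists_gridPoint_close hK0 x
  have hK' : (0 : ℝ) < K := by exact_mod_cast hK0
  have h1 := abs_sub_le_of_mem_trigSpan hP hmax x (gridPoint k) (by positivity) hk
  have h2 : (numFeatures d N * (Real.pi * N * (1 / K)) : ℝ) ≤ 1 / 2 := by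
    have h3 : (7 * N * numFeatures d N : ℝ) ≤ K := by exact_mod_cast hK
    have h4 : Real.pi ≤ 7 / 2 := by linarith [Real.pi_lt_d2]
    have h5 : (0 : ℝ) ≤ N * numFeatures d N := by positivity
    rw [mul_one_div, ← mul_div_assoc, div_le_iff₀ hK']
    nlinarith
  have h6 : |P x.1| * (numFeatures d N * (Real.pi * N * (1 / K))) ≤ |P x.1| * (1 / 2) :=
    mul_le_mul_of_nonneg_left h2 (abs_nonneg _)
  have h7 := abs_sub_abs_le_abs_sub (P x.1) (P (gridPoint k).1)
  linarith [hmax z, hτ k]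

/-! ### The law of a regression target -/

section

variable {d N : ℕ}

theorem continuous_vpKernel_cube (d N : ℕ) : Continuous fun z : Cube d => vpKernel N z.1 :=
  (continuous_vpKernel N).comp continuous_subtype_val

/-- Normalization of a nonnegative continuous density. -/
theorem isProbabilityMeasure_withDensity_div {f : Cube d → ℝ} (hf : Continuous f)
    (hf0 : ∀ z, 0 ≤ f z) (hpos : 0 < ∫ z, f z) :
    IsProbabilityMeasure ((volume : Measure (Cube d)).withDensity
      fun z => ENNReal.ofReal (f z / ∫ z, f z)) := by
  refine ⟨?_⟩
  rw [withDensity_apply _ MeasurableSet.univ, Measure.restrict_univ,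
    ← ofReal_integral_eq_lintegral_ofReal ((integrable_cube_of_continuous hf).div_const _)
      (ae_of_all _ fun z => div_nonneg (hf0 z) hpos.le), integral_div, div_self hpos.ne',
    ENNReal.ofReal_one]

theorem integral_withDensity_div {f : Cube d → ℝ} (hf : Continuous f) (hf0 : ∀ z, 0 ≤ f z)
    (hpos : 0 < ∫ z, f z) (g : Cube d → ℝ) :
    (∫ z, f z) * ∫ z, g z ∂((volume : Measure (Cube d)).withDensity
      fun z => ENNReal.ofReal (f z / ∫ z, f z)) = ∫ z, g z * f z := by
  rw [integral_withDensity_eq_integral_toReal_smul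
    ((hf.div_const _).measurable.ennreal_ofReal) (ae_of_all _ fun _ => ENNReal.ofReal_lt_top),
    ← integral_const_mul]
  refine integral_congr_ae (ae_of_all _ fun z => ?_)
  simp only
  rw [ENNReal.toReal_ofReal (div_nonneg (hf0 z) hpos.le), smul_eq_mul]
  field_simp

theorem isProbabilityMeasure_noisePos (d : ℕ) (hN : Even N) :
    IsProbabilityMeasure (noisePos d N) :=
  isProbabilityMeasure_withDensity_div ((continuous_vpKernel_cube d N).max continuous_const)
    (fun _ => le_max_right _ _) (betaPos_pos d hN)

theorem isProbabilityMeasure_noiseNeg (hd : 0 < d) (hN0 : 0 < N) (hN : Even N) :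
    IsProbabilityMeasure (noiseNeg d N) :=
  isProbabilityMeasure_withDensity_div ((continuous_vpKernel_cube d N).neg.max continuous_const)
    (fun _ => le_max_right _ _) (betaNeg_pos hd hN0 hN)

theorem betaPos_mul_integral_noisePos (d : ℕ) (hN : Even N) (g : Cube d → ℝ) :
    betaPos d N * ∫ z, g z ∂(noisePos d N) = ∫ z, g z * max (vpKernel N z.1) 0 :=
  integral_withDensity_div ((continuous_vpKernel_cube d N).max continuous_const)
    (fun _ => le_max_right _ _) (betaPos_pos d hN) g

theorem betaNeg_mul_integral_noiseNeg (hd : 0 < d) (hN0 : 0 < N) (hN : Even N)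
    (g : Cube d → ℝ) :
    betaNeg d N * ∫ z, g z ∂(noiseNeg d N) = ∫ z, g z * max (-vpKernel N z.1) 0 :=
  integral_withDensity_div ((continuous_vpKernel_cube d N).neg.max continuous_const)
    (fun _ => le_max_right _ _) (betaNeg_pos hd hN0 hN) g

end

section

variable {dS dA H : ℕ} {M : MDP dS dA H} {ν N : ℕ} {CT L : ℝ}

theorem measurable_wrap_add {d : ℕ} (z : Cube d) :
    Measurable fun η : Cube d => wrap (z.1 + η.1) :=
  measurable_wrap.comp (measurable_const.add measurable_subtype_coe)

theorem MDP.isProbabilityMeasure_queryLaw (M : MDP dS dA H) (noise : Measure (Cube (dS + dA)))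
    [IsProbabilityMeasure noise] (h : Fin H) (z : Cube (dS + dA)) :
    IsProbabilityMeasure (M.queryLaw noise h z) := by
  have := M.markov h
  have := Measure.isProbabilityMeasure_map (μ := noise) (measurable_wrap_add z).aemeasurable
  rw [MDP.queryLaw]
  infer_instance

theorem MDP.measurable_reward_add {R : Cube (dS + dA) → ℝ} (hR : Measurable R)
    {f : Cube (dS + dA) → ℝ} (hf : Continuous f) :
    Measurable fun q : Cube (dS + dA) × Cube dS => R q.1 + valueOf f q.2 :=
  (hR.comp measurable_fst).add ((continuous_valueOf hf).measurable.comp measurable_snd)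

theorem MDP.abs_reward_add_le (M : MDP dS dA H) (h : Fin H) {f : Cube (dS + dA) → ℝ} {B : ℝ}
    (hB : ∀ z, |f z| ≤ B) (q : Cube (dS + dA) × Cube dS) :
    |M.R h q.1 + valueOf f q.2| ≤ 1 + B := by
  obtain ⟨h3, h4⟩ := M.R_mem h q.1
  exact (abs_add_le _ _).trans
    (add_le_add (abs_le.2 ⟨by linarith, h4⟩) (abs_valueOf_le hB q.2))

theorem MDP.IsSmooth.integrable_reward_add (hM : M.IsSmooth ν CT)
    (noise : Measure (Cube (dS + dA))) [IsProbabilityMeasure noise] (h : Fin H)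
    {f : Cube (dS + dA) → ℝ} (hf : Continuous f) (z : Cube (dS + dA)) :
    Integrable (fun q => M.R h q.1 + valueOf f q.2) (M.queryLaw noise h z) := by
  have := M.isProbabilityMeasure_queryLaw noise h z
  obtain ⟨B, hB⟩ := exists_abs_le_of_continuous hf
  exact Integrable.of_bound
    (MDP.measurable_reward_add (hM.measurable_reward h) hf).aestronglyMeasurable (1 + B)
    (ae_of_all _ (M.abs_reward_add_le h hB))

theorem MDP.IsSmooth.integral_queryLaw (hM : M.IsSmooth ν CT)
    (noise : Measure (Cube (dS + dA))) [IsProbabilityMeasure noise] (h : Fin H)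
    {f : Cube (dS + dA) → ℝ} (hf : Continuous f) (z : Cube (dS + dA)) :
    ∫ q, (M.R h q.1 + valueOf f q.2) ∂(M.queryLaw noise h z) =
      ∫ η, M.bellman h f (wrap (z.1 + η.1)) ∂noise := by
  have := M.markov h
  have hmap := Measure.isProbabilityMeasure_map (μ := noise) (measurable_wrap_add z).aemeasurable
  have h1 := hM.integrable_reward_add noise h hf z
  rw [MDP.queryLaw] at h1 ⊢
  rw [Measure.integral_compProd h1]
  have h2 : ∀ w, ∫ s, (M.R h w + valueOf f s) ∂(M.p h w) = M.bellman h f w := by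
    intro w
    rw [integral_add (integrable_const _)
      (M.integrable_of_continuous h w (continuous_valueOf hf))]
    simp [MDP.bellman]
  simp only [h2]
  exact integral_map (measurable_wrap_add z).aemeasurable
    (hM.measurable_bellman h hf).aestronglyMeasurable

theorem MDP.target_eq (M : MDP dS dA H) (h : Fin H) (V : Cube dS → ℝ) (q : QueryPair dS dA) :
    M.target N h V q = betaPos (dS + dA) N * (M.R h q.1.1 + V q.1.2) -
      betaNeg (dS + dA) N * (M.R h q.2.1 + V q.2.2) := by
  rw [MDP.target]
  ring

/-- The law of the two queries made for one element of a dataset. -/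
def MDP.pairLaw (M : MDP dS dA H) (N : ℕ) (h : Fin H) (z : Cube (dS + dA)) :
    Measure (QueryPair dS dA) :=
  (M.queryLaw (noisePos (dS + dA) N) h z).prod (M.queryLaw (noiseNeg (dS + dA) N) h z)

theorem MDP.isProbabilityMeasure_pairLaw (M : MDP dS dA H) (hd : 0 < dS + dA) (hN0 : 0 < N)
    (hN : Even N) (h : Fin H) (z : Cube (dS + dA)) : IsProbabilityMeasure (M.pairLaw N h z) := by
  have := isProbabilityMeasure_noisePos (dS + dA) hN
  have := isProbabilityMeasure_noiseNeg hd hN0 hN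
  have := M.isProbabilityMeasure_queryLaw (noisePos (dS + dA) N) h z
  have := M.isProbabilityMeasure_queryLaw (noiseNeg (dS + dA) N) h z
  rw [MDP.pairLaw]
  infer_instance

/-- The regression targets are unbiased for `D_N * T_h f`. -/
theorem MDP.IsSmooth.integral_target (hM : M.IsSmooth ν CT) (hd : 0 < dS + dA) (hN0 : 0 < N)
    (hN : Even N) (h : Fin H) {f : Cube (dS + dA) → ℝ} (hf : Continuous f) (z : Cube (dS + dA)) :
    ∫ q, M.target N h (valueOf f) q ∂(M.pairLaw N h z) =
      circConv (vpKernel N) (M.bellman h f) z := by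
  have := isProbabilityMeasure_noisePos (dS + dA) hN
  have := isProbabilityMeasure_noiseNeg hd hN0 hN
  have := M.isProbabilityMeasure_queryLaw (noisePos (dS + dA) N) h z
  have := M.isProbabilityMeasure_queryLaw (noiseNeg (dS + dA) N) h z
  have hmeas : Measurable fun η : Cube (dS + dA) => M.bellman h f (wrap (z.1 + η.1)) :=
    (hM.measurable_bellman h hf).comp (measurable_wrap_add z)
  obtain ⟨B, hB⟩ := exists_abs_le_of_continuous hf
  have hint : ∀ D : Cube (dS + dA) → ℝ, Continuous D →
      Integrable fun η : Cube (dS + dA) => M.bellman h f (wrap (z.1 + η.1)) * D η := by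
    intro D hD
    obtain ⟨A, hA⟩ := exists_abs_le_of_continuous hD
    refine (integrable_cube hmeas fun η => M.abs_bellman_le h hB _).mul_bdd
      hD.aestronglyMeasurable (ae_of_all _ hA)
  simp only [MDP.target_eq, MDP.pairLaw]
  have h1 := (hM.integrable_reward_add (noisePos (dS + dA) N) h hf z)
  have h2 := (hM.integrable_reward_add (noiseNeg (dS + dA) N) h hf z)
  rw [integral_sub ((h1.comp_fst _).const_mul _) ((h2.comp_snd _).const_mul _),
    integral_const_mul, integral_const_mul,
    integral_fun_fst (fun q : Cube (dS + dA) × Cube dS => M.R h q.1 + valueOf f q.2),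
    integral_fun_snd (fun q : Cube (dS + dA) × Cube dS => M.R h q.1 + valueOf f q.2),
    hM.integral_queryLaw _ h hf z, hM.integral_queryLaw _ h hf z]
  simp only [probReal_univ, one_smul]
  rw [betaPos_mul_integral_noisePos _ hN, betaNeg_mul_integral_noiseNeg hd hN0 hN,
    ← integral_sub (hint (fun z => max (vpKernel N z.1) 0)
        ((continuous_vpKernel_cube _ N).max continuous_const))
      (hint (fun z => max (-vpKernel N z.1) 0)
        ((continuous_vpKernel_cube _ N).neg.max continuous_const)),
    circConv_eq_add (isPeriodic_vpKernel N) (continuous_vpKernel N).measurable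
      (fun x => vpKernel_neg N x) (hM.measurable_bellman h hf)]
  refine integral_congr_ae (ae_of_all _ fun η => ?_)
  simp only
  rw [← mul_sub, max_zero_sub_max_neg_zero_eq_self]

theorem MDP.abs_target_le (M : MDP dS dA H) (hL : IsVPBound (dS + dA) L) (hN0 : 0 < N)
    (hN : Even N) (h : Fin H) {f : Cube (dS + dA) → ℝ} {B : ℝ} (hB : ∀ z, |f z| ≤ B)
    (q : QueryPair dS dA) : |M.target N h (valueOf f) q| ≤ L * (1 + B) := by
  have h1 := M.abs_reward_add_le h hB q.1
  have h2 := M.abs_reward_add_le h hB q.2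
  have h3 := (betaPos_pos (dS + dA) hN).le
  have h4 := betaNeg_nonneg (dS + dA) N
  have h5 := hL N hN0 hN
  rw [← betaPos_add_betaNeg] at h5
  rw [MDP.target_eq]
  refine (abs_sub _ _).trans ?_
  rw [abs_mul, abs_mul, abs_of_nonneg h3, abs_of_nonneg h4]
  have h6 : 0 ≤ 1 + B := (abs_nonneg _).trans h1
  nlinarith [mul_le_mul_of_nonneg_left h1 h3, mul_le_mul_of_nonneg_left h2 h4]

end

/-! ### Concentration of weighted sums -/

/-- Hoeffding's inequality for a weighted sum of independent bounded variables. -/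
theorem measure_pi_abs_weighted_sum_ge_le {J X : Type*} [Fintype J] [MeasurableSpace X]
    (μ : J → Measure X) [∀ j, IsProbabilityMeasure (μ j)] {Y : X → ℝ} (hY : Measurable Y) {A : ℝ}
    (hA : ∀ q, |Y q| ≤ A) (c : J → ℝ) {S τ : ℝ} (hS : (∑ j, c j ^ 2) * A ^ 2 ≤ S) (hτ : 0 ≤ τ) :
    Measure.pi μ {ω | τ ≤ |∑ j, c j * (Y (ω j) - ∫ q, Y q ∂(μ j))|} ≤
      ENNReal.ofReal (2 * Real.exp (-τ ^ 2 / (2 * S))) := by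
  have hS0 : 0 ≤ S := le_trans (mul_nonneg (Finset.sum_nonneg fun j _ => sq_nonneg _)
    (sq_nonneg _)) hS
  have key : ∀ c : J → ℝ, (∑ j, c j ^ 2) * A ^ 2 ≤ S →
      (Measure.pi μ).real {ω | τ ≤ ∑ j, c j * (Y (ω j) - ∫ q, Y q ∂(μ j))} ≤
        Real.exp (-τ ^ 2 / (2 * S)) := by
    intro c hc
    have hsub : ∀ j, HasSubgaussianMGF
        (fun ω : J → X => c j * (Y (ω j) - ∫ q, Y q ∂(μ j)))
        (⟨c j ^ 2, sq_nonneg _⟩ * (‖A - -A‖₊ / 2) ^ 2) (Measure.pi μ) := by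
      intro j
      have h1 : HasSubgaussianMGF (fun ω : J → X => Y (ω j) -
          ∫ ω' : J → X, Y (ω' j) ∂(Measure.pi μ)) ((‖A - -A‖₊ / 2) ^ 2) (Measure.pi μ) :=
        hasSubgaussianMGF_of_mem_Icc (hY.comp (measurable_pi_apply j)).aemeasurable
          (ae_of_all _ fun ω => abs_le.1 (hA (ω j)))
      have h2 : ∫ ω' : J → X, Y (ω' j) ∂(Measure.pi μ) = ∫ q, Y q ∂(μ j) := by
        have h3 := integral_map (μ := Measure.pi μ) (measurable_pi_apply j).aemeasurable
          (f := Y) hY.aestronglyMeasurable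
        rw [← h3, (measurePreserving_eval μ j).map_eq]
      rw [h2] at h1
      exact h1.const_mul (c j)
    have hind : iIndepFun (fun j (ω : J → X) => c j * (Y (ω j) - ∫ q, Y q ∂(μ j)))
        (Measure.pi μ) :=
      iIndepFun_pi (X := fun j q => c j * (Y q - ∫ q, Y q ∂(μ j)))
        fun j => ((hY.sub_const _).const_mul _).aemeasurable
    have hsum := HasSubgaussianMGF.sum_of_iIndepFun hind (s := Finset.univ) fun j _ => hsub j
    have hS' : HasSubgaussianMGF (fun ω : J → X => ∑ j, c j * (Y (ω j) - ∫ q, Y q ∂(μ j)))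
        ⟨S, hS0⟩ (Measure.pi μ) := by
      refine ⟨hsum.integrable_exp_mul, fun t => (hsum.mgf_le t).trans ?_⟩
      gcongr
      refine le_trans (le_of_eq ?_) hc
      push_cast
      rw [Finset.sum_mul]
      refine Finset.sum_congr rfl fun j _ => ?_
      change c j ^ 2 * (‖A - -A‖ / 2) ^ 2 = c j ^ 2 * A ^ 2
      rw [Real.norm_eq_abs, div_pow, sq_abs]
      ring
    exact hS'.measure_ge_le hτ
  have h1 := key c hS
  have h2 := key (fun j => -c j) (by simpa using hS)
  have hsub : {ω : J → X | τ ≤ |∑ j, c j * (Y (ω j) - ∫ q, Y q ∂(μ j))|} ⊆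
      {ω | τ ≤ ∑ j, c j * (Y (ω j) - ∫ q, Y q ∂(μ j))} ∪
        {ω | τ ≤ ∑ j, -c j * (Y (ω j) - ∫ q, Y q ∂(μ j))} := by
    intro ω hω
    rw [Set.mem_ofPred_eq] at hω
    rcases le_abs.1 hω with h | h
    · exact Or.inl h
    · right
      simpa only [Set.mem_ofPred_eq, neg_mul, Finset.sum_neg_distrib] using h
  refine (measure_mono hsub).trans ((measure_union_le _ _).trans ?_)
  rw [← ofReal_measureReal, ← ofReal_measureReal, ← ENNReal.ofReal_add measureReal_nonneg
    measureReal_nonneg]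
  exact ENNReal.ofReal_le_ofReal (by linarith)

/-! ### The estimates as measurable functions of the data -/

section

variable {dS dA H : ℕ} {M : MDP dS dA H} {ν N ntot : ℕ} {CT L : ℝ} {ρ : Design (dS + dA)}

/-- The linear combination of the features with coefficients `θ`. It is irreducible in order that
unification does not unfold the sum over the features. -/
@[irreducible]
def linQ {d : ℕ} (N : ℕ) (θ : FeatIdx d N → ℝ) (z : Cube d) : ℝ := feature N z ⬝ᵥ θ

theorem continuous_feature {d N : ℕ} (n : FeatIdx d N) :
    Continuous fun z : Cube d => feature N z n := by
  have h : (fun z : Cube d => feature N z n) = fun z => (normFactor n.1)⁻¹ * basisFn n.1 z.1 := by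
    ext z
    rw [basisFn_eq_feature, inv_mul_cancel_left₀ (normFactor_pos n.1).ne']
  rw [h]
  exact continuous_const.mul ((contDiff_basisFn n.1).continuous.comp continuous_subtype_val)

theorem continuous_linQ_uncurry {d N : ℕ} :
    Continuous fun p : (FeatIdx d N → ℝ) × Cube d => linQ N p.1 p.2 := by
  simp only [linQ, dotProduct]
  exact continuous_finsetSum _ fun n _ => ((continuous_feature n).comp continuous_snd).mul
    ((continuous_apply n).comp continuous_fst)

theorem continuous_linQ {d N : ℕ} (θ : FeatIdx d N → ℝ) : Continuous (linQ N θ) := by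
  have h : Continuous fun z : Cube d => (θ, z) := by fun_prop
  exact continuous_linQ_uncurry.comp h

theorem continuous_linQ_left {d N : ℕ} (z : Cube d) :
    Continuous fun θ : FeatIdx d N → ℝ => linQ N θ z := by
  have h : Continuous fun θ : FeatIdx d N → ℝ => (θ, z) := by fun_prop
  exact continuous_linQ_uncurry.comp h

theorem continuous_valueOf_linQ :
    Continuous fun p : (FeatIdx (dS + dA) N → ℝ) × Cube dS => valueOf (linQ N p.1) p.2 := by
  have h0 : Continuous fun r : ((FeatIdx (dS + dA) N → ℝ) × Cube dS) × Cube dA =>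
      pair r.1.2 r.2 := by
    have : Continuous fun r : ((FeatIdx (dS + dA) N → ℝ) × Cube dS) × Cube dA =>
      (r.1.2, r.2) := by fun_prop
    exact continuous_pair.comp this
  have h1 : Continuous fun r : ((FeatIdx (dS + dA) N → ℝ) × Cube dS) × Cube dA =>
      (r.1.1, pair r.1.2 r.2) := by fun_prop
  have h := isCompact_univ.continuous_sSup
    (f := fun (p : (FeatIdx (dS + dA) N → ℝ) × Cube dS) (a : Cube dA) => linQ N p.1 (pair p.2 a))
    (continuous_linQ_uncurry.comp h1)
  simp only [Set.image_univ] at h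
  exact h

theorem MDP.IsSmooth.measurable_target (hM : M.IsSmooth ν CT) (h : Fin H) :
    Measurable fun p : (FeatIdx (dS + dA) N → ℝ) × QueryPair dS dA =>
      M.target N h (valueOf (linQ N p.1)) p.2 := by
  have hR := hM.measurable_reward h
  have hV : Measurable fun p : (FeatIdx (dS + dA) N → ℝ) × Cube dS => valueOf (linQ N p.1) p.2 :=
    continuous_valueOf_linQ.measurable
  have h1 : Measurable fun p : (FeatIdx (dS + dA) N → ℝ) × QueryPair dS dA =>
      (p.1, p.2.1.2) := by fun_prop
  have h2 : Measurable fun p : (FeatIdx (dS + dA) N → ℝ) × QueryPair dS dA =>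
      (p.1, p.2.2.2) := by fun_prop
  have h1' := hV.comp h1
  have h2' := hV.comp h2
  have h3 : Measurable fun p : (FeatIdx (dS + dA) N → ℝ) × QueryPair dS dA => M.R h p.2.1.1 := by
    fun_prop
  have h4 : Measurable fun p : (FeatIdx (dS + dA) N → ℝ) × QueryPair dS dA => M.R h p.2.2.1 := by
    fun_prop
  exact ((h3.const_mul _).sub (h4.const_mul _)).add ((h1'.const_mul _).sub (h2'.const_mul _))

/-- The coefficients computed at stage `h` from those of the next stage and from the outcomes of
the queries. It is irreducible for the same reason as `linQ`. -/
@[irreducible]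
def MDP.stageFit (M : MDP dS dA H) (N ntot : ℕ) (ρ : Design (dS + dA)) (h : Fin H)
    (θ : FeatIdx (dS + dA) N → ℝ) (y : ρ.SampleIdx ntot → QueryPair dS dA) :
    FeatIdx (dS + dA) N → ℝ :=
  leastSquares (ρ.sampleFeature N ntot) fun j => M.target N h (valueOf (linQ N θ)) (y j)

theorem MDP.IsSmooth.measurable_stageFit (hM : M.IsSmooth ν CT) (hρ : ρ.IsQuasiOptimal N)
    (hn : 0 < ntot) (h : Fin H) :
    Measurable fun p : (FeatIdx (dS + dA) N → ℝ) × (ρ.SampleIdx ntot → QueryPair dS dA) =>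
      M.stageFit N ntot ρ h p.1 p.2 := by
  simp only [MDP.stageFit, leastSquares_eq _ (hρ.isUnit_gram hn)]
  refine measurable_pi_iff.2 fun i => ?_
  simp only [mulVec, dotProduct, Finset.sum_apply, Pi.smul_apply, smul_eq_mul]
  refine Finset.measurable_sum _ fun k _ => Measurable.const_mul ?_ _
  refine Finset.measurable_sum _ fun j _ => Measurable.mul_const ?_ _
  exact (hM.measurable_target h).comp
    (measurable_fst.prodMk ((measurable_pi_apply j).comp measurable_snd))

/-- The coefficients `θ̂_h` that the algorithm computes. -/
def MDP.thetaHat (M : MDP dS dA H) (N ntot : ℕ) (ρ : Design (dS + dA))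
    (ω : Fin H → ρ.SampleIdx ntot → QueryPair dS dA) : Fin (H + 1) → FeatIdx (dS + dA) N → ℝ :=
  Fin.reverseInduction (motive := fun _ => FeatIdx (dS + dA) N → ℝ) 0
    fun h θ => M.stageFit N ntot ρ h θ (ω h)

theorem MDP.thetaHat_last (ω : Fin H → ρ.SampleIdx ntot → QueryPair dS dA) :
    M.thetaHat N ntot ρ ω (Fin.last H) = 0 := by
  rw [MDP.thetaHat, Fin.reverseInduction_last]

theorem MDP.thetaHat_castSucc (ω : Fin H → ρ.SampleIdx ntot → QueryPair dS dA) (h : Fin H) :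
    M.thetaHat N ntot ρ ω h.castSucc =
      M.stageFit N ntot ρ h (M.thetaHat N ntot ρ ω h.succ) (ω h) := by
  rw [MDP.thetaHat, Fin.reverseInduction_castSucc]

theorem MDP.Qhat_eq (ω : Fin H → ρ.SampleIdx ntot → QueryPair dS dA) (k : Fin (H + 1)) :
    M.Qhat N ntot ρ ω k = linQ N (M.thetaHat N ntot ρ ω k) := by
  induction k using Fin.reverseInduction with
  | last =>
    rw [M.thetaHat_last, MDP.Qhat, Fin.reverseInduction_last]
    ext z
    simp [linQ]
  | cast h ih =>
    rw [MDP.Qhat] at ih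
    rw [M.thetaHat_castSucc, MDP.Qhat, Fin.reverseInduction_castSucc, ih]
    ext z
    rw [linQ, MDP.stageFit]
    rfl

theorem MDP.IsSmooth.measurable_thetaHat (hM : M.IsSmooth ν CT) (hρ : ρ.IsQuasiOptimal N)
    (hn : 0 < ntot) (k : Fin (H + 1)) :
    Measurable fun ω : Fin H → ρ.SampleIdx ntot → QueryPair dS dA => M.thetaHat N ntot ρ ω k := by
  induction k using Fin.reverseInduction with
  | last => simp only [M.thetaHat_last]; exact measurable_const
  | cast h ih =>
    simp only [M.thetaHat_castSucc]
    have h1 : Measurable fun ω : Fin H → ρ.SampleIdx ntot → QueryPair dS dA =>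
        (M.thetaHat N ntot ρ ω h.succ, ω h) := ih.prodMk (measurable_pi_apply h)
    exact (hM.measurable_stageFit hρ hn h).comp h1

/-- The coefficients of the later stages do not depend on the data of stage `h`. -/
theorem MDP.thetaHat_update (ω : Fin H → ρ.SampleIdx ntot → QueryPair dS dA) (h : Fin H)
    (y : ρ.SampleIdx ntot → QueryPair dS dA) (k : Fin (H + 1)) (hk : h.castSucc < k) :
    M.thetaHat N ntot ρ (Function.update ω h y) k = M.thetaHat N ntot ρ ω k := by
  induction k using Fin.reverseInduction with
  | last => rw [M.thetaHat_last, M.thetaHat_last]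
  | cast h' ih =>
    have hne : h' ≠ h := by rintro rfl; exact lt_irrefl _ hk
    rw [M.thetaHat_castSucc, M.thetaHat_castSucc, ih (hk.trans Fin.castSucc_lt_succ),
      Function.update_of_ne hne]

/-! ### Concentration of the regression errors -/

/-- Fubini's theorem for a product of probability measures, with one coordinate singled out. -/
theorem measure_pi_le_of_update {ι : Type*} [Fintype ι] [DecidableEq ι] {X : ι → Type*}
    [∀ i, MeasurableSpace (X i)] (μ : ∀ i, Measure (X i)) [∀ i, IsProbabilityMeasure (μ i)]
    {s : Set (∀ i, X i)} (hs : MeasurableSet s) (i : ι) {c : ℝ≥0∞}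
    (hc : ∀ x, μ i {y | Function.update x i y ∈ s} ≤ c) : Measure.pi μ s ≤ c := by
  have hind : Measurable (s.indicator fun _ => (1 : ℝ≥0∞)) := measurable_const.indicator hs
  have hne : Nonempty (∀ i, X i) := by
    have := fun i => (inferInstance : NeZero (μ i))
    exact ⟨fun i => (nonempty_of_isProbabilityMeasure (μ i)).some⟩
  obtain ⟨x⟩ := hne
  have h1 : ∫⋯∫⁻_{i}, s.indicator (fun _ => (1 : ℝ≥0∞)) ∂μ ≤ fun _ => c := by
    rw [lmarginal_singleton]
    intro x
    refine le_trans (le_of_eq ?_) (hc x)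
    change _ = μ i (Function.update x i ⁻¹' s)
    rw [← lintegral_indicator_one (measurable_update x hs)]
    rfl
  have h2 : (Finset.univ : Finset ι) = (Finset.univ.erase i) ∪ {i} := by
    ext j
    simp
  rw [← lintegral_indicator_one hs, lintegral_eq_lmarginal_univ x]
  change (∫⋯∫⁻_Finset.univ, s.indicator (fun _ => (1 : ℝ≥0∞)) ∂μ) x ≤ c
  rw [h2, lmarginal_union μ _ hind (by simp)]
  refine (lmarginal_mono h1 x).trans (le_of_eq ?_)
  simp [lmarginal]

/-- The regression error, at the point `g`, of the fit of stage `h` on the targets that are built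
from the coefficients `θ`. -/
def MDP.fitError (M : MDP dS dA H) (N ntot : ℕ) (ρ : Design (dS + dA)) (h : Fin H)
    (g : Cube (dS + dA)) (θ : FeatIdx (dS + dA) N → ℝ)
    (y : ρ.SampleIdx ntot → QueryPair dS dA) : ℝ :=
  linQ N (M.stageFit N ntot ρ h θ y) g - circConv (vpKernel N) (M.bellman h (linQ N θ)) g

theorem MDP.IsSmooth.measurable_fitError (hM : M.IsSmooth ν CT) (hd : 0 < dS + dA) (hN0 : 0 < N)
    (hN : Even N) (hρ : ρ.IsQuasiOptimal N) (hn : 0 < ntot) (h : Fin H) (g : Cube (dS + dA)) :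
    Measurable fun p : (FeatIdx (dS + dA) N → ℝ) × (ρ.SampleIdx ntot → QueryPair dS dA) =>
      M.fitError N ntot ρ h g p.1 p.2 := by
  have := M.isProbabilityMeasure_pairLaw hd hN0 hN h g
  have h1 : Measurable fun θ : FeatIdx (dS + dA) N → ℝ =>
      circConv (vpKernel N) (M.bellman h (linQ N θ)) g := by
    simp only [← hM.integral_target hd hN0 hN h (continuous_linQ _) g]
    exact (StronglyMeasurable.integral_prod_right (ν := M.pairLaw N h g)
      (f := fun θ q => M.target N h (valueOf (linQ N θ)) q)
      (hM.measurable_target h).stronglyMeasurable).measurable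
  have h2 : Measurable fun θ : FeatIdx (dS + dA) N → ℝ => linQ N θ g :=
    (continuous_linQ_left g).measurable
  exact (h2.comp (hM.measurable_stageFit hρ hn h)).sub (h1.comp measurable_fst)

/-- `D_N * T_h f` is a trigonometric polynomial of degree `N`, hence the linear model is exact. The
error at `g` is a weighted sum of the centered targets, and the squares of the weights add up to
the leverage of `g`. -/
theorem MDP.IsSmooth.measure_fitError_ge_le (hM : M.IsSmooth ν CT)
    (hL : IsVPBound (dS + dA) L) (hd : 0 < dS + dA) (hN0 : 0 < N)
    (hN : Even N) (hρ : ρ.IsQuasiOptimal N) (hn : 0 < ntot) (h : Fin H) (g : Cube (dS + dA))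
    {θ : FeatIdx (dS + dA) N → ℝ} {B τ : ℝ} (hB : ∀ z, |linQ N θ z| ≤ B) (hτ : 0 ≤ τ) :
    (Measure.pi fun j : ρ.SampleIdx ntot => M.pairLaw N h j.1.1)
        {y | τ ≤ |M.fitError N ntot ρ h g θ y|} ≤
      ENNReal.ofReal (2 * Real.exp
        (-τ ^ 2 / (2 * (2 * numFeatures (dS + dA) N / ntot * (L * (1 + B)) ^ 2)))) := by
  have := fun z => M.isProbabilityMeasure_pairLaw hd hN0 hN h z
  have hG := hρ.isUnit_gram hn
  obtain ⟨A, hA⟩ := exists_abs_le_of_continuous (continuous_linQ θ)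
  obtain ⟨P, hP, hPc⟩ := circConv_vpKernel_mem N
    (integrable_cube (hM.measurable_bellman h (continuous_linQ θ)) (M.abs_bellman_le h hA))
  obtain ⟨θ₀, hθ₀⟩ := exists_feature_of_mem_trigSpan hP
  have herr : ∀ y : ρ.SampleIdx ntot → QueryPair dS dA, M.fitError N ntot ρ h g θ y =
      ∑ j, (feature N g ⬝ᵥ (gram (ρ.sampleFeature N ntot))⁻¹ *ᵥ ρ.sampleFeature N ntot j) *
        (M.target N h (valueOf (linQ N θ)) (y j) -
          ∫ q, M.target N h (valueOf (linQ N θ)) q ∂(M.pairLaw N h j.1.1)) := by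
    intro y
    rw [MDP.fitError, hPc, hθ₀, linQ, MDP.stageFit, dotProduct_leastSquares_sub _ hG]
    refine Finset.sum_congr rfl fun j _ => ?_
    rw [hM.integral_target hd hN0 hN h (continuous_linQ θ), hPc, hθ₀]
    rfl
  simp only [herr]
  refine measure_pi_abs_weighted_sum_ge_le _
    ((hM.measurable_target h).comp measurable_prodMk_left)
    (M.abs_target_le hL hN0 hN h hB) _ ?_ hτ
  rw [sum_leverage_sq _ hG]
  gcongr
  exact hρ.leverage_le hn g

/-- With high probability, every stage whose targets are built from a function bounded by `B` has
a uniformly small regression error. -/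
theorem MDP.IsSmooth.dataLaw_le (hM : M.IsSmooth ν CT) (hL : IsVPBound (dS + dA) L)
    (hd : 0 < dS + dA) (hN0 : 0 < N) (hN : Even N) (hρ : ρ.IsQuasiOptimal N) (hn : 0 < ntot)
    (hm : 0 < numFeatures (dS + dA) N) {B τ : ℝ} (hτ : 0 ≤ τ) :
    M.dataLaw N ntot ρ {ω | ¬ ∀ h : Fin H, (∀ z, |M.Qhat N ntot ρ ω h.succ z| ≤ B) →
      ∀ z, |M.Qhat N ntot ρ ω h.castSucc z -
        circConv (vpKernel N) (M.bellman h (M.Qhat N ntot ρ ω h.succ)) z| ≤ 2 * τ} ≤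
      ENNReal.ofReal (H * ((7 * N * numFeatures (dS + dA) N) ^ (dS + dA) * (2 * Real.exp
        (-τ ^ 2 / (2 * (2 * numFeatures (dS + dA) N / ntot * (L * (1 + B)) ^ 2)))))) := by
  set p := 2 * Real.exp
    (-τ ^ 2 / (2 * (2 * numFeatures (dS + dA) N / ntot * (L * (1 + B)) ^ 2))) with hp
  set K := 7 * N * numFeatures (dS + dA) N with hK
  have hK0 : 0 < K := by positivity
  have hlaw := fun h z => M.isProbabilityMeasure_pairLaw hd hN0 hN h z
  set bad : Fin H → (Fin (dS + dA) → Fin K) → Set (Fin H → ρ.SampleIdx ntot → QueryPair dS dA) :=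
    fun h k => {ω | (∀ z, |linQ N (M.thetaHat N ntot ρ ω h.succ) z| ≤ B) ∧
      τ ≤ |M.fitError N ntot ρ h (gridPoint k) (M.thetaHat N ntot ρ ω h.succ) (ω h)|} with hbad
  have hmeas : ∀ h k, MeasurableSet (bad h k) := by
    intro h k
    have h1 := hM.measurable_thetaHat hρ hn h.succ
    have h2 : IsClosed {θ : FeatIdx (dS + dA) N → ℝ | ∀ z, |linQ N θ z| ≤ B} := by
      simp only [Set.ofPred_forall]
      exact isClosed_iInter fun z => isClosed_le
        (continuous_linQ_left z).abs continuous_const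
    refine (h1 h2.measurableSet).inter ?_
    exact measurableSet_le measurable_const
      ((hM.measurable_fitError hd hN0 hN hρ hn h (gridPoint k)).comp
        (h1.prodMk (measurable_pi_apply h))).abs
  have hslice : ∀ h k, M.dataLaw N ntot ρ (bad h k) ≤ ENNReal.ofReal p := by
    intro h k
    refine measure_pi_le_of_update
      (fun h => Measure.pi fun j : ρ.SampleIdx ntot => M.pairLaw N h j.1.1) (hmeas h k) h fun ω => ?_
    have hup : ∀ y, M.thetaHat N ntot ρ (Function.update ω h y) h.succ =
        M.thetaHat N ntot ρ ω h.succ := fun y =>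
      M.thetaHat_update ω h y h.succ Fin.castSucc_lt_succ
    by_cases hb : ∀ z, |linQ N (M.thetaHat N ntot ρ ω h.succ) z| ≤ B
    · refine (measure_mono fun y hy => ?_).trans
        (hM.measure_fitError_ge_le hL hd hN0 hN hρ hn h (gridPoint k) hb hτ)
      have := hy.2
      rwa [hup, Function.update_self] at this
    · refine (measure_mono_null (t := ∅) (fun y hy => hb ?_) measure_empty).le.trans zero_le
      have := hy.1
      rwa [hup] at this
  have hcover : {ω | ¬ ∀ h : Fin H, (∀ z, |M.Qhat N ntot ρ ω h.succ z| ≤ B) →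
      ∀ z, |M.Qhat N ntot ρ ω h.castSucc z -
        circConv (vpKernel N) (M.bellman h (M.Qhat N ntot ρ ω h.succ)) z| ≤ 2 * τ} ⊆
      ⋃ h, ⋃ k, bad h k := by
    intro ω hω
    by_contra hnot
    simp only [Set.mem_iUnion, not_exists] at hnot
    refine hω fun h hb z => ?_
    simp only [M.Qhat_eq] at hb ⊢
    have hg : ∀ k, |M.fitError N ntot ρ h (gridPoint k)
        (M.thetaHat N ntot ρ ω h.succ) (ω h)| ≤ τ := fun k =>
      (not_le.1 fun hk => hnot h k ⟨hb, hk⟩).le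
    set θ := M.thetaHat N ntot ρ ω h.succ
    obtain ⟨P, hP, hPc⟩ := circConv_vpKernel_mem N
      (integrable_cube (hM.measurable_bellman h (continuous_linQ θ)) (M.abs_bellman_le h hb))
    obtain ⟨P', hP', hPc'⟩ := exists_trigSpan_feature (M.stageFit N ntot ρ h θ (ω h))
    have heq : ∀ z, M.fitError N ntot ρ h z θ (ω h) = (P' - P) z.1 := by
      intro z
      rw [MDP.fitError, hPc, Pi.sub_apply, hPc', linQ]
    have := abs_le_of_abs_gridPoint_le (Submodule.sub_mem _ hP' hP) hK0 le_rfl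
      (fun k => by rw [← heq]; exact hg k) z
    rw [← heq, MDP.fitError] at this
    rwa [M.thetaHat_castSucc]
  refine (measure_mono hcover).trans ((measure_iUnion_fintype_le _ _).trans ?_)
  refine (Finset.sum_le_sum fun h _ => (measure_iUnion_fintype_le _ _).trans
    (Finset.sum_le_sum fun k _ => hslice h k)).trans (le_of_eq ?_)
  simp only [Finset.sum_const, Finset.card_univ, Fintype.card_fin, Fintype.card_pi,
    Finset.prod_const, nsmul_eq_mul]
  rw [← ENNReal.ofReal_natCast, ← ENNReal.ofReal_natCast, ← ENNReal.ofReal_mul (by positivity),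
    ← ENNReal.ofReal_mul (by positivity), hK]
  push_cast
  rfl

end

/-! ### Uniform accuracy of the algorithm -/

section

variable {dS dA H : ℕ} {M : MDP dS dA H} {ν ntot : ℕ} {CT L : ℝ} {ρ : Design (dS + dA)}

theorem supDist_lt {d : ℕ} {f g : Cube d → ℝ} {a b : ℝ} (h : ∀ z, |f z - g z| ≤ a) (hab : a < b) :
    supDist f g < ENNReal.ofReal b := by
  obtain ⟨z⟩ := nonempty_cube d
  have ha : 0 ≤ a := (abs_nonneg _).trans (h z)
  refine lt_of_le_of_lt (iSup_le fun z => ?_)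
    ((ENNReal.ofReal_lt_ofReal_iff (ha.trans_lt hab)).2 hab)
  rw [enorm_le_ofReal_iff ha]
  exact h z

/-- On the event of small regression errors, the estimates of all the stages are accurate. The
bound on the estimate of stage `h + 1`, which enters the range of the targets of stage `h`, comes
from its accuracy. -/
theorem MDP.IsSmooth.abs_sub_Qhat_le {N : ℕ} (hM : M.IsSmooth ν CT) (hL : IsVPBound (dS + dA) L)
    (hN0 : 0 < N) (hN : Even N) {η τ : ℝ} (hτ : 0 ≤ τ) (hη : η ≤ 1) (hτη : H * L ^ H * τ ≤ η)
    (ω : Fin H → ρ.SampleIdx ntot → QueryPair dS dA)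
    (hω : ∀ h : Fin H,
      (∀ z, |M.Qhat N ntot ρ ω h.succ z| ≤ (2 * max CT 1 * L) ^ H + 1) →
      ∀ z, |M.Qhat N ntot ρ ω h.castSucc z -
        circConv (vpKernel N) (M.bellman h (M.Qhat N ntot ρ ω h.succ)) z| ≤ τ)
    (k : Fin (H + 1)) (z : Cube (dS + dA)) :
    |M.Qtilde N k z - M.Qhat N ntot ρ ω k z| ≤ η := by
  have hL1 := hL.one_le
  have hcont : ∀ k, Continuous (M.Qhat N ntot ρ ω k) := fun k => by
    rw [M.Qhat_eq]
    exact continuous_linQ _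
  have hlast : M.Qhat N ntot ρ ω (Fin.last H) = 0 := by
    rw [MDP.Qhat, Fin.reverseInduction_last]
    rfl
  have hacc : ∀ k : Fin (H + 1), (∀ h : Fin H, k ≤ h.castSucc → ∀ z,
      |M.Qhat N ntot ρ ω h.castSucc z -
        circConv (vpKernel N) (M.bellman h (M.Qhat N ntot ρ ω h.succ)) z| ≤ τ) →
      ∀ z, |M.Qtilde N k z - M.Qhat N ntot ρ ω k z| ≤ η := by
    intro k hk z
    refine (hM.abs_Qtilde_sub_le hL hN0 hN _ hcont hlast hτ k hk z).trans (le_trans ?_ hτη)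
    have h1 : L ^ (H - (k : ℕ)) ≤ L ^ H := pow_le_pow_right₀ hL1 (Nat.sub_le _ _)
    have h2 : ((H - (k : ℕ) : ℕ) : ℝ) ≤ H := by exact_mod_cast Nat.sub_le _ _
    gcongr
  have hall : ∀ k : Fin (H + 1), ∀ h : Fin H, k ≤ h.castSucc → ∀ z,
      |M.Qhat N ntot ρ ω h.castSucc z -
        circConv (vpKernel N) (M.bellman h (M.Qhat N ntot ρ ω h.succ)) z| ≤ τ := by
    intro k
    induction k using Fin.reverseInduction with
    | last => exact fun h hh => absurd hh (not_le.2 (Fin.castSucc_lt_last h))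
    | cast h ih =>
      intro h' hh'
      rcases (Fin.castSucc_le_castSucc_iff.1 hh').eq_or_lt with rfl | hlt
      · refine hω h fun z => ?_
        have h1 := hacc h.succ ih z
        have h2 := hM.abs_Qtilde_le hL hN0 hN h.succ z
        rw [abs_sub_comm] at h1
        have h3 := abs_add_le (M.Qhat N ntot ρ ω h.succ z - M.Qtilde N h.succ z)
          (M.Qtilde N h.succ z)
        rw [sub_add_cancel] at h3
        linarith
      · exact ih h' (Fin.succ_le_castSucc_iff.2 hlt)
  exact hacc k (hall k) z

/-- The probability that the algorithm fails, if the degree `N = 2dm` makes the bias small.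
The bias and the accumulated regression error each get a quarter of `ε / (3L)^H`. -/
theorem MDP.IsSmooth.measure_failure_le (hM : M.IsSmooth ν CT) (hL : IsVPBound (dS + dA) L)
    (hd : 0 < dS + dA) (hH : 0 < H) {m : ℕ} (hm : 0 < m)
    (hρ : ρ.IsQuasiOptimal (2 * ((dS + dA) * m))) (hn : 0 < ntot)
    (hm' : 0 < numFeatures (dS + dA) (2 * ((dS + dA) * m))) {ε τ : ℝ} (hε : 0 < ε) (hε1 : ε < 1)
    (hτ : τ = ε / (8 * H * L ^ H * (3 * L) ^ H))
    (hbias : H * ((1 + L) * ((2 * max CT 1 * L) ^ H * ((dS + dA : ℕ) * (2 / m : ℝ)) ^ (ν + 1))) ≤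
      ε / (3 * L) ^ H / 4) :
    M.dataLaw (2 * ((dS + dA) * m)) ntot ρ {ω | ¬ ∀ h : Fin H,
      supDist (M.Qstar h.castSucc) (M.Qhat (2 * ((dS + dA) * m)) ntot ρ ω h.castSucc) <
        ENNReal.ofReal (ε / (3 * L) ^ ((h : ℕ) + 1)) ∧
      supDist (M.Qtilde (2 * ((dS + dA) * m)) h.castSucc)
          (M.Qhat (2 * ((dS + dA) * m)) ntot ρ ω h.castSucc) <
        ENNReal.ofReal (ε / (3 * L) ^ ((h : ℕ) + 1))} ≤
    ENNReal.ofReal (H * ((7 * (2 * ((dS + dA) * m) : ℕ) *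
      numFeatures (dS + dA) (2 * ((dS + dA) * m))) ^ (dS + dA) * (2 * Real.exp
        (-τ ^ 2 / (2 * (2 * numFeatures (dS + dA) (2 * ((dS + dA) * m)) / ntot *
          (L * (1 + ((2 * max CT 1 * L) ^ H + 1))) ^ 2)))))) := by
  set N := 2 * ((dS + dA) * m) with hNdef
  have hN0 : 0 < N := by positivity
  have hN : Even N := even_two_mul _
  have hL1 := hL.one_le
  have hHr : (0 : ℝ) < H := by exact_mod_cast hH
  have hT : 1 ≤ (3 * L) ^ H := one_le_pow₀ (by linarith)
  have hτ0 : 0 ≤ τ := by rw [hτ]; positivity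
  set e := ε / (3 * L) ^ H with he
  have he0 : 0 < e := by positivity
  have he1 : e ≤ 1 := by
    rw [he, div_le_one (by positivity)]
    linarith
  refine (measure_mono ?_).trans
    (hM.dataLaw_le hL hd hN0 hN hρ hn hm' (B := (2 * max CT 1 * L) ^ H + 1) hτ0)
  intro ω hω hgood
  refine hω fun h => ?_
  have hτη : H * L ^ H * (2 * τ) ≤ e / 4 := by
    apply le_of_eq
    rw [hτ, he]
    field_simp
    norm_num
  have h1 := hM.abs_sub_Qhat_le hL hN0 hN (by positivity) (by linarith) hτη ω hgood h.castSucc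
  have h2 : ∀ z, |M.Qstar h.castSucc z - M.Qhat N ntot ρ ω h.castSucc z| ≤ e / 2 := by
    intro z
    have h3 := hM.abs_Qstar_sub_Qtilde_le hL hd hm h.castSucc z
    have h4 : ((H - (h.castSucc : ℕ) : ℕ) : ℝ) ≤ H := by exact_mod_cast Nat.sub_le _ _
    have h5 := abs_sub_le (M.Qstar h.castSucc z) (M.Qtilde N h.castSucc z)
      (M.Qhat N ntot ρ ω h.castSucc z)
    have h6 := h1 z
    have h7 : (0 : ℝ) ≤ (1 + L) *
        ((2 * max CT 1 * L) ^ H * ((dS + dA : ℕ) * (2 / m : ℝ)) ^ (ν + 1)) := by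
      have : 0 ≤ max CT 1 := zero_le_one.trans (le_max_right _ _)
      positivity
    have h8 := mul_le_mul_of_nonneg_right h4 h7
    linarith
  have h9 : e ≤ ε / (3 * L) ^ ((h : ℕ) + 1) := by
    rw [he]
    gcongr
    · linarith
    · exact h.2
  exact ⟨supDist_lt h2 (by linarith), supDist_lt h1 (by linarith)⟩

end

/-! ### The number of features and the number of samples -/

theorem numFeatures_le (d N : ℕ) : numFeatures d N ≤ (2 * N + 1) ^ d := by
  refine (Finset.card_filter_le _ _).trans (le_of_eq ?_)
  rw [Fintype.card_piFinset]
  simp only [Int.card_Icc, Finset.prod_const, Finset.card_univ, Fintype.card_fin]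
  congr 1
  omega

theorem le_numFeatures {d : ℕ} (hd : 0 < d) (N : ℕ) : N ≤ numFeatures d N := by
  have h : (Finset.range N).card ≤ (freqs d N).card := by
    refine Finset.card_le_card_of_injOn (fun i => Pi.single ⟨0, hd⟩ (i : ℤ)) (fun i hi => ?_) ?_
    · have hi' : i < N := Finset.mem_range.1 hi
      rw [Finset.mem_coe, mem_freqs, Finset.sum_eq_single ⟨0, hd⟩]
      · simp only [Pi.single_eq_same, Nat.abs_cast]
        exact_mod_cast hi'.le
      · intro j _ hj
        simp [Pi.single_eq_of_ne hj]
      · simp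
    · intro i _ j _ hij
      exact_mod_cast Pi.single_injective _ hij
  rwa [Finset.card_range] at h

theorem Design.samplesPerStage_le {d : ℕ} (ρ : Design d) (ntot : ℕ) :
    (ρ.samplesPerStage ntot : ℝ) ≤ 2 * (ntot + ρ.weight.support.card) := by
  rw [Design.samplesPerStage]
  push_cast
  refine mul_le_mul_of_nonneg_left ?_ zero_le_two
  have h1 : ∑ z ∈ ρ.weight.support, (⌈(ntot : ℝ) * ρ.weight z⌉₊ : ℝ) ≤
      ∑ z ∈ ρ.weight.support, ((ntot : ℝ) * ρ.weight z + 1) :=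
    Finset.sum_le_sum fun z _ =>
      (Nat.ceil_lt_add_one (mul_nonneg (Nat.cast_nonneg _) (ρ.nonneg z))).le
  refine h1.trans (le_of_eq ?_)
  have h2 : ∑ z ∈ ρ.weight.support, ρ.weight z = 1 := ρ.sum_eq_one
  rw [Finset.sum_add_distrib, ← Finset.mul_sum, h2]
  simp

/-! ### Choice of the degree and of the sample size -/

/-- All the constants that depend on `H`, on the dimension or on the kernel bound `L` are bounded by
powers of the single number `Y = (400 C M₀ L)^H`; the dimension is covered since `d ≤ 13 L`. -/
theorem growth_bounds {H d : ℕ} {L C M₀ Y : ℝ} (hL : 1 ≤ L) (hC : 1 ≤ C) (hM₀ : 1 ≤ M₀)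
    (hH : 0 < H) (hdL : (d : ℝ) ≤ 13 * L) (hY : Y = (400 * C * M₀ * L) ^ H) :
    400 * L ≤ Y ∧ (d : ℝ) ≤ Y ∧ M₀ ≤ Y ∧ (H : ℝ) ≤ Y ∧ L ^ H ≤ Y ∧ (2 * C * L) ^ H ≤ Y ∧
      (3 * L) ^ H ≤ Y := by
  have hCM : 1 ≤ C * M₀ := one_le_mul_of_one_le_of_one_le hC hM₀
  have hCML : 1 ≤ C * M₀ * L := one_le_mul_of_one_le_of_one_le hCM hL
  have hML : 1 ≤ M₀ * L := one_le_mul_of_one_le_of_one_le hM₀ hL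
  have h1 : 400 * C * M₀ * L ≤ Y := by
    rw [hY]
    exact le_self_pow₀ (by nlinarith) hH.ne'
  have h2 : 400 * L ≤ 400 * C * M₀ * L := by nlinarith
  have h3 : M₀ ≤ 400 * C * M₀ * L := by
    have : 1 ≤ C * L := one_le_mul_of_one_le_of_one_le hC hL
    nlinarith
  have hpow : ∀ b : ℝ, 0 ≤ b → b ≤ 400 * C * M₀ * L → b ^ H ≤ Y := fun b hb hb' => by
    rw [hY]
    exact pow_le_pow_left₀ hb hb' H
  have h4 : 2 * C * L ≤ 400 * C * M₀ * L := by
    have : 1 ≤ C * L := one_le_mul_of_one_le_of_one_le hC hL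
    nlinarith
  refine ⟨h2.trans h1, by linarith, h3.trans h1, ?_, hpow L (by linarith) (by nlinarith),
    hpow _ (by positivity) h4, hpow _ (by positivity) (by linarith)⟩
  have h5 : (H : ℝ) ≤ 2 ^ H := by exact_mod_cast (Nat.lt_two_pow_self).le
  exact h5.trans (hpow 2 (by norm_num) (by linarith))

theorem two_mul_add_le_pow {N F d : ℕ} (hN : 0 < N) (hF : F ≤ (2 * N + 1) ^ d) :
    (F : ℝ) ≤ (3 * N) ^ d := by
  have h : F ≤ (3 * N) ^ d := hF.trans (Nat.pow_le_pow_left (by omega) d)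
  exact_mod_cast h

/-- The choice `Λ = log (2H (7NÑ)^d) + log (1 + 1/δ)` of the logarithmic factor. -/
theorem log_factor_le {N F d H : ℕ} {Y r ℓ : ℝ} (hN : 0 < N) (hF0 : 0 < F) (hH : 0 < H)
    (hd : 0 < d) (hY : 400 ≤ Y) (hdY : (d : ℝ) ≤ Y) (hHY : (H : ℝ) ≤ Y) (hr : 1 ≤ r)
    (hN' : 21 * (N : ℝ) ≤ Y ^ 9 * r) (hF : (F : ℝ) ≤ (3 * N) ^ d) (hℓ : Real.log r ≤ ℓ) :
    Real.log (2 * H * (7 * N * F) ^ d) ≤ Y ^ 4 * (1 + ℓ) := by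
  have hN1 : (1 : ℝ) ≤ N := by exact_mod_cast hN
  have hF1 : (1 : ℝ) ≤ F := by exact_mod_cast hF0
  have hH1 : (1 : ℝ) ≤ H := by exact_mod_cast hH
  have hd1 : (1 : ℝ) ≤ d := by exact_mod_cast hd
  have hlr : 0 ≤ Real.log r := Real.log_nonneg hr
  have hlY : Real.log Y ≤ Y := (Real.log_le_sub_one_of_pos (by linarith)).trans (by linarith)
  have hlY0 : 0 ≤ Real.log Y := Real.log_nonneg (by linarith)
  have h1 : (7 * N * F : ℝ) ≤ (Y ^ 9 * r) ^ (d + 1) := by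
    calc (7 * N * F : ℝ) ≤ (21 * N) * (21 * N) ^ d := by
          have : (F : ℝ) ≤ (21 * N) ^ d := hF.trans (by gcongr; norm_num)
          gcongr
          norm_num
      _ = (21 * N) ^ (d + 1) := by rw [pow_succ]; ring
      _ ≤ _ := by gcongr
  have h2 : (2 * H * (7 * N * F) ^ d : ℝ) ≤ Y ^ 2 * ((Y ^ 9 * r) ^ (d + 1)) ^ d := by
    have : (2 * H : ℝ) ≤ Y ^ 2 := by nlinarith
    gcongr
  have h3 : Real.log (Y ^ 2 * ((Y ^ 9 * r) ^ (d + 1)) ^ d) =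
      2 * Real.log Y + d * ((d + 1) * (9 * Real.log Y + Real.log r)) := by
    rw [Real.log_mul (by positivity) (by positivity), Real.log_pow, Real.log_pow, Real.log_pow,
      Real.log_mul (by positivity) (by positivity), Real.log_pow]
    push_cast
    ring
  refine (Real.log_le_log (by positivity) h2).trans ?_
  rw [h3]
  have h4 : (d * (d + 1) : ℝ) ≤ 2 * Y ^ 2 := by nlinarith
  have h5 : 0 ≤ 9 * Real.log Y + Real.log r := by positivity
  have h6 : 9 * Real.log Y + Real.log r ≤ 9 * Y + ℓ := by linarith
  have hℓ0 : 0 ≤ ℓ := hlr.trans hℓ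
  calc 2 * Real.log Y + d * ((d + 1) * (9 * Real.log Y + Real.log r))
      = 2 * Real.log Y + (d * (d + 1)) * (9 * Real.log Y + Real.log r) := by ring
    _ ≤ 2 * Y + 2 * Y ^ 2 * (9 * Y + ℓ) := by gcongr
    _ ≤ Y ^ 4 * (1 + ℓ) := by
        have h7 : 2 * Y + 18 * Y ^ 3 ≤ Y ^ 4 := by
          have : Y ≤ Y ^ 3 := le_self_pow₀ (by linarith) (by norm_num)
          have h8 : Y ^ 4 = Y * Y ^ 3 := by ring
          have : 0 < Y ^ 3 := by positivity
          nlinarith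
        have h9 : 2 * Y ^ 2 ≤ Y ^ 4 := by
          have h8 : Y ^ 4 = Y ^ 2 * Y ^ 2 := by ring
          have : 2 ≤ Y ^ 2 := by nlinarith
          rw [h8]
          gcongr
        nlinarith [mul_le_mul_of_nonneg_right h9 hℓ0]

/-- The sample size `ntot = ⌈4ÑA²Λ/τ²⌉` makes the failure probability at most `δ`. -/
theorem failure_prob_le {F d H ntot N : ℕ} {A τ Λ δ : ℝ} (hN : 0 < N) (hF : 0 < F) (hH : 0 < H)
    (hA : 0 < A) (hτ : 0 < τ) (hδ : 0 < δ)
    (hΛ : Λ = Real.log (2 * H * (7 * N * F) ^ d) + Real.log (1 + 1 / δ)) (hn : 0 < ntot)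
    (hntot : 4 * F * A ^ 2 / τ ^ 2 * Λ ≤ ntot) :
    H * ((7 * N * F) ^ d * (2 * Real.exp (-τ ^ 2 / (2 * (2 * F / ntot * A ^ 2))))) ≤ δ := by
  have hF' : (0 : ℝ) < F := by exact_mod_cast hF
  have hN' : (0 : ℝ) < N := by exact_mod_cast hN
  have hH' : (0 : ℝ) < H := by exact_mod_cast hH
  have hn' : (0 : ℝ) < ntot := by exact_mod_cast hn
  have h1 : -τ ^ 2 / (2 * (2 * F / ntot * A ^ 2)) ≤ -Λ := by
    have h2 : -τ ^ 2 / (2 * (2 * F / ntot * A ^ 2)) = -(ntot * τ ^ 2 / (4 * F * A ^ 2)) := by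
      field_simp
      norm_num
    rw [h2, neg_le_neg_iff, le_div_iff₀ (by positivity)]
    rw [div_mul_eq_mul_div, div_le_iff₀ (by positivity)] at hntot
    linarith
  have h3 : Real.exp (-Λ) = (2 * (H : ℝ) * (7 * N * F) ^ d)⁻¹ * (1 + 1 / δ)⁻¹ := by
    rw [Real.exp_neg, hΛ, Real.exp_add, Real.exp_log (by positivity), Real.exp_log (by positivity),
      mul_inv]
  calc H * ((7 * N * F) ^ d * (2 * Real.exp (-τ ^ 2 / (2 * (2 * F / ntot * A ^ 2)))))
      ≤ H * ((7 * N * F) ^ d * (2 * Real.exp (-Λ))) := by gcongr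
    _ = (1 + 1 / δ)⁻¹ := by
        rw [h3]
        field_simp
    _ ≤ δ := by
        rw [inv_le_comm₀ (by positivity) hδ, inv_eq_one_div]
        linarith

/-- The resulting number of samples per stage. -/
theorem samples_le {F N d s ntot : ℕ} {A τ Λ Y r ℓ κ : ℝ} {k : ℕ} (hF3 : 3 ≤ F) (hN : 0 < N)
    (hd : 0 < d) (hY : 400 ≤ Y) (hr : 1 ≤ r) (hN' : 21 * (N : ℝ) ≤ Y ^ 9 * r)
    (hF : (F : ℝ) ≤ (3 * N) ^ d) (hs : (s : ℝ) ≤ 4 * F * Real.log (Real.log F))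
    (hA1 : 1 ≤ A) (hA : A ≤ Y ^ 3) (hτ0 : 0 < τ) (hτ1 : τ ≤ 1) (hτ : 1 / τ ≤ Y ^ 4 * r ^ k)
    (hΛF : Real.log F ≤ Λ) (hΛ : Λ ≤ Y ^ 4 * ℓ)
    (hntot : (ntot : ℝ) ≤ 4 * F * A ^ 2 / τ ^ 2 * Λ + 1) (hκ : κ = Y ^ (28 * d)) :
    2 * ((ntot : ℝ) + s) ≤ κ * r ^ (d + 2 * k) * ℓ := by
  have hF3' : (3 : ℝ) ≤ F := by exact_mod_cast hF3
  have hlogF : 1 ≤ Real.log F := by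
    rw [Real.le_log_iff_exp_le (by linarith)]
    linarith [Real.exp_one_lt_three]
  have hloglog : Real.log (Real.log F) ≤ Λ :=
    (Real.log_le_sub_one_of_pos (by linarith)).trans (by linarith)
  have hΛ1 : 1 ≤ Λ := hlogF.trans hΛF
  have hq : 1 ≤ A ^ 2 * (1 / τ) ^ 2 := by
    have h1 : 1 ≤ 1 / τ := by rw [le_div_iff₀ hτ0]; linarith
    exact one_le_mul_of_one_le_of_one_le (one_le_pow₀ hA1) (one_le_pow₀ h1)
  set X := F * (A ^ 2 * (1 / τ) ^ 2) * Λ with hX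
  have hFΛ : F * Λ ≤ X := by
    rw [hX]
    nlinarith [mul_nonneg (by linarith : (0 : ℝ) ≤ F) (by linarith : (0 : ℝ) ≤ Λ)]
  have hX1 : 1 ≤ X := by nlinarith
  have h2 : 4 * F * A ^ 2 / τ ^ 2 * Λ = 4 * X := by rw [hX]; field_simp
  have h3 : (s : ℝ) ≤ 4 * X := by
    refine hs.trans ?_
    have : F * Real.log (Real.log F) ≤ F * Λ := by gcongr
    linarith
  have h4 : 2 * ((ntot : ℝ) + s) ≤ Y * X := by
    rw [h2] at hntot
    nlinarith
  have hFY : (F : ℝ) ≤ (Y ^ 9 * r) ^ d := hF.trans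
    (pow_le_pow_left₀ (by positivity)
      (by linarith [(Nat.cast_nonneg N : (0 : ℝ) ≤ N)]) d)
  have hℓ : 0 ≤ ℓ := by
    have : 0 ≤ Y ^ 4 * ℓ := by linarith
    exact nonneg_of_mul_nonneg_right this (by positivity)
  have hτ' : 0 ≤ 1 / τ := by positivity
  calc 2 * ((ntot : ℝ) + s) ≤ Y * X := h4
    _ ≤ Y * ((Y ^ 9 * r) ^ d * ((Y ^ 3) ^ 2 * (Y ^ 4 * r ^ k) ^ 2) * (Y ^ 4 * ℓ)) := by
        rw [hX]
        gcongr
    _ = Y ^ (9 * d + 19) * r ^ (d + 2 * k) * ℓ := by ring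
    _ ≤ κ * r ^ (d + 2 * k) * ℓ := by
        rw [hκ]
        gcongr
        · linarith
        · omega

/-- The degree `N = 2dm`, with `m = ⌈2 d S₀ M₀ r⌉` and `r = ε^{-1/k}`. Here `S₀ / ε` is the factor
by which the bias has to be reduced, and `M₀` is a lower bound for `m`. -/
theorem exists_degree {d H k : ℕ} {L C M₀ Y ε r : ℝ} (hd : 0 < d) (hH : 0 < H) (hk : 0 < k)
    (hL : 1 ≤ L) (hC : 1 ≤ C) (hM₀ : 1 ≤ M₀) (hdL : (d : ℝ) ≤ 13 * L)
    (hY : Y = (400 * C * M₀ * L) ^ H) (hε : 0 < ε) (hr : 1 ≤ r) (hrk : r ^ k = 1 / ε) :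
    ∃ m : ℕ, 0 < m ∧ M₀ ≤ m ∧
      ((2 * (d * m) : ℕ) : ℝ) ≤
        8 * d ^ 2 * (4 * H * (1 + L) * (2 * C * L) ^ H * (3 * L) ^ H) * M₀ * r ∧
      H * ((1 + L) * ((2 * C * L) ^ H * (d * (2 / m : ℝ)) ^ k)) ≤ ε / (3 * L) ^ H / 4 ∧
      21 * ((2 * (d * m) : ℕ) : ℝ) ≤ Y ^ 9 * r := by
  have hd1 : (1 : ℝ) ≤ d := by exact_mod_cast hd
  have hH1 : (1 : ℝ) ≤ H := by exact_mod_cast hH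
  obtain ⟨hYL, hdY, hMY, hHY, hLY, hxY, hTY⟩ := growth_bounds hL hC hM₀ hH hdL hY
  have hY400 : 400 ≤ Y := by linarith
  have hCL : 1 ≤ C * L := one_le_mul_of_one_le_of_one_le hC hL
  have hx1 : 1 ≤ (2 * C * L) ^ H := one_le_pow₀ (by linarith)
  have hT1 : 1 ≤ (3 * L) ^ H := one_le_pow₀ (by linarith)
  generalize (2 * C * L) ^ H = x at *
  generalize (3 * L) ^ H = T at *
  obtain ⟨S₀, hS₀⟩ : ∃ S₀, S₀ = 4 * H * (1 + L) * x * T := ⟨_, rfl⟩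
  rw [← hS₀]
  have hS₀1 : 1 ≤ S₀ := by
    have h1 : 1 ≤ 4 * H * (1 + L) := by nlinarith
    rw [hS₀]
    exact one_le_mul_of_one_le_of_one_le (one_le_mul_of_one_le_of_one_le h1 hx1) hT1
  have hdS : 1 ≤ d * S₀ := one_le_mul_of_one_le_of_one_le hd1 hS₀1
  have hdSM : 1 ≤ d * S₀ * M₀ := one_le_mul_of_one_le_of_one_le hdS hM₀
  have hdSMr : 1 ≤ d * S₀ * M₀ * r := one_le_mul_of_one_le_of_one_le hdSM hr
  have hm1 : 2 * d * S₀ * M₀ * r ≤ ⌈2 * d * S₀ * M₀ * r⌉₊ := Nat.le_ceil _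
  have hm2 := Nat.ceil_lt_add_one (by linarith : 0 ≤ 2 * d * S₀ * M₀ * r)
  generalize ⌈2 * d * S₀ * M₀ * r⌉₊ = m at *
  have hm3 : (m : ℝ) ≤ 4 * d * S₀ * M₀ * r := by linarith
  have hmpos : (0 : ℝ) < m := by linarith
  have hNle : ((2 * (d * m) : ℕ) : ℝ) ≤ 8 * d ^ 2 * S₀ * M₀ * r := by
    push_cast
    nlinarith [mul_le_mul_of_nonneg_left hm3 (by linarith : (0 : ℝ) ≤ d)]
  refine ⟨m, by exact_mod_cast hmpos, ?_, hNle, ?_, ?_⟩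
  · have : M₀ ≤ d * S₀ * r * M₀ := le_mul_of_one_le_left (by linarith)
      (one_le_mul_of_one_le_of_one_le hdS hr)
    linarith
  · have h1 : d * (2 / m : ℝ) ≤ 1 / (S₀ * r) := by
      rw [mul_div_assoc', div_le_div_iff₀ hmpos (by positivity)]
      have : d * S₀ * r * 1 ≤ d * S₀ * r * M₀ := by gcongr
      linarith
    have h2 : (d * (2 / m : ℝ)) ^ k ≤ ε / S₀ := by
      calc (d * (2 / m : ℝ)) ^ k ≤ (1 / (S₀ * r)) ^ k := by gcongr
        _ = ε / S₀ ^ k := by rw [div_pow, mul_pow, hrk, one_pow]; field_simp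
        _ ≤ ε / S₀ := by
            gcongr
            exact le_self_pow₀ hS₀1 hk.ne'
    calc H * ((1 + L) * (x * (d * (2 / m : ℝ)) ^ k))
        ≤ H * ((1 + L) * (x * (ε / S₀))) := by gcongr
      _ = ε / T / 4 := by rw [hS₀]; field_simp
  · have h1 : S₀ ≤ Y ^ 5 := by
      have h3 : 4 * (1 + L) ≤ Y := by linarith
      have h4 : 1 ≤ Y := by linarith
      calc S₀ = H * (4 * (1 + L)) * x * T := by rw [hS₀]; ring
        _ ≤ Y * Y * Y * Y := by gcongr
        _ ≤ Y * Y * Y * Y * Y := le_mul_of_one_le_right (by positivity) h4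
        _ = Y ^ 5 := by ring
    calc 21 * ((2 * (d * m) : ℕ) : ℝ) ≤ 21 * (8 * d ^ 2 * S₀ * M₀ * r) := by gcongr
      _ = 168 * d ^ 2 * S₀ * M₀ * r := by ring
      _ ≤ Y * Y ^ 2 * Y ^ 5 * Y * r := by
          have : (168 : ℝ) ≤ Y := by linarith
          gcongr
      _ = Y ^ 9 * r := by ring

/-- The sample size that makes the failure probability at most `δ`. The parameters stand for
`P = L^H`, `x = (2CL)^H` and `T = (3L)^H`: the regression has to be accurate up to
`τ = ε / (8HPT)`, since its errors are amplified by at most `2HP` and a quarter of `ε / T` is available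
for them; the targets have absolute value at most `L (1 + (x + 1))`. -/
theorem exists_sampleSize {F N d H k : ℕ} {L x T P Y ε r δ : ℝ} (hF3 : 3 ≤ F) (hN : 0 < N)
    (hd : 0 < d) (hH : 0 < H) (hL : 1 ≤ L) (hx : 1 ≤ x) (hT : 1 ≤ T) (hP : 1 ≤ P)
    (hY : 400 ≤ Y) (hLY : L ≤ Y) (hdY : (d : ℝ) ≤ Y) (hHY : (H : ℝ) ≤ Y) (hxY : x ≤ Y)
    (hTY : T ≤ Y) (hPY : P ≤ Y) (hε : 0 < ε) (hε1 : ε < 1) (hr : 1 ≤ r) (hrk : r ^ k = 1 / ε)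
    (hlogr : Real.log r ≤ Real.log (1 / ε))
    (hN' : 21 * (N : ℝ) ≤ Y ^ 9 * r) (hF : (F : ℝ) ≤ (3 * N) ^ d) (hδ : 0 < δ) :
    ∃ ntot : ℕ, 0 < ntot ∧
      H * ((7 * N * F) ^ d * (2 * Real.exp (-(ε / (8 * H * P * T)) ^ 2 /
        (2 * (2 * F / ntot * (L * (1 + (x + 1))) ^ 2))))) ≤ δ ∧
      ∀ s : ℕ, (s : ℝ) ≤ 4 * F * Real.log (Real.log F) →
        2 * ((ntot : ℝ) + s) ≤ Y ^ (28 * d) * r ^ (d + 2 * k) *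
          (1 + Real.log (1 / ε) + Real.log (1 + 1 / δ)) := by
  have hH1 : (1 : ℝ) ≤ H := by exact_mod_cast hH
  have hF3' : (3 : ℝ) ≤ F := by exact_mod_cast hF3
  have hN1 : (1 : ℝ) ≤ N := by exact_mod_cast hN
  obtain ⟨τ, hτ⟩ : ∃ τ, τ = ε / (8 * H * P * T) := ⟨_, rfl⟩
  obtain ⟨A, hA⟩ : ∃ A, A = L * (1 + (x + 1)) := ⟨_, rfl⟩
  obtain ⟨Λ, hΛ⟩ : ∃ Λ, Λ = Real.log (2 * H * (7 * N * F) ^ d) + Real.log (1 + 1 / δ) := ⟨_, rfl⟩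
  rw [← hτ, ← hA]
  have hτ0 : 0 < τ := by rw [hτ]; positivity
  have hA1 : 1 ≤ A := by rw [hA]; exact one_le_mul_of_one_le_of_one_le hL (by linarith)
  have hlogδ : 0 ≤ Real.log (1 + 1 / δ) := Real.log_nonneg (by
    have : 0 < 1 / δ := by positivity
    linarith)
  have hlogε : 0 ≤ Real.log (1 / ε) := (Real.log_nonneg hr).trans hlogr
  have hΛF : Real.log F ≤ Λ := by
    have h1 : (F : ℝ) ≤ 2 * H * (7 * N * F) ^ d := by
      have h2 : (F : ℝ) ≤ 7 * N * F := by nlinarith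
      have h3 : 7 * N * F ≤ (7 * N * F : ℝ) ^ d := le_self_pow₀ (by linarith) hd.ne'
      nlinarith
    have h4 := Real.log_le_log (by linarith) h1
    linarith
  have hΛ0 : 0 < Λ := (Real.log_pos (by linarith)).trans_le hΛF
  have hX0 : 0 < 4 * F * A ^ 2 / τ ^ 2 * Λ := by positivity
  have hn : 0 < ⌈4 * F * A ^ 2 / τ ^ 2 * Λ⌉₊ := Nat.ceil_pos.2 hX0
  refine ⟨⌈4 * F * A ^ 2 / τ ^ 2 * Λ⌉₊, hn, failure_prob_le hN (by omega) hH (by linarith) hτ0 hδ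
    hΛ hn (Nat.le_ceil _), fun s hs => ?_⟩
  have hAY : A ≤ Y ^ 3 := by
    have h1 : 1 + (x + 1) ≤ Y ^ 2 := by nlinarith
    calc A ≤ Y * Y ^ 2 := by rw [hA]; gcongr
      _ = Y ^ 3 := by ring
  have hτ1 : τ ≤ 1 := by
    rw [hτ, div_le_one (by positivity)]
    have h1 : 1 ≤ 8 * H * P * T := one_le_mul_of_one_le_of_one_le
      (one_le_mul_of_one_le_of_one_le (by linarith) hP) hT
    linarith
  have hτY : 1 / τ ≤ Y ^ 4 * r ^ k := by
    rw [hrk, hτ, one_div_div, div_eq_mul_one_div]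
    have h1 : 8 * H * P * T ≤ Y * Y * Y * Y := by
      have : (8 : ℝ) ≤ Y := by linarith
      gcongr
    have h2 : Y * Y * Y * Y = Y ^ 4 := by ring
    rw [← h2]
    gcongr
  have hΛY : Λ ≤ Y ^ 4 * (1 + Real.log (1 / ε) + Real.log (1 + 1 / δ)) := by
    have h1 := log_factor_le hN (by omega) hH hd hY hdY hHY hr hN' hF hlogr
    have h2 : (1 : ℝ) ≤ Y ^ 4 := one_le_pow₀ (by linarith)
    rw [hΛ]
    nlinarith
  exact samples_le hF3 hN hd hY hr hN' hF hs hA1 hAY hτ0 hτ1 hτY hΛF hΛY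
    (Nat.ceil_lt_add_one hX0.le).le rfl

end SmoothMDP

end

theorem mainTheorem2 :
    (∀ d : ℕ, ∃ L : ℝ, SmoothMDP.IsVPBound d L) ∧
    ∀ (ν : ℕ) (CT : ℝ), ∃ c : ℕ, ∀ (dS dA H : ℕ), 0 < dS + dA → 0 < H →
      ∀ L : ℝ, SmoothMDP.IsVPBound (dS + dA) L →
      ∃ CN : ℝ, ∀ ε : ℝ, 0 < ε → ε < 1 →
      ∃ N : ℕ, 0 < N ∧ Even N ∧ (N : ℝ) ≤ CN * ε ^ (-(1 : ℝ) / ((ν : ℝ) + 1)) ∧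
        (∃ ρ : SmoothMDP.Design (dS + dA), ρ.IsQuasiOptimal N) ∧
        ∀ δ : ℝ, 0 < δ →
        ∃ ntot : ℕ, ∀ ρ : SmoothMDP.Design (dS + dA), ρ.IsQuasiOptimal N →
          (ρ.samplesPerStage ntot : ℝ) ≤
            (c * L) ^ (c * H * (dS + dA)) *
              ε ^ (-(((dS + dA : ℕ) : ℝ) + 2 * ((ν : ℝ) + 1)) / ((ν : ℝ) + 1)) *
              (1 + Real.log (1 / ε) + Real.log (1 + 1 / δ)) ^ c ∧
          ∀ M : SmoothMDP.MDP dS dA H, M.IsSmooth ν CT →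
            M.dataLaw N ntot ρ {ω | ¬ ∀ h : Fin H,
              SmoothMDP.supDist (M.Qstar h.castSucc) (M.Qhat N ntot ρ ω h.castSucc) <
                ENNReal.ofReal (ε / (3 * L) ^ ((h : ℕ) + 1)) ∧
              SmoothMDP.supDist (M.Qtilde N h.castSucc) (M.Qhat N ntot ρ ω h.castSucc) <
                ENNReal.ofReal (ε / (3 * L) ^ ((h : ℕ) + 1))} ≤ ENNReal.ofReal δ := by
  refine ⟨SmoothMDP.exists_isVPBound, fun ν CT => ?_⟩
  -- Since `Ñ ≥ N ≥ M₀`, quasi-optimal designs exist.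
  obtain ⟨C, hC⟩ : ∃ C, C = max CT 1 := ⟨_, rfl⟩
  obtain ⟨M₀, hM₀⟩ : ∃ M₀, M₀ = Real.exp (Real.exp 3) := ⟨_, rfl⟩
  have hC1 : 1 ≤ C := hC ▸ le_max_right _ _
  have hM₀1 : 1 ≤ M₀ := hM₀ ▸ Real.one_le_exp (Real.exp_pos 3).le
  have hCM : 1 ≤ C * M₀ := one_le_mul_of_one_le_of_one_le hC1 hM₀1
  obtain ⟨c, hc⟩ : ∃ c : ℕ, 400 * C * M₀ ≤ c := exists_nat_ge _
  have hc400 : 400 ≤ c := by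
    have : (400 : ℝ) ≤ c := by linarith
    exact_mod_cast this
  refine ⟨c, fun dS dA H hd hH L hL => ?_⟩
  have hL1 := hL.one_le
  obtain ⟨Y, hY⟩ : ∃ Y, Y = (400 * C * M₀ * L) ^ H := ⟨_, rfl⟩
  obtain ⟨hYL, hdY, hMY, hHY, hLY, hxY, hTY⟩ :=
    SmoothMDP.growth_bounds hL1 hC1 hM₀1 hH hL.dim_le hY
  have hCL : 1 ≤ C * L := one_le_mul_of_one_le_of_one_le hC1 hL1
  refine ⟨8 * ((dS + dA : ℕ) : ℝ) ^ 2 *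
    (4 * H * (1 + L) * (2 * C * L) ^ H * (3 * L) ^ H) * M₀, fun ε hε hε1 => ?_⟩
  obtain ⟨r, hr⟩ : ∃ r, r = ε ^ (-(1 : ℝ) / ((ν : ℝ) + 1)) := ⟨_, rfl⟩
  have hν : (ν : ℝ) + 1 ≠ 0 := by positivity
  have hr1 : 1 ≤ r := by
    rw [hr]
    exact Real.one_le_rpow_of_pos_of_le_one_of_nonpos hε hε1.le (by
      rw [neg_div]
      exact neg_nonpos.2 (by positivity))
  have hrk : r ^ (ν + 1) = 1 / ε := by
    rw [hr, ← Real.rpow_natCast, ← Real.rpow_mul hε.le]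
    push_cast
    rw [div_mul_cancel₀ _ hν, Real.rpow_neg_one, one_div]
  have hlogr : Real.log r ≤ Real.log (1 / ε) := by
    rw [← hrk, Real.log_pow]
    have h0 := Real.log_nonneg hr1
    push_cast
    nlinarith [mul_nonneg (Nat.cast_nonneg ν : (0 : ℝ) ≤ ν) h0]
  obtain ⟨m, hm0, hMm, hNle, hbias, hN21⟩ := SmoothMDP.exists_degree hd hH (Nat.succ_pos ν) hL1 hC1
    hM₀1 hL.dim_le hY hε hr1 hrk
  have hN0 : 0 < 2 * ((dS + dA) * m) := by positivity
  have hFm : (m : ℝ) ≤ SmoothMDP.numFeatures (dS + dA) (2 * ((dS + dA) * m)) := by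
    have h1 := SmoothMDP.le_numFeatures hd (2 * ((dS + dA) * m))
    have h2 : m ≤ 2 * ((dS + dA) * m) := by nlinarith
    exact_mod_cast h2.trans h1
  have hFN := SmoothMDP.two_mul_add_le_pow hN0
    (SmoothMDP.numFeatures_le (dS + dA) (2 * ((dS + dA) * m)))
  have hFpos : (0 : ℝ) < SmoothMDP.numFeatures (dS + dA) (2 * ((dS + dA) * m)) := by linarith
  have hloglog : 3 ≤ Real.log (Real.log
      (SmoothMDP.numFeatures (dS + dA) (2 * ((dS + dA) * m)))) := by
    have h1 : Real.exp 3 ≤ Real.log (SmoothMDP.numFeatures (dS + dA) (2 * ((dS + dA) * m))) := by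
      rw [Real.le_log_iff_exp_le hFpos, ← hM₀]
      exact hMm.trans hFm
    rwa [Real.le_log_iff_exp_le ((Real.exp_pos 3).trans_le h1)]
  have hF3 : 3 ≤ SmoothMDP.numFeatures (dS + dA) (2 * ((dS + dA) * m)) := by
    have h1 := Real.add_one_le_exp 3
    have h2 := Real.add_one_le_exp (Real.exp 3)
    have h3 : (3 : ℝ) ≤ SmoothMDP.numFeatures (dS + dA) (2 * ((dS + dA) * m)) := by linarith
    exact_mod_cast h3
  refine ⟨2 * ((dS + dA) * m), hN0, even_two_mul _, hr ▸ hNle,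
    SmoothMDP.exists_isQuasiOptimal _ _ (by linarith), fun δ hδ => ?_⟩
  obtain ⟨ntot, hn, hprob, hsamples⟩ := SmoothMDP.exists_sampleSize hF3 hN0 hd hH hL1
    (one_le_pow₀ (by linarith) : 1 ≤ (2 * C * L) ^ H)
    (one_le_pow₀ (by linarith) : 1 ≤ (3 * L) ^ H) (one_le_pow₀ hL1 : 1 ≤ L ^ H)
    (by linarith) (by linarith) hdY hHY hxY hTY hLY hε hε1 hr1 hrk hlogr hN21 hFN hδ
  refine ⟨ntot, fun ρ hρ => ⟨?_, fun M hM => ?_⟩⟩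
  · refine (ρ.samplesPerStage_le ntot).trans ((hsamples _ hρ.card_le).trans ?_)
    have hrexp : r ^ (dS + dA + 2 * (ν + 1)) =
        ε ^ (-(((dS + dA : ℕ) : ℝ) + 2 * ((ν : ℝ) + 1)) / ((ν : ℝ) + 1)) := by
      rw [hr, ← Real.rpow_natCast, ← Real.rpow_mul hε.le]
      congr 1
      push_cast
      ring
    have hκ : Y ^ (28 * (dS + dA)) ≤ (c * L) ^ (c * H * (dS + dA)) := by
      have hcL : 1 ≤ c * L := by nlinarith
      rw [hY, ← pow_mul]
      calc (400 * C * M₀ * L) ^ (H * (28 * (dS + dA)))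
          ≤ (c * L) ^ (H * (28 * (dS + dA))) := by gcongr
        _ ≤ (c * L) ^ (c * H * (dS + dA)) := pow_le_pow_right₀ hcL (by
            calc H * (28 * (dS + dA)) = 28 * H * (dS + dA) := by ring
              _ ≤ c * H * (dS + dA) := by gcongr; omega)
    have hlogε : 0 ≤ Real.log (1 / ε) := (Real.log_nonneg hr1).trans hlogr
    have hlogδ : 0 ≤ Real.log (1 + 1 / δ) := Real.log_nonneg (by
      have : 0 < 1 / δ := by positivity
      linarith)
    have hlog : 1 + Real.log (1 / ε) + Real.log (1 + 1 / δ) ≤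
        (1 + Real.log (1 / ε) + Real.log (1 + 1 / δ)) ^ c :=
      le_self_pow₀ (by linarith) (by omega)
    rw [← hrexp]
    gcongr
  · refine (hM.measure_failure_le hL hd hH hm0 hρ hn (by omega) hε hε1 rfl ?_).trans
      (ENNReal.ofReal_le_ofReal ?_)
    · rw [← hC]
      exact hbias
    · rw [← hC]
      exact hprob
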